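/- For a finite graph $G=(V,E)$ let $IGL(G)=\sum_{\{u,v\}\subseteq V,\,u\ne v}\frac{1}{d_G(u,v)}$, where $d_G(u,v)$ is the number of edges of a shortest path from $u$ to $v$, and $\frac1{d_G(u,v)}=0$ if there is no such path. The problem MinIGL asks, for a graph $G$, an integer $k\ge 0$ and a real number $\tau$: is there a set $S$ of exactly $k$ vertices of $G$ such that $IGL(G-S)\le\tau$? A real RAM is a random access machine whose memory cells each hold one real number. In unit time it performs an addition, a subtraction, a multiplication, a division or a comparison of real numbers, or a direct or indirect memory access (through an address that is a natural number); it has no operation for rounding and no modulo operation. Its space is counted in memory cells. Theorem. There is a real RAM algorithm that decides MinIGL on trees: for every tree $T$ with $n$ vertices (given, together with $n$, by its adjacency matrix), every integer $k \ge 0$ and every real $\tau$, it decides correctly whether $(T,k,\tau)$ is a Yes-instance of MinIGL. It takes $2^{O\left((n\log n)^{5/6}\right)}$ time and $O(n^3)$ space, where the implied constants depend on nothing (in particular not on $T$, $k$ or $\tau$). -/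

import Mathlib

open scoped Asymptotics

/-! ## Inverse geodesic length and the decision problem MinIGL -/

namespace SimpleGraph

variable {V : Type*}

open Classical in
/-- The inverse distance `1 / d_G(u, v)`, with the convention `1 / ∞ = 0` for vertices that are
not joined by a path. -/
noncomputable def invDist (G : SimpleGraph V) (u v : V) : ℝ :=
  if G.Reachable u v then 1 / (G.dist u v : ℝ) else 0

theorem invDist_comm (G : SimpleGraph V) (u v : V) : G.invDist u v = G.invDist v u := by
  by_cases h : G.Reachable u v
  · simp [invDist, h, h.symm, G.dist_comm]
  · have h' : ¬ G.Reachable v u := fun h'' => h h''.symm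
    simp [invDist, h, h']

open Classical in
/-- The inverse geodesic length: the sum of `1 / d_G(u, v)` over all unordered pairs `{u, v}` of
two distinct vertices. -/
noncomputable def igl [Fintype V] (G : SimpleGraph V) : ℝ :=
  ∑ e : Sym2 V with ¬ e.IsDiag, Sym2.lift ⟨G.invDist, G.invDist_comm⟩ e

open Classical in
/-- `(G, k, τ)` is a Yes-instance of MinIGL: some set `S` of exactly `k` vertices can be deleted
such that the remaining graph `G - S` has inverse geodesic length at most `τ`. -/
def MinIGL [Fintype V] (G : SimpleGraph V) (k : ℕ) (τ : ℝ) : Prop :=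
  ∃ S : Finset V, S.card = k ∧ (G.induce {v | v ∉ S}).igl ≤ τ

end SimpleGraph

/-! ## The real RAM -/

namespace RealRAM

/-- The memory: cells `0, 1, 2, …`, each of which holds one real number. -/
abbrev Mem : Type := ℕ → ℝ

/-- The instructions. `M[a]` is the content of cell `a`. There is no rounding, no modulo, and no
other conversion of reals to integers. -/
inductive Instr : Type
  /-- `M[d] := q` -/
  | const (d : ℕ) (q : ℚ)
  /-- `M[d] := M[a]` -/
  | copy (d a : ℕ)
  /-- `M[d] := M[a] + M[b]` -/
  | add (d a b : ℕ)
  /-- `M[d] := M[a] - M[b]` -/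
  | sub (d a b : ℕ)
  /-- `M[d] := M[a] * M[b]` -/
  | mul (d a b : ℕ)
  /-- `M[d] := M[a] / M[b]`; division by zero is a fault -/
  | div (d a b : ℕ)
  /-- `M[d] := M[M[a]]`; it is a fault if `M[a]` is not a natural number -/
  | load (d a : ℕ)
  /-- `M[M[d]] := M[a]`; it is a fault if `M[d]` is not a natural number -/
  | store (d a : ℕ)
  /-- if `M[a] ≤ M[b]` then continue with instruction number `l`, otherwise with the next one -/
  | jumpLE (a b l : ℕ)
  /-- stop and answer `ans` -/
  | halt (ans : Bool)

/-- A program is a finite list of instructions, numbered from `0`. -/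
abbrev Program : Type := List Instr

/-- A configuration: the number of the instruction to be executed next, and the memory. -/
structure Config where
  pc : ℕ
  mem : Mem

open Classical in
/-- The address denoted by a real number: defined only if the number is a natural number. -/
noncomputable def address (x : ℝ) : Option ℕ :=
  if ((⌊x⌋₊ : ℕ) : ℝ) = x then some ⌊x⌋₊ else none

/-- Write `x` into cell `d` and move on to the next instruction. -/
def Config.write (c : Config) (d : ℕ) (x : ℝ) : Config :=
  ⟨c.pc + 1, Function.update c.mem d x⟩

open Classical in
/-- The effect of one instruction; `none` stands for a fault, and for `halt`, which has no
successor configuration. -/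
noncomputable def Instr.exec (c : Config) : Instr → Option Config
  | const d q => some (c.write d (q : ℝ))
  | copy d a => some (c.write d (c.mem a))
  | add d a b => some (c.write d (c.mem a + c.mem b))
  | sub d a b => some (c.write d (c.mem a - c.mem b))
  | mul d a b => some (c.write d (c.mem a * c.mem b))
  | div d a b => if c.mem b = 0 then none else some (c.write d (c.mem a / c.mem b))
  | load d a => (address (c.mem a)).map fun i => c.write d (c.mem i)
  | store d a => (address (c.mem d)).map fun i => c.write i (c.mem a)
  | jumpLE a b l => some ⟨if c.mem a ≤ c.mem b then l else c.pc + 1, c.mem⟩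
  | halt _ => none

/-- The addresses of the cells that an instruction reads or writes. -/
noncomputable def Instr.cells (c : Config) : Instr → List ℕ
  | const d _ => [d]
  | copy d a => [d, a]
  | add d a b => [d, a, b]
  | sub d a b => [d, a, b]
  | mul d a b => [d, a, b]
  | div d a b => [d, a, b]
  | load d a => [d, a] ++ (address (c.mem a)).toList
  | store d a => [d, a] ++ (address (c.mem d)).toList
  | jumpLE a b _ => [a, b]
  | halt _ => []

/-- `P.Reaches s c t c'`: started in configuration `c`, the program `P` is in configuration `c'`
after exactly `t` executed instructions, and all cells that these instructions read or write are
among the cells `0, …, s - 1`. -/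
inductive Program.Reaches (P : Program) (s : ℕ) : Config → ℕ → Config → Prop
  | refl (c : Config) : Program.Reaches P s c 0 c
  | step {c c' c'' : Config} {t : ℕ} (i : Instr) (hi : P[c.pc]? = some i)
      (hs : ∀ a ∈ i.cells c, a < s) (hc : i.exec c = some c')
      (h : Program.Reaches P s c' t c'') : Program.Reaches P s c (t + 1) c''

/-- Started at instruction `0` with memory `m`, the program `P` halts with the answer `ans` after
executing exactly `t` instructions (including the final `halt`), with all cells that it reads or
writes among the cells `0, …, s - 1`. -/
def Program.Answers (P : Program) (m : Mem) (ans : Bool) (t s : ℕ) : Prop :=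
  ∃ (t' : ℕ) (c : Config), t = t' + 1 ∧ P.Reaches s ⟨0, m⟩ t' c ∧
    P[c.pc]? = some (Instr.halt ans)

open Classical in
/-- The initial memory for an instance `(G, k, τ)` on the vertices `0, …, n - 1`: the numbers `n`,
`k`, `τ`, followed by the adjacency matrix of `G`, row by row; all other cells hold `0`. -/
noncomputable def input {n : ℕ} (G : SimpleGraph (Fin n)) (k : ℕ) (τ : ℝ) : Mem
  | 0 => n
  | 1 => k
  | 2 => τ
  | a + 3 => if ∃ i j : Fin n, a = n * i + j ∧ G.Adj i j then 1 else 0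

end RealRAM

/-! Geodesics in a tree are unique, so a deletion set `S` destroys exactly the pairs whose geodesic
meets `S` and leaves all other distances unchanged. Hence twice the objective is `pairSum`, the sum
of inverse distances over ordered pairs whose geodesic avoids `S` (`IsTree.minIGL_iff`).

The combinatorial core is `IsTree.card_liveSet_lt`: an optimal `S` with `k > 0` vertices leaves only
components with fewer than `3200 (n/k)^3` vertices. Root the tree. The sets of vertices with a given
last ancestor in `S` are disjoint, so some `s` in `S` has such a set of size `q ≤ n/k`. Exchange `s`
for any other vertex `x`; by optimality, what `x` destroys is at most what putting `s` back
restores. The restored pairs have an end in the small set of `s`, so they are worth little: about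
`q` times the sum of `1/d(s, w)` over a single component above `s`. Choosing `x` as a centroid of a
largest component, of size `p`, gains at least `p/2`. This forces many vertices (at least `599 q^2`)
to lie within distance `16 q` of `s` if `p ≥ 3200 q^3`. A centroid of this ball then gains too much,
since all distances in the ball are at most `32 q`.

Let `M` be `cutoff n`, which is about `8 n^(3/4)` and at most `n`. Either `S` has at most `M`
vertices, or every component of `T - S` has. In both cases the component of a vertex inside its own
subtree (its crown) is described by at most `M` vertices and one bit, that is, by one of `2 (n+1)^M`
probes (`encodable_of_optimal`). A dynamic programme over subtrees tries all probes at every vertex.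
A crown determines its border, the deleted vertices just below it, and the objective of a subtree is
that of the crown plus those of the subtrees hanging below the border (`IsTree.pairSum_subtree`,
`IsTree.exists_glue`). For every number of deletions, the values of these smaller subtrees are
combined by min-plus convolution.

For the real RAM, the algorithm is written in a small language of bounded loops over arrays,
compiled into a fixed program (`Ex.runs`, `St.runs`), and verified by weakest preconditions. All
loops have at most `(n+1)^(M+1)` rounds and the nesting depth is fixed, so the time is a polynomial
in this number, that is `2^O(n^(3/4) log n)`. The stated bound follows because `(log n)^(1/6) ≤ 2
n^(1/12)`. Rounding is avoided by counting: a quotient is the number of positive multiples that do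
not exceed the dividend. -/

namespace RealRAM

/-! ## Position-independent blocks of code -/

/-- Move the jump target of an instruction by `p`. -/
def Instr.shift (p : ℕ) : Instr → Instr
  | .jumpLE a b l => .jumpLE a b (p + l)
  | i => i

theorem Instr.shift_shift (p q : ℕ) (i : Instr) : (i.shift q).shift p = i.shift (p + q) := by
  cases i <;> simp [Instr.shift, Nat.add_assoc]

/-- The block `c`, whose jump targets are relative to its beginning, stands in `P` at position
`p`. -/
def CodeAt (P : Program) (p : ℕ) (code : List Instr) : Prop :=
  ∀ i ins, code[i]? = some ins → P[p + i]? = some (ins.shift p)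

/-- Concatenation of blocks with relative jump targets. -/
def cat (c₁ c₂ : List Instr) : List Instr := c₁ ++ c₂.map (Instr.shift c₁.length)

@[simp] theorem length_cat (c₁ c₂ : List Instr) : (cat c₁ c₂).length = c₁.length + c₂.length := by
  simp [cat]

theorem CodeAt.left {P : Program} {p : ℕ} {c₁ c₂ : List Instr} (h : CodeAt P p (cat c₁ c₂)) :
    CodeAt P p c₁ := by
  intro i ins hi
  apply h
  rw [cat, List.getElem?_append_left (List.getElem?_eq_some_iff.1 hi).1, hi]

theorem CodeAt.right {P : Program} {p : ℕ} {c₁ c₂ : List Instr} (h : CodeAt P p (cat c₁ c₂)) :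
    CodeAt P (p + c₁.length) c₂ := by
  intro i ins hi
  have := h (c₁.length + i) (ins.shift c₁.length) (by
    rw [cat, List.getElem?_append_right (by omega)]
    simp [hi])
  rw [Nat.add_assoc, this, Instr.shift_shift]

theorem Program.Reaches.trans {P : Program} {s : ℕ} {c₁ c₂ c₃ : Config} {t₁ t₂ : ℕ}
    (h₁ : P.Reaches s c₁ t₁ c₂) (h₂ : P.Reaches s c₂ t₂ c₃) : P.Reaches s c₁ (t₁ + t₂) c₃ := by
  induction h₁ with
  | refl c => simpa using h₂
  | @step a b c t i hi hs hc h ih =>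
    have := Program.Reaches.step i hi hs hc (ih h₂)
    rwa [Nat.add_right_comm] at this

theorem Program.Reaches.single {P : Program} {s : ℕ} {c c' : Config} (i : Instr)
    (hi : P[c.pc]? = some i) (hs : ∀ a ∈ i.cells c, a < s) (hc : i.exec c = some c') :
    P.Reaches s c 1 c' :=
  Program.Reaches.step i hi hs hc (Program.Reaches.refl _)

/-- Wherever the block `c` stands, it runs from its beginning with memory `m` to its end, in at
most `T` steps, inside the first `s` cells, and ends with a memory that satisfies `Q`. -/
def RunsIn (c : List Instr) (s T : ℕ) (m : Mem) (Q : Mem → Prop) : Prop :=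
  ∀ (P : Program) (p : ℕ), CodeAt P p c →
    ∃ t ≤ T, ∃ m', P.Reaches s ⟨p, m⟩ t ⟨p + c.length, m'⟩ ∧ Q m'

theorem RunsIn.mono {c : List Instr} {s T T' : ℕ} {m : Mem} {Q Q' : Mem → Prop}
    (h : RunsIn c s T m Q) (hT : T ≤ T') (hQ : ∀ m', Q m' → Q' m') : RunsIn c s T' m Q' := by
  intro P p hp
  obtain ⟨t, ht, m', h1, h2⟩ := h P p hp
  exact ⟨t, ht.trans hT, m', h1, hQ _ h2⟩

theorem RunsIn.cat {c₁ c₂ : List Instr} {s T₁ T₂ : ℕ} {m : Mem} {Q₁ Q : Mem → Prop}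
    (h₁ : RunsIn c₁ s T₁ m Q₁) (h₂ : ∀ m', Q₁ m' → RunsIn c₂ s T₂ m' Q) :
    RunsIn (cat c₁ c₂) s (T₁ + T₂) m Q := by
  intro P p hp
  obtain ⟨t, ht, m', h1, h2⟩ := h₁ P p hp.left
  obtain ⟨t', ht', m'', h1', h2'⟩ := h₂ m' h2 P _ hp.right
  refine ⟨t + t', by omega, m'', ?_, h2'⟩
  have := h1.trans h1'
  rwa [Nat.add_assoc, ← length_cat] at this

theorem RunsIn.nil {s : ℕ} {m : Mem} {Q : Mem → Prop} (h : Q m) : RunsIn [] s 0 m Q :=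
  fun _ _ _ => ⟨0, le_rfl, m, Program.Reaches.refl _, h⟩

/-- The instructions that neither jump nor fault. -/
def Instr.effect (m : Mem) : Instr → Option Mem
  | .const d q => some (Function.update m d (q : ℝ))
  | .copy d a => some (Function.update m d (m a))
  | .add d a b => some (Function.update m d (m a + m b))
  | .sub d a b => some (Function.update m d (m a - m b))
  | .mul d a b => some (Function.update m d (m a * m b))
  | _ => none

/-- The cells used by an arithmetic instruction. -/
def Instr.bound : Instr → ℕ
  | .const d _ => d + 1
  | .copy d a => max d a + 1
  | .add d a b => max d (max a b) + 1
  | .sub d a b => max d (max a b) + 1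
  | .mul d a b => max d (max a b) + 1
  | _ => 0

theorem RunsIn.effect {i : Instr} {s : ℕ} {m m' : Mem} {Q : Mem → Prop}
    (hi : i.effect m = some m') (hs : i.bound ≤ s) (hQ : Q m') : RunsIn [i] s 1 m Q := by
  intro P p hp
  refine ⟨1, le_rfl, m', Program.Reaches.single (i.shift p) (hp 0 i rfl) ?_ ?_, hQ⟩
  · cases i <;> simp [Instr.effect] at hi <;>
      simp [Instr.bound] at hs <;> simp [Instr.shift, Instr.cells] <;> omega
  · cases i <;> simp [Instr.effect] at hi <;> subst hi <;>
      simp [Instr.exec, Instr.shift, Config.write]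

theorem cat_cons {i : Instr} {c : List Instr} (h : ∀ j ∈ c, ∀ p, j.shift p = j) :
    i :: c = cat [i] c := by
  simp only [cat, List.cons_append, List.nil_append, List.length_cons, List.length_nil]
  congr 1
  conv_lhs => rw [← List.map_id c]
  exact List.map_congr_left fun j hj => (h j hj _).symm

/-- The effect of a list of arithmetic instructions. -/
def effects : List Instr → Mem → Option Mem
  | [], m => some m
  | i :: c, m => (i.effect m).bind (effects c)

theorem Instr.shift_of_effect {i : Instr} {m m' : Mem} (h : i.effect m = some m') (p : ℕ) :
    i.shift p = i := by
  cases i <;> simp [Instr.effect] at h <;> rfl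

theorem RunsIn.effects {c : List Instr} {s : ℕ} {m m' : Mem} {Q : Mem → Prop}
    (hi : effects c m = some m') (hs : ∀ i ∈ c, i.bound ≤ s) (hQ : Q m') :
    RunsIn c s c.length m Q := by
  have key : ∀ (c : List Instr) (m m' : Mem), RealRAM.effects c m = some m' →
      ∀ i ∈ c, ∀ p, i.shift p = i := by
    intro c
    induction c with
    | nil => simp
    | cons i c ih =>
      intro m m' h j hj p
      simp only [RealRAM.effects, Option.bind_eq_some_iff] at h
      obtain ⟨m1, h1, h2⟩ := h
      rcases List.mem_cons.1 hj with rfl | hj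
      · exact Instr.shift_of_effect h1 p
      · exact ih _ _ h2 j hj p
  induction c generalizing m with
  | nil =>
    simp only [RealRAM.effects, Option.some.injEq] at hi
    subst hi
    exact RunsIn.nil hQ
  | cons i c ih =>
    simp only [RealRAM.effects, Option.bind_eq_some_iff] at hi
    obtain ⟨m1, h1, h2⟩ := hi
    rw [cat_cons (key c _ _ h2), length_cat, List.length_singleton]
    refine RunsIn.cat (Q₁ := fun x => x = m1) (RunsIn.effect h1 (hs i (by simp)) rfl) ?_
    rintro _ rfl
    exact ih h2 fun j hj => hs j (by simp [hj])

theorem address_natCast (c : ℕ) : address (c : ℝ) = some c := by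
  simp [address]

theorem RunsIn.load {d a s c : ℕ} {m : Mem} {Q : Mem → Prop} (h : m a = c) (hd : d < s)
    (ha : a < s) (hc : c < s) (hQ : Q (Function.update m d (m c))) :
    RunsIn [.load d a] s 1 m Q := by
  intro P p hp
  refine ⟨1, le_rfl, _, Program.Reaches.single _ (hp 0 _ rfl) ?_ ?_, hQ⟩
  · simp [Instr.shift, Instr.cells, h, address_natCast]; omega
  · simp [Instr.shift, Instr.exec, h, address_natCast, Config.write]

theorem RunsIn.store {d a s c : ℕ} {m : Mem} {Q : Mem → Prop} (h : m d = c) (hd : d < s)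
    (ha : a < s) (hc : c < s) (hQ : Q (Function.update m c (m a))) :
    RunsIn [.store d a] s 1 m Q := by
  intro P p hp
  refine ⟨1, le_rfl, _, Program.Reaches.single _ (hp 0 _ rfl) ?_ ?_, hQ⟩
  · simp [Instr.shift, Instr.cells, h, address_natCast]; omega
  · simp [Instr.shift, Instr.exec, h, address_natCast, Config.write]

theorem reaches_jump {P : Program} {s p a b l : ℕ} {m : Mem}
    (hp : P[p]? = some (.jumpLE a b l)) (ha : a < s) (hb : b < s) :
    P.Reaches s ⟨p, m⟩ 1 ⟨if m a ≤ m b then l else p + 1, m⟩ :=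
  Program.Reaches.single _ hp (by simp [Instr.cells]; omega) (by simp [Instr.exec])

/-- `M[d] := min M[d] M[a]` -/
def minCode (d a : ℕ) : List Instr := [.jumpLE d a 2, .copy d a]

theorem RunsIn.minCode {d a s : ℕ} {m : Mem} {Q : Mem → Prop} (hd : d < s) (ha : a < s)
    (hQ : Q (Function.update m d (min (m d) (m a)))) : RunsIn (minCode d a) s 2 m Q := by
  intro P p hp
  have h0 := reaches_jump (m := m) (hp 0 _ rfl) hd ha
  by_cases h : m d ≤ m a
  · rw [if_pos h] at h0
    refine ⟨1, by omega, _, h0, ?_⟩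
    rwa [min_eq_left h, Function.update_eq_self] at hQ
  · rw [if_neg h] at h0
    rw [min_eq_right (le_of_not_ge h)] at hQ
    refine ⟨2, by omega, _, h0.trans (Program.Reaches.single _ (hp 1 _ rfl) ?_ ?_), hQ⟩
    · simp [Instr.shift, Instr.cells]; omega
    · simp [Instr.shift, Instr.exec, Config.write, RealRAM.minCode]

/-- `M[d] := 1` if `M[d] ≤ M[a]`, and `M[d] := 0` otherwise -/
def leCode (d a : ℕ) : List Instr :=
  [.jumpLE d a 3, .const d 0, .jumpLE d d 4, .const d 1]

open Classical in
theorem RunsIn.leCode {d a s : ℕ} {m : Mem} {Q : Mem → Prop} (hd : d < s) (ha : a < s)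
    (hQ : Q (Function.update m d (if m d ≤ m a then 1 else 0))) :
    RunsIn (leCode d a) s 3 m Q := by
  intro P p hp
  have h0 := reaches_jump (m := m) (hp 0 _ rfl) hd ha
  by_cases h : m d ≤ m a
  · rw [if_pos h] at h0
    rw [if_pos h] at hQ
    refine ⟨2, by omega, _, h0.trans (Program.Reaches.single _ (hp 3 _ rfl) ?_ ?_), hQ⟩
    · simp [Instr.shift, Instr.cells]; omega
    · simp [Instr.shift, Instr.exec, Config.write, RealRAM.leCode, Nat.add_assoc]
  · rw [if_neg h] at h0
    rw [if_neg h] at hQ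
    have h1 : P.Reaches s ⟨p + 1, m⟩ 1 ⟨p + 2, Function.update m d 0⟩ := by
      refine Program.Reaches.single _ (hp 1 _ rfl) ?_ ?_
      · simp [Instr.shift, Instr.cells]; omega
      · simp [Instr.shift, Instr.exec, Config.write, Nat.add_assoc]
    have h2 := reaches_jump (m := Function.update m d 0) (hp 2 _ rfl) hd hd
    rw [if_pos le_rfl] at h2
    exact ⟨3, by omega, _, (h0.trans h1).trans h2, hQ⟩

/-- `M[d] := M[d]⁻¹`, with the convention `0⁻¹ = 0`; the cell `d + 1` is used as well -/
def invCode (d : ℕ) : List Instr :=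
  [.const (d + 1) 0, .jumpLE d (d + 1) 3, .jumpLE (d + 1) (d + 1) 4, .jumpLE (d + 1) d 6,
    .const (d + 1) 1, .div d (d + 1) d]

theorem RunsIn.invCode {d s : ℕ} {m : Mem} {Q : Mem → Prop} (hd : d + 1 < s)
    (hQ : ∀ x, Q (Function.update (Function.update m (d + 1) x) d (m d)⁻¹)) :
    RunsIn (invCode d) s 5 m Q := by
  intro P p hp
  set m1 := Function.update m (d + 1) 0 with hm1
  have hd1 : m1 d = m d := by simp [hm1]
  have hd2 : m1 (d + 1) = 0 := by simp [hm1]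
  have h0 : P.Reaches s ⟨p, m⟩ 1 ⟨p + 1, m1⟩ := by
    refine Program.Reaches.single _ (hp 0 _ rfl) ?_ ?_
    · simp [Instr.shift, Instr.cells]; omega
    · simp [Instr.shift, Instr.exec, Config.write, hm1]
  have h1 := reaches_jump (m := m1) (hp 1 _ rfl) (by omega : d < s) hd
  have h3 := reaches_jump (m := m1) (hp 3 _ rfl) hd (by omega : d < s)
  have h2 := reaches_jump (m := m1) (hp 2 _ rfl) hd hd
  rw [if_pos le_rfl] at h2
  rw [hd1, hd2] at h1 h3
  have h4 : m d ≠ 0 → P.Reaches s ⟨p + 4, m1⟩ 2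
      ⟨p + 6, Function.update (Function.update m (d + 1) 1) d (m d)⁻¹⟩ := by
    intro hne
    refine (Program.Reaches.single (c' := ⟨p + 5, Function.update m (d + 1) 1⟩) _
      (hp 4 _ rfl) ?_ ?_).trans (Program.Reaches.single _ (hp 5 _ rfl) ?_ ?_) (t₁ := 1) (t₂ := 1)
    · simp [Instr.shift, Instr.cells]; omega
    · simp [Instr.shift, Instr.exec, Config.write, hm1, Nat.add_assoc]
    · simp [Instr.shift, Instr.cells]; omega
    · simp [Instr.shift, Instr.exec, Config.write, hne, Nat.add_assoc]
  by_cases h : m d ≤ 0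
  · rw [if_pos h] at h1
    by_cases h' : 0 ≤ m d
    · rw [if_pos h'] at h3
      have hz : m d = 0 := le_antisymm h h'
      refine ⟨3, by omega, _, (h0.trans h1).trans h3, ?_⟩
      have := hQ 0
      rw [hz, inv_zero] at this
      rwa [← hm1, ← hz, ← hd1, Function.update_eq_self] at this
    · rw [if_neg h'] at h3
      exact ⟨5, by omega, _, ((h0.trans h1).trans h3).trans (h4 (by linarith [lt_of_not_ge h'])),
        hQ 1⟩
  · rw [if_neg h] at h1
    exact ⟨5, by omega, _, ((h0.trans h1).trans h2).trans (h4 (by rintro h'; exact h h'.le)), hQ 1⟩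

/-- The loop `while ¬ M[b] ≤ M[i] do body; M[i] := M[i] + M[one]`. -/
def loopCode (b i one : ℕ) (body : List Instr) : List Instr :=
  -- The last two instructions are appended without shifting, since the target `0` already refers to
  -- the beginning of the whole loop.
  cat [.jumpLE b i (body.length + 3)] body ++ [.add i i one, .jumpLE b b 0]

theorem length_loopCode (b i one : ℕ) (body : List Instr) :
    (loopCode b i one body).length = body.length + 3 := by
  simp [loopCode]; omega


/-- Induction on the number of remaining rounds. The invariant `J k` speaks of the memory at the
test with counter `k`. The body must leave the counter and the cell with the unit intact, and `J (k
+ 1)` is required after the increment. Each round costs three extra steps, and the final test one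
more. -/
theorem RunsIn.loopCode {b i one s T c : ℕ} {body : List Instr} (J : ℕ → Mem → Prop) {m : Mem}
    (hb : b < s) (hi : i < s) (hone : one < s)
    (hJ : ∀ k m, J k m → m b = c ∧ m i = k)
    (hbody : ∀ k < c, ∀ m, J k m → RunsIn body s T m fun m' =>
      m' i = k ∧ m' one = 1 ∧ J (k + 1) (Function.update m' i ((k + 1 : ℕ) : ℝ)))
    (h0 : J 0 m) : RunsIn (loopCode b i one body) s ((T + 3) * c + 1) m (J c) := by
  intro P p hp
  have hp' : CodeAt P p (RealRAM.cat [.jumpLE b i (body.length + 3)] body) := by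
    intro j ins hj
    exact hp j ins (by
      rw [RealRAM.loopCode, List.getElem?_append_left (List.getElem?_eq_some_iff.1 hj).1, hj])
  have hjump : P[p]? = some (.jumpLE b i (p + (body.length + 3))) := hp'.left 0 _ rfl
  have hcode : CodeAt P (p + 1) body := hp'.right
  have hadd : P[p + 1 + body.length]? = some (.add i i one) := by
    have := hp (1 + body.length) (.add i i one) (by
      rw [RealRAM.loopCode, List.getElem?_append_right (by simp)]
      simp)
    rwa [← Nat.add_assoc] at this
  have hback : P[p + 1 + body.length + 1]? = some (.jumpLE b b p) := by
    have := hp (1 + body.length + 1) (.jumpLE b b 0) (by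
      rw [RealRAM.loopCode, List.getElem?_append_right (by simp)]
      simp)
    rwa [← Nat.add_assoc, ← Nat.add_assoc] at this
  have key : ∀ r k m, k + r = c → J k m → ∃ t ≤ (T + 3) * r + 1, ∃ m',
      P.Reaches s ⟨p, m⟩ t ⟨p + (body.length + 3), m'⟩ ∧ J c m' := by
    intro r
    induction r with
    | zero =>
      intro k m hk hm
      obtain ⟨h1, h2⟩ := hJ k m hm
      have h := reaches_jump (m := m) hjump hb hi
      have hkc : k = c := by omega
      rw [h1, h2, if_pos (by rw [hkc])] at h
      exact ⟨1, by omega, m, h, hkc ▸ hm⟩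
    | succ r ih =>
      intro k m hk hm
      obtain ⟨h1, h2⟩ := hJ k m hm
      have h := reaches_jump (m := m) hjump hb hi
      rw [h1, h2, if_neg (by push Not; exact_mod_cast (by omega : k < c))] at h
      obtain ⟨t, ht, m1, h3, h4, h5, h6⟩ := hbody k (by omega) m hm P _ hcode
      have h7 : P.Reaches s ⟨p + 1 + body.length, m1⟩ 1
          ⟨p + 1 + body.length + 1, Function.update m1 i ((k + 1 : ℕ) : ℝ)⟩ := by
        refine Program.Reaches.single _ hadd ?_ ?_
        · simp [Instr.cells]; omega
        · simp [Instr.exec, Config.write, h4, h5]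
      have h8 := reaches_jump (m := Function.update m1 i ((k + 1 : ℕ) : ℝ)) hback hb hb
      rw [if_pos le_rfl] at h8
      obtain ⟨t', ht', m2, h9, h10⟩ := ih (k + 1) _ (by omega) h6
      refine ⟨_, ?_, m2, (((h.trans h3).trans h7).trans h8).trans h9, h10⟩
      rw [Nat.mul_succ]; omega
  obtain ⟨t, ht, m', h1, h2⟩ := key c 0 m (by omega) h0
  exact ⟨t, ht, m', by rwa [length_loopCode], h2⟩

/-! ## A small language of nested loops over arrays -/

/-- The number of cells reserved for registers. -/
def regCount : ℕ := 64

/-- The number of arrays. -/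
def arrCount : ℕ := 24

/-- The contents of the arrays: array number, followed by three indices. -/
abbrev Heap : Type := ℕ → ℕ → ℕ → ℕ → ℝ

/-- The values of the loop variables. -/
abbrev Env : Type := ℕ → ℕ

/-- Array indices: constants, or loop variables plus constants. -/
inductive Ix : Type
  | lit (c : ℕ)
  | var (x c : ℕ)

def Ix.eval (ρ : Env) : Ix → ℕ
  | lit c => c
  | var x c => ρ x + c

/-- Binary operations. -/
inductive Op : Type
  | add | sub | mul | min | le

open Classical in
noncomputable def Op.app : Op → ℝ → ℝ → ℝ
  | add, x, y => x + y
  | sub, x, y => x - y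
  | mul, x, y => x * y
  | min, x, y => Min.min x y
  | le, x, y => if x ≤ y then 1 else 0

/-- Expressions. `inp e` reads the input, `fold op x b e f` is `e` combined with the values of `f`
for `x = 0, …, b - 1`. -/
inductive Ex : Type
  | lit (q : ℚ)
  | var (x : ℕ)
  | inp (e : Ex)
  | get (a : ℕ) (i j k : Ix)
  | inv (e : Ex)
  | bin (op : Op) (e f : Ex)
  | fold (op : Op) (x : ℕ) (b e f : Ex)

/-- Statements. -/
inductive St : Type
  | put (a : ℕ) (i j k : Ix) (e : Ex)
  | seq (s t : St)
  | loop (x : ℕ) (b : Ex) (s : St)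

noncomputable def iter (op : Op) (z : ℝ) (f : ℕ → ℝ) : ℕ → ℝ
  | 0 => z
  | k + 1 => op.app (iter op z f k) (f k)

/-- The sizes of an execution: array indices are at most `n`, the arrays begin at the cell `base`,
loops have at most `bd` rounds, and `imm` is the part of the memory that is only read. -/
structure Ctx : Type where
  n : ℕ
  base : ℕ
  bd : ℕ
  imm : ℕ → ℝ
  regCount_le : regCount ≤ base

/-- Cells `0`, `1`, `2` keep `n`, `k` and `τ` throughout, and the adjacency matrix lies between the
registers and the arrays. The other registers are overwritten and cannot serve as input. -/
def Ctx.Readable (C : Ctx) (c : ℕ) : Prop := c < 3 ∨ (regCount ≤ c ∧ c < C.base)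

/-- The cell that holds an array entry. -/
def Ctx.addr (C : Ctx) (a i j k : ℕ) : ℕ :=
  C.base + (arrCount * ((i * (C.n + 1) + j) * (C.n + 1) + k) + a)

def Ctx.space (C : Ctx) : ℕ := C.base + arrCount * (C.n + 1) ^ 3

/-- The floors only make the evaluation total. `Ex.Ok` demands that the numbers in question are
natural, so no rounding is asked of the machine. -/
noncomputable def Ex.eval (C : Ctx) (H : Heap) : Ex → Env → ℝ
  | lit q, _ => q
  | var x, ρ => ρ x
  | inp e, ρ => C.imm ⌊e.eval C H ρ⌋₊
  | get a i j k, ρ => H a (i.eval ρ) (j.eval ρ) (k.eval ρ)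
  | inv e, ρ => (e.eval C H ρ)⁻¹
  | bin op e f, ρ => op.app (e.eval C H ρ) (f.eval C H ρ)
  | fold op x b e f, ρ =>
      iter op (e.eval C H ρ) (fun i => f.eval C H (Function.update ρ x i)) ⌊b.eval C H ρ⌋₊

/-- The expression can be evaluated without a fault. -/
def Ex.Ok (C : Ctx) (H : Heap) : Ex → Env → Prop
  | lit _, _ => True
  | var _, _ => True
  | inp e, ρ => e.Ok C H ρ ∧ ∃ c, e.eval C H ρ = (c : ℕ) ∧ C.Readable c
  | get a i j k, ρ => a < arrCount ∧ i.eval ρ ≤ C.n ∧ j.eval ρ ≤ C.n ∧ k.eval ρ ≤ C.n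
  | inv e, ρ => e.Ok C H ρ
  | bin _ e f, ρ => e.Ok C H ρ ∧ f.Ok C H ρ
  | fold _ x b e f, ρ => b.Ok C H ρ ∧ e.Ok C H ρ ∧
      ∃ c : ℕ, b.eval C H ρ = c ∧ c ≤ C.bd ∧ ∀ i < c, f.Ok C H (Function.update ρ x i)

def Heap.set (H : Heap) (a i j k : ℕ) (x : ℝ) : Heap := fun a' i' j' k' =>
  if a' = a ∧ i' = i ∧ j' = j ∧ k' = k then x else H a' i' j' k'

/-- Weakest preconditions, with invariants for loops. -/
def wp (C : Ctx) : St → Env → (Heap → Prop) → Heap → Prop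
  | .put a i j k e, ρ, Q, H => e.Ok C H ρ ∧ a < arrCount ∧ i.eval ρ ≤ C.n ∧ j.eval ρ ≤ C.n ∧
      k.eval ρ ≤ C.n ∧ Q (H.set a (i.eval ρ) (j.eval ρ) (k.eval ρ) (e.eval C H ρ))
  | .seq s t, ρ, Q, H => wp C s ρ (wp C t ρ Q) H
  | .loop x b s, ρ, Q, H => b.Ok C H ρ ∧ ∃ c : ℕ, b.eval C H ρ = c ∧ c ≤ C.bd ∧
      ∃ J : ℕ → Heap → Prop, J 0 H ∧
        (∀ i < c, ∀ H', J i H' → wp C s (Function.update ρ x i) (J (i + 1)) H') ∧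
        ∀ H', J c H' → Q H'

theorem wp.mono {C : Ctx} {s : St} {ρ : Env} {Q Q' : Heap → Prop} {H : Heap}
    (h : wp C s ρ Q H) (hQ : ∀ H', Q H' → Q' H') : wp C s ρ Q' H := by
  induction s generalizing ρ Q Q' H with
  | put a i j k e => exact ⟨h.1, h.2.1, h.2.2.1, h.2.2.2.1, h.2.2.2.2.1, hQ _ h.2.2.2.2.2⟩
  | seq s t ihs iht => exact ihs h fun H' h' => iht h' hQ
  | loop x b s ih =>
    obtain ⟨h1, c, h2, h3, J, h4, h5, h6⟩ := h
    exact ⟨h1, c, h2, h3, J, h4, h5, fun H' h' => hQ _ (h6 _ h')⟩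

/-! ### Compilation -/

/-- A literal is loaded twice so that both cases take two instructions and the address computation
has a fixed length. -/
def Ix.code (σ : ℕ → ℕ) (L : ℕ) : Ix → List Instr
  | lit c => [.const L c, .const L c]
  | var x c => [.const L c, .add L L (σ x)]

/-- Compute the address of an array entry in the register `L`. -/
def addrCode (σ : ℕ → ℕ) (L a : ℕ) (i j k : Ix) : List Instr :=
  cat (i.code σ L) (cat [.mul L L 3] (cat (j.code σ (L + 1)) (cat [.add L L (L + 1), .mul L L 3]
    (cat (k.code σ (L + 1)) [.add L L (L + 1), .const (L + 1) arrCount, .mul L L (L + 1),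
      .const (L + 1) a, .add L L (L + 1), .add L L 4]))))

def Op.code (d a : ℕ) : Op → List Instr
  | add => [.add d d a]
  | sub => [.sub d d a]
  | mul => [.mul d d a]
  | min => minCode d a
  | le => leCode d a

/-- Code that computes an expression in the register `L`, using registers from `L` on. The
loop variable `x` is held in the register `σ x`. -/
def Ex.code : Ex → (σ : ℕ → ℕ) → (L : ℕ) → List Instr
  | lit q, _, L => [.const L q]
  | var x, σ, L => [.copy L (σ x)]
  | inp e, σ, L => cat (e.code σ L) [.load L L]
  | get a i j k, σ, L => cat (addrCode σ L a i j k) [.load L L]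
  | inv e, σ, L => cat (e.code σ L) (invCode L)
  | bin op e f, σ, L => cat (e.code σ L) (cat (f.code σ (L + 1)) (op.code L (L + 1)))
  | fold op x b e f, σ, L =>
      cat (e.code σ L) (cat (b.code σ (L + 1)) (cat [.const (L + 2) 0, .const (L + 3) 1]
        (loopCode (L + 1) (L + 2) (L + 3)
          (cat (f.code (Function.update σ x (L + 2)) (L + 4)) (op.code L (L + 4))))))

def Ex.regs : Ex → ℕ
  | lit _ => 1
  | var _ => 1
  | inp e => e.regs
  | get _ _ _ _ => 2
  | inv e => max 2 e.regs
  | bin _ e f => max e.regs (f.regs + 1)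
  | fold _ _ b e f => max e.regs (max (b.regs + 1) (f.regs + 4))

theorem Ex.regs_pos (e : Ex) : 0 < e.regs := by
  induction e <;> simp only [Ex.regs] <;> omega

/-- `B` bounds the rounds of every loop. The cost therefore depends on the program text and `B`
only, not on the data. -/
def Ex.cost (B : ℕ) : Ex → ℕ
  | lit _ => 1
  | var _ => 1
  | inp e => e.cost B + 1
  | get _ _ _ _ => 16
  | inv e => e.cost B + 5
  | bin _ e f => e.cost B + f.cost B + 3
  | fold _ _ b e f => e.cost B + b.cost B + 3 + (f.cost B + 6) * B

def St.code : St → (σ : ℕ → ℕ) → (L : ℕ) → List Instr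
  | put a i j k e, σ, L => cat (e.code σ L) (cat (addrCode σ (L + 1) a i j k) [.store (L + 1) L])
  | seq s t, σ, L => cat (s.code σ L) (t.code σ L)
  | loop x b s, σ, L => cat (b.code σ L) (cat [.const (L + 1) 0, .const (L + 2) 1]
      (loopCode L (L + 1) (L + 2) (s.code (Function.update σ x (L + 1)) (L + 3))))

def St.regs : St → ℕ
  | put _ _ _ _ e => max e.regs 3
  | seq s t => max s.regs t.regs
  | loop _ b s => max b.regs (s.regs + 3)

theorem St.regs_pos (s : St) : 0 < s.regs := by
  induction s <;> simp only [St.regs] <;> omega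

def St.cost (B : ℕ) : St → ℕ
  | put _ _ _ _ e => e.cost B + 16
  | seq s t => s.cost B + t.cost B
  | loop _ b s => b.cost B + 3 + (s.cost B + 3) * B

/-! ### Correctness of the compilation -/

/-- The memories agree outside of the registers from `L` on. -/
def Agree (L : ℕ) (m m' : Mem) : Prop := ∀ c, c < L ∨ regCount ≤ c → m' c = m c

theorem Agree.trans {L L' : ℕ} {m m' m'' : Mem} (h : Agree L m m') (h' : Agree L' m' m'')
    (hL : L ≤ L') : Agree L m m'' := fun c hc => (h' c (by omega)).trans (h c hc)

theorem Agree.update {L r : ℕ} {m : Mem} (x : ℝ) (h₁ : L ≤ r) (h₂ : r < regCount) :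
    Agree L m (Function.update m r x) := fun c hc => by
  rw [Function.update_of_ne (by omega)]

/-- Cells `3` and `4` hold the row length `n + 1` and the first array cell, which the address
computation needs. Everything that matters lies below `L` or beyond the registers, so code that
works in the registers from `L` on cannot disturb it. -/
structure Rep (C : Ctx) (L : ℕ) (σ : ℕ → ℕ) (ρ : Env) (H : Heap) (m : Mem) : Prop where
  imm : ∀ c, C.Readable c → m c = C.imm c
  width : m 3 = (C.n + 1 : ℕ)
  base : m 4 = C.base
  var_lt : ∀ x, σ x < L
  var : ∀ x, m (σ x) = ρ x
  heap : ∀ a < arrCount, ∀ i ≤ C.n, ∀ j ≤ C.n, ∀ k ≤ C.n, m (C.addr a i j k) = H a i j k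
  five_le : 5 ≤ L

theorem Ctx.addr_lt {C : Ctx} {a i j k : ℕ} (ha : a < arrCount) (hi : i ≤ C.n) (hj : j ≤ C.n)
    (hk : k ≤ C.n) : C.addr a i j k < C.space := by
  have h1 : i * (C.n + 1) + j + 1 ≤ (C.n + 1) * (C.n + 1) := by nlinarith
  have h2 : (i * (C.n + 1) + j) * (C.n + 1) + k + 1 ≤ (C.n + 1) ^ 3 := by
    calc _ ≤ (i * (C.n + 1) + j + 1) * (C.n + 1) := by ring_nf; omega
      _ ≤ ((C.n + 1) * (C.n + 1)) * (C.n + 1) := Nat.mul_le_mul_right _ h1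
      _ = _ := by ring
  unfold Ctx.addr Ctx.space
  have h3 := Nat.mul_le_mul_left arrCount h2
  rw [Nat.mul_add, Nat.mul_one] at h3
  omega

theorem mul_add_inj {w x y r t : ℕ} (hr : r < w) (ht : t < w) (h : x * w + r = y * w + t) :
    x = y ∧ r = t := by
  have h1 := congrArg (· % w) h
  simp only [Nat.add_mod, Nat.mul_mod_left, Nat.zero_add,
    Nat.mod_eq_of_lt hr, Nat.mod_eq_of_lt ht] at h1
  subst h1
  exact ⟨Nat.eq_of_mul_eq_mul_right (by omega : 0 < w) (by omega), rfl⟩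

/-- Addresses are mixed-radix numbers with the array number as the last digit, and the digits are
unique. The first index is the leading digit and needs no bound. -/
theorem Ctx.addr_inj {C : Ctx} {a i j k a' i' j' k' : ℕ} (ha : a < arrCount) (hj : j ≤ C.n)
    (hk : k ≤ C.n) (ha' : a' < arrCount) (hj' : j' ≤ C.n) (hk' : k' ≤ C.n)
    (h : C.addr a i j k = C.addr a' i' j' k') : a = a' ∧ i = i' ∧ j = j' ∧ k = k' := by
  have h1 := Nat.add_left_cancel h
  rw [Nat.mul_comm, Nat.mul_comm arrCount] at h1
  obtain ⟨h2, h3⟩ := mul_add_inj ha ha' h1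
  obtain ⟨h4, h5⟩ := mul_add_inj (by omega) (by omega) h2
  obtain ⟨h6, h7⟩ := mul_add_inj (by omega) (by omega) h4
  exact ⟨h3, h6, h7, h5⟩

theorem Ctx.base_le_addr (C : Ctx) (a i j k : ℕ) : C.base ≤ C.addr a i j k := by
  unfold Ctx.addr; omega

theorem Ctx.regCount_le_space (C : Ctx) : regCount ≤ C.space := by
  have := C.regCount_le
  unfold Ctx.space; omega

theorem Rep.agree {C : Ctx} {L : ℕ} {σ : ℕ → ℕ} {ρ : Env} {H : Heap} {m m' : Mem}
    (h : Rep C L σ ρ H m) (ha : Agree L m m') : Rep C L σ ρ H m' := by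
  have h5 := h.five_le
  have hb := C.regCount_le
  refine ⟨fun c hc => ?_, ?_, ?_, h.var_lt, fun x => ?_, fun a ha' i hi j hj k hk => ?_, h5⟩
  · rw [ha c (by rcases hc with hc | hc <;> omega), h.imm c hc]
  · rw [ha 3 (by omega), h.width]
  · rw [ha 4 (by omega), h.base]
  · rw [ha _ (Or.inl (h.var_lt x)), h.var]
  · rw [ha _ (Or.inr (hb.trans (C.base_le_addr ..))), h.heap a ha' i hi j hj k hk]

theorem Rep.mono {C : Ctx} {L L' : ℕ} {σ : ℕ → ℕ} {ρ : Env} {H : Heap} {m : Mem}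
    (h : Rep C L σ ρ H m) (hL : L ≤ L') : Rep C L' σ ρ H m :=
  ⟨h.imm, h.width, h.base, fun x => (h.var_lt x).trans_le hL, h.var, h.heap, h.five_le.trans hL⟩

theorem Rep.bind {C : Ctx} {L L' : ℕ} {σ : ℕ → ℕ} {ρ : Env} {H : Heap} {m : Mem} {x r i : ℕ}
    (h : Rep C L σ ρ H m) (hL : L ≤ L') (hr : r < L') (hm : m r = i) :
    Rep C L' (Function.update σ x r) (Function.update ρ x i) H m := by
  refine ⟨h.imm, h.width, h.base, fun y => ?_, fun y => ?_, h.heap, h.five_le.trans hL⟩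
  · by_cases hy : y = x
    · subst hy; simpa using hr
    · rw [Function.update_of_ne hy]; exact (h.var_lt y).trans_le hL
  · by_cases hy : y = x
    · subst hy; simpa using hm
    · rw [Function.update_of_ne hy, Function.update_of_ne hy]; exact h.var y

theorem Ix.runs {C : Ctx} {L L' : ℕ} {σ : ℕ → ℕ} {ρ : Env} {H : Heap} {m : Mem} (i : Ix)
    (h : Rep C L σ ρ H m) (hL : L ≤ L') (hr : L' < regCount) :
    RunsIn (i.code σ L') C.space 2 m fun m' => m' L' = i.eval ρ ∧ Agree L' m m' := by
  have hs := C.regCount_le_space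
  cases i with
  | lit c =>
    refine RunsIn.effects (m' := Function.update (Function.update m L' (c : ℝ)) L' (c : ℝ))
      (by simp [effects, Instr.effect, Ix.code]) ?_ ⟨?_, ?_⟩
    · simp only [Ix.code, List.mem_cons, List.not_mem_nil, or_false, or_self, forall_eq,
        Instr.bound]
      omega
    · simp [Ix.eval]
    · exact (Agree.update _ le_rfl hr).trans (Agree.update _ le_rfl hr) le_rfl
  | var x c =>
    have hx := h.var_lt x
    refine RunsIn.effects (m' := Function.update (Function.update m L' (c : ℝ)) L' (c + m (σ x)))
      ?_ ?_ ⟨?_, ?_⟩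
    · simp [effects, Instr.effect, Ix.code, Function.update_of_ne (show σ x ≠ L' by omega)]
    · simp only [Ix.code, List.mem_cons, List.not_mem_nil, or_false, forall_eq_or_imp, forall_eq,
        Instr.bound]
      omega
    · simp [Ix.eval, h.var, add_comm]
    · exact (Agree.update _ le_rfl hr).trans (Agree.update _ le_rfl hr) le_rfl

theorem addrCode_runs {C : Ctx} {L L' a : ℕ} {σ : ℕ → ℕ} {ρ : Env} {H : Heap} {m : Mem}
    {i j k : Ix} (h : Rep C L σ ρ H m) (hL : L ≤ L') (hr : L' + 1 < regCount) :
    RunsIn (addrCode σ L' a i j k) C.space 15 m fun m' =>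
      m' L' = C.addr a (i.eval ρ) (j.eval ρ) (k.eval ρ) ∧ Agree L' m m' := by
  have hs := C.regCount_le_space
  have h5 := h.five_le
  refine (RunsIn.cat (i.runs h hL (by omega)) fun m1 ⟨v1, a1⟩ => ?_ : RunsIn _ _ (2 + 13) _ _)
  have r1 : Rep C L σ ρ H m1 := h.agree (fun c hc => a1 c (by omega))
  refine (RunsIn.cat (Q₁ := fun m2 => m2 L' = (i.eval ρ * (C.n + 1) : ℕ) ∧ Agree L' m m2)
    (RunsIn.effect (s := C.space) (i := .mul L' L' 3) rfl (by simp [Instr.bound]; omega)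
      ⟨?_, ?_⟩) fun m2 ⟨v2, a2⟩ => ?_ :
    RunsIn _ _ (1 + 12) _ _)
  · simp [v1, r1.width]
  · exact a1.trans (Agree.update _ le_rfl (by omega)) le_rfl
  have r2 : Rep C L σ ρ H m2 := h.agree (fun c hc => a2 c (by omega))
  refine (RunsIn.cat (j.runs r2 (L' := L' + 1) (by omega) (by omega)) fun m3 ⟨v3, a3⟩ => ?_ :
    RunsIn _ _ (2 + 10) _ _)
  have r3 : Rep C L σ ρ H m3 := r2.agree (fun c hc => a3 c (by omega))
  refine (RunsIn.cat (Q₁ := fun m4 =>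
      m4 L' = ((i.eval ρ * (C.n + 1) + j.eval ρ) * (C.n + 1) : ℕ) ∧ Agree L' m m4)
    (RunsIn.effects (s := C.space) (c := [.add L' L' (L' + 1), .mul L' L' 3]) rfl
      (by simp [Instr.bound]; omega) ⟨?_, ?_⟩) fun m4 ⟨v4, a4⟩ => ?_ :
    RunsIn _ _ (2 + 8) _ _)
  · have h3 : m3 3 = _ := r3.width
    have hL' := a3 L' (by omega)
    simp [v3, hL', v2, h3, Function.update_of_ne (show 3 ≠ L' by omega)]
  · exact ((a2.trans a3 (by omega)).trans (Agree.update _ le_rfl (by omega)) le_rfl).trans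
      (Agree.update _ le_rfl (by omega)) le_rfl
  have r4 : Rep C L σ ρ H m4 := h.agree (fun c hc => a4 c (by omega))
  refine (RunsIn.cat (k.runs r4 (L' := L' + 1) (by omega) (by omega)) fun m5 ⟨v5, a5⟩ => ?_ :
    RunsIn _ _ (2 + 6) _ _)
  have r5 : Rep C L σ ρ H m5 := r4.agree (fun c hc => a5 c (by omega))
  refine RunsIn.effects (by rfl) (by simp [Instr.bound]; omega) ⟨?_, ?_⟩
  · have h3 : m5 4 = _ := r5.base
    have hL' := a5 L' (by omega)
    simp [v5, hL', v4, h3, Function.update_of_ne (show 4 ≠ L' by omega),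
      Function.update_of_ne (show 4 ≠ L' + 1 by omega), Ctx.addr]
    ring
  · have u1 : ∀ (m : Mem) (x : ℝ), Agree L' m (Function.update m L' x) :=
      fun m x => Agree.update x le_rfl (by omega)
    have u2 : ∀ (m : Mem) (x : ℝ), Agree L' m (Function.update m (L' + 1) x) :=
      fun m x => Agree.update x (by omega) (by omega)
    exact ((((((a4.trans a5 (by omega)).trans (u1 _ _) le_rfl).trans (u2 _ _) le_rfl).trans
      (u1 _ _) le_rfl).trans (u2 _ _) le_rfl).trans (u1 _ _) le_rfl).trans (u1 _ _) le_rfl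

theorem Op.runs {d a s : ℕ} {m : Mem} (op : Op) (hd : d < s) (ha : a < s) :
    RunsIn (op.code d a) s 3 m fun m' => m' = Function.update m d (op.app (m d) (m a)) := by
  cases op with
  | add =>
    exact (RunsIn.effect (i := .add d d a) (Q := fun m' => m' = _) rfl
      (by simp [Instr.bound]; omega) rfl).mono (by omega) fun _ h => h
  | sub =>
    exact (RunsIn.effect (i := .sub d d a) (Q := fun m' => m' = _) rfl
      (by simp [Instr.bound]; omega) rfl).mono (by omega) fun _ h => h
  | mul =>
    exact (RunsIn.effect (i := .mul d d a) (Q := fun m' => m' = _) rfl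
      (by simp [Instr.bound]; omega) rfl).mono (by omega) fun _ h => h
  | min => exact (RunsIn.minCode (Q := fun m' => m' = _) hd ha rfl).mono (by omega) fun _ h => h
  | le => exact (RunsIn.leCode (Q := fun m' => m' = _) hd ha rfl).mono (by omega) fun _ h => h

/-- Induction on the expression. A partial result waits in register `L` while the rest is evaluated
in the registers above it. In a fold, the registers `L` to `L + 3` hold the accumulator, the bound,
the counter and the unit, and the bound variable is redirected to the counter. -/
theorem Ex.runs {C : Ctx} {L : ℕ} {σ : ℕ → ℕ} {ρ : Env} {H : Heap} {m : Mem} (e : Ex)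
    (h : Rep C L σ ρ H m) (hok : e.Ok C H ρ) (hr : L + e.regs ≤ regCount) :
    RunsIn (e.code σ L) C.space (e.cost C.bd) m fun m' =>
      m' L = e.eval C H ρ ∧ Agree L m m' := by
  have hs := C.regCount_le_space
  induction e generalizing L σ ρ m with
  | lit q =>
    simp only [Ex.regs] at hr
    exact RunsIn.effect (by rfl) (by simp [Instr.bound]; omega)
      ⟨by simp [Ex.eval], Agree.update _ le_rfl (by omega)⟩
  | var x =>
    simp only [Ex.regs] at hr
    have := h.var_lt x
    exact RunsIn.effect (by rfl) (by simp [Instr.bound]; omega)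
      ⟨by simp [Ex.eval, h.var], Agree.update _ le_rfl (by omega)⟩
  | inp e ih =>
    simp only [Ex.regs] at hr
    obtain ⟨hok, c, hc, hcr⟩ := hok
    refine RunsIn.cat (ih h hok hr) fun m1 ⟨v1, a1⟩ => ?_
    have hpos := e.regs_pos
    have h1 := h.agree a1
    have hcs : c < C.space := by
      rcases hcr with hc | hc
      · have : regCount = 64 := rfl
        omega
      · unfold Ctx.space; omega
    refine RunsIn.load (c := c) (by rw [v1, hc]) (by omega) (by omega) hcs
      ⟨?_, a1.trans (Agree.update _ le_rfl (by omega)) le_rfl⟩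
    simp [Ex.eval, hc, h1.imm c hcr]
  | get a i j k =>
    simp only [Ex.regs] at hr
    obtain ⟨ha, hi, hj, hk⟩ := hok
    refine RunsIn.cat (T₁ := 15) (T₂ := 1) (addrCode_runs h le_rfl (by omega))
      fun m1 ⟨v1, a1⟩ => ?_
    have h1 := h.agree a1
    refine RunsIn.load v1 (by omega) (by omega) (Ctx.addr_lt ha hi hj hk)
      ⟨?_, a1.trans (Agree.update _ le_rfl (by omega)) le_rfl⟩
    simp [Ex.eval, h1.heap a ha _ hi _ hj _ hk]
  | inv e ih =>
    simp only [Ex.regs] at hr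
    refine RunsIn.cat (ih h hok (by omega)) fun m1 ⟨v1, a1⟩ => ?_
    refine RunsIn.invCode (by omega) fun x => ⟨by simp [Ex.eval, v1], ?_⟩
    exact (a1.trans (Agree.update _ (by omega) (by omega)) le_rfl).trans
      (Agree.update _ le_rfl (by omega)) le_rfl
  | bin op e f ihe ihf =>
    simp only [Ex.regs] at hr
    refine (RunsIn.cat (T₂ := f.cost C.bd + 3) (ihe h hok.1 (by omega)) fun m1 ⟨v1, a1⟩ => ?_).mono
      (by simp only [Ex.cost]; omega) fun _ h => h
    have h1 := h.agree a1
    refine RunsIn.cat (ihf (h1.mono (Nat.le_succ L)) hok.2 (by omega)) fun m2 ⟨v2, a2⟩ => ?_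
    have hpos := f.regs_pos
    refine (op.runs (by omega) (by omega)).mono le_rfl ?_
    rintro _ rfl
    refine ⟨?_, (a1.trans a2 (by omega)).trans (Agree.update _ le_rfl (by omega)) le_rfl⟩
    have := a2 L (by omega)
    simp [Ex.eval, v2, this, v1]
  | fold op x b e f ihb ihe ihf =>
    simp only [Ex.regs] at hr
    obtain ⟨hb, he, c, hc, hcB, hf⟩ := hok
    have hpos := f.regs_pos
    have hT : (f.cost C.bd + 6) * c ≤ (f.cost C.bd + 6) * C.bd := Nat.mul_le_mul_left _ hcB
    refine (RunsIn.cat (T₂ := b.cost C.bd + (2 + ((f.cost C.bd + 6) * c + 1))) (ihe h he (by omega))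
      fun m1 ⟨v1, a1⟩ => ?_).mono (by simp only [Ex.cost]; omega) fun _ h => h
    have h1 := h.agree a1
    refine RunsIn.cat (ihb (h1.mono (Nat.le_succ L)) hb (by omega)) fun m2 ⟨v2, a2⟩ => ?_
    have v2' := a2 L (by omega)
    refine RunsIn.cat (T₁ := 2) (Q₁ := fun m3 => m3 L = e.eval C H ρ ∧ m3 (L + 1) = c ∧
        m3 (L + 2) = 0 ∧ m3 (L + 3) = 1 ∧ Agree L m m3)
      (RunsIn.effects (by rfl) (by simp [Instr.bound]; omega) ⟨?_, ?_, ?_, ?_, ?_⟩)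
      fun m3 ⟨w1, w2, w3, w4, a3⟩ => ?_
    · simp [v2', v1]
    · simp [v2, hc]
    · simp
    · simp
    · exact ((a1.trans a2 (by omega)).trans (Agree.update _ (by omega) (by omega)) le_rfl).trans
        (Agree.update _ (by omega) (by omega)) le_rfl
    refine (RunsIn.loopCode (c := c) (T := f.cost C.bd + 3) (fun k m' =>
        m' L = iter op (e.eval C H ρ) (fun i => f.eval C H (Function.update ρ x i)) k ∧
        m' (L + 1) = c ∧ m' (L + 2) = k ∧ m' (L + 3) = 1 ∧ Agree L m m')
      (by omega) (by omega) (by omega) (fun k m' h' => ⟨h'.2.1, h'.2.2.1⟩) ?_ ?_).mono le_rfl ?_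
    · rintro k hk m' ⟨u1, u2, u3, u4, a4⟩
      refine RunsIn.cat (ihf ((h.agree a4).bind (L' := L + 4) (by omega) (by omega) u3) (hf k hk)
        (by omega)) fun m5 ⟨v5, a5⟩ => ?_
      refine (op.runs (by omega) (by omega)).mono le_rfl ?_
      rintro _ rfl
      have b0 := a5 L (by omega)
      have b1 := a5 (L + 1) (by omega)
      have b2 := a5 (L + 2) (by omega)
      have b3 := a5 (L + 3) (by omega)
      refine ⟨by simp [b2, u3], by simp [b3, u4], ?_, by simp [b1, u2], by simp,
        by simp [b3, u4], ?_⟩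
      · simp [iter, b0, u1, v5]
      · exact ((a4.trans a5 (by omega)).trans (Agree.update _ (by omega) (by omega)) le_rfl).trans
          (Agree.update _ (by omega) (by omega)) le_rfl
    · exact ⟨w1, w2, by simp [w3], w4, a3⟩
    · rintro m' ⟨u1, -, -, -, a4⟩
      exact ⟨by simp [u1, Ex.eval, hc], a4⟩

/-- The loop invariants supplied by `wp` become machine invariants by asking for some heap that the
memory represents and that satisfies them. An assignment changes a single array cell, by injectivity
of addresses. -/
theorem St.runs {C : Ctx} {L : ℕ} {σ : ℕ → ℕ} {ρ : Env} {H : Heap} {m : Mem} {Q : Heap → Prop}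
    (s : St) (h : Rep C L σ ρ H m) (hw : wp C s ρ Q H) (hr : L + s.regs ≤ regCount) :
    RunsIn (s.code σ L) C.space (s.cost C.bd) m fun m' =>
      (∃ H', Rep C L σ ρ H' m' ∧ Q H') ∧ ∀ c < L, m' c = m c := by
  have hs := C.regCount_le_space
  induction s generalizing L σ ρ m H Q with
  | put a i j k e =>
    simp only [St.regs] at hr
    obtain ⟨hok, ha, hi, hj, hk, hQ⟩ := hw
    refine RunsIn.cat (T₂ := 15 + 1) (e.runs h hok (by omega)) fun m1 ⟨v1, a1⟩ => ?_
    have h1 := h.agree a1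
    refine RunsIn.cat (addrCode_runs h1 (L' := L + 1) (by omega) (by omega)) fun m2 ⟨v2, a2⟩ => ?_
    have h2 := h1.agree fun c hc => a2 c (by omega)
    have w1 : m2 L = e.eval C H ρ := by rw [a2 L (by omega), v1]
    have hb := C.base_le_addr a (i.eval ρ) (j.eval ρ) (k.eval ρ)
    have hR := C.regCount_le
    have h5 := h.five_le
    refine RunsIn.store v2 (by omega) (by omega) (Ctx.addr_lt ha hi hj hk) ⟨⟨_, ?_, hQ⟩, ?_⟩
    · refine ⟨fun c hc => ?_, ?_, ?_, h.var_lt, fun x => ?_,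
        fun a' ha' i' hi' j' hj' k' hk' => ?_, h5⟩
      · rw [Function.update_of_ne, h2.imm c hc]
        rcases hc with hc | hc <;> omega
      · rw [Function.update_of_ne (by omega), h2.width]
      · rw [Function.update_of_ne (by omega), h2.base]
      · have := h.var_lt x
        rw [Function.update_of_ne (by omega), h2.var]
      · unfold Heap.set
        split_ifs with hif
        · obtain ⟨rfl, rfl, rfl, rfl⟩ := hif
          simp [w1]
        · rw [Function.update_of_ne, h2.heap a' ha' i' hi' j' hj' k' hk']
          intro heq
          exact hif (Ctx.addr_inj ha' hj' hk' ha hj hk heq)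
    · intro c hc
      rw [Function.update_of_ne (by omega), a2 c (by omega), a1 c (by omega)]
  | seq s t ihs iht =>
    simp only [St.regs] at hr
    refine RunsIn.cat (ihs h hw (by omega)) fun m1 ⟨⟨H1, r1, q1⟩, f1⟩ => ?_
    exact (iht r1 q1 (by omega)).mono le_rfl fun m2 ⟨hx, f2⟩ =>
      ⟨hx, fun c hc => (f2 c hc).trans (f1 c hc)⟩
  | loop x b s ih =>
    simp only [St.regs] at hr
    obtain ⟨hb, c, hc, hcB, J, hJ0, hJ, hJQ⟩ := hw
    have hT : (s.cost C.bd + 3) * c ≤ (s.cost C.bd + 3) * C.bd := Nat.mul_le_mul_left _ hcB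
    refine (RunsIn.cat (T₂ := 2 + ((s.cost C.bd + 3) * c + 1)) (b.runs h hb (by omega))
      fun m1 ⟨v1, a1⟩ => ?_).mono (by simp only [St.cost]; omega) fun _ h => h
    have hpos := s.regs_pos
    refine RunsIn.cat (T₁ := 2) (Q₁ := fun m3 => m3 L = c ∧
        m3 (L + 1) = 0 ∧ m3 (L + 2) = 1 ∧ Agree L m m3)
      (RunsIn.effects (by rfl) (by simp [Instr.bound]; omega) ⟨?_, ?_, ?_, ?_⟩)
      fun m3 ⟨w1, w2, w3, a3⟩ => ?_
    · simp [v1, hc]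
    · simp
    · simp
    · exact (a1.trans (Agree.update _ (by omega) (by omega)) le_rfl).trans
        (Agree.update _ (by omega) (by omega)) le_rfl
    refine (RunsIn.loopCode (c := c) (T := s.cost C.bd) (fun k m' =>
        m' L = c ∧ m' (L + 1) = k ∧ m' (L + 2) = 1 ∧ (∀ c < L, m' c = m c) ∧
        ∃ H', Rep C L σ ρ H' m' ∧ J k H')
      (by omega) (by omega) (by omega) (fun k m' h' => ⟨h'.1, h'.2.1⟩) ?_ ?_).mono le_rfl ?_
    · rintro k hk m' ⟨u1, u2, u3, u4, H', r', j'⟩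
      refine (ih (r'.bind (L' := L + 3) (by omega) (by omega) u2) (hJ k hk H' j')
        (by omega)).mono le_rfl ?_
      rintro m5 ⟨⟨H5, r5, j5⟩, f5⟩
      have b0 := f5 L (by omega)
      have b1 := f5 (L + 1) (by omega)
      have b2 := f5 (L + 2) (by omega)
      refine ⟨by rw [b1, u2], by rw [b2, u3], ?_, by simp, ?_, ?_, H5, ?_, j5⟩
      · rw [Function.update_of_ne (by omega), b0, u1]
      · rw [Function.update_of_ne (by omega), b2, u3]
      · intro c hc
        rw [Function.update_of_ne (by omega), f5 c (by omega), u4 c hc]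
      · refine Rep.agree (m := m5) ⟨r5.imm, r5.width, r5.base, r'.var_lt, fun y => ?_, r5.heap,
          h.five_le⟩ (Agree.update _ (by omega) (by omega))
        rw [f5 _ (by have := r'.var_lt y; omega), r'.var]
    · exact ⟨w1, by simp [w2], w3, fun c hc => a3 c (Or.inl hc), H, h.agree a3, hJ0⟩
    · rintro m' ⟨-, -, -, u4, H', r', j'⟩
      exact ⟨⟨H', r', hJQ _ j'⟩, u4⟩

/-! ### The running time -/

/-- Bounded by a polynomial for positive arguments. -/
def PolyBounded (f : ℕ → ℕ) : Prop := ∃ K d : ℕ, ∀ B, 1 ≤ B → f B ≤ K * B ^ d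

theorem PolyBounded.const (c : ℕ) : PolyBounded fun _ => c := ⟨c, 0, by simp⟩

theorem PolyBounded.id : PolyBounded fun B => B := ⟨1, 1, by simp⟩

theorem PolyBounded.add {f g : ℕ → ℕ} (hf : PolyBounded f) (hg : PolyBounded g) :
    PolyBounded fun B => f B + g B := by
  obtain ⟨K, d, h⟩ := hf
  obtain ⟨K', d', h'⟩ := hg
  refine ⟨K + K', d + d', fun B hB => ?_⟩
  have h1 : B ^ d ≤ B ^ (d + d') := Nat.pow_le_pow_right hB (by omega)
  have h2 : B ^ d' ≤ B ^ (d + d') := Nat.pow_le_pow_right hB (by omega)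
  have h3 := Nat.mul_le_mul_left K h1
  have h4 := Nat.mul_le_mul_left K' h2
  have := h B hB
  have := h' B hB
  show f B + g B ≤ _
  rw [Nat.add_mul]
  omega

theorem PolyBounded.mul {f g : ℕ → ℕ} (hf : PolyBounded f) (hg : PolyBounded g) :
    PolyBounded fun B => f B * g B := by
  obtain ⟨K, d, h⟩ := hf
  obtain ⟨K', d', h'⟩ := hg
  refine ⟨K * K', d + d', fun B hB => ?_⟩
  calc f B * g B ≤ (K * B ^ d) * (K' * B ^ d') := Nat.mul_le_mul (h B hB) (h' B hB)
    _ = _ := by ring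

/-- Only loops multiply by `B`, so the degree is governed by the nesting depth, which is a constant
of the program. -/
theorem Ex.cost_polyBounded (e : Ex) : PolyBounded fun B => e.cost B := by
  induction e with
  | lit q => exact .const _
  | var x => exact .const _
  | inp e ih => exact ih.add (.const _)
  | get a i j k => exact .const _
  | inv e ih => exact ih.add (.const _)
  | bin op e f ihe ihf => exact (ihe.add ihf).add (.const _)
  | fold op x b e f ihb ihe ihf =>
    exact ((ihe.add ihb).add (.const _)).add ((ihf.add (.const _)).mul .id)

theorem St.cost_polyBounded (s : St) : PolyBounded fun B => s.cost B := by
  induction s with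
  | put a i j k e => exact e.cost_polyBounded.add (.const _)
  | seq s t ihs iht => exact ihs.add iht
  | loop x b s ih =>
    exact (b.cost_polyBounded.add (.const _)).add ((ih.add (.const _)).mul .id)

end RealRAM

/-! ### Geodesics in trees and the effect of deletions on them -/

namespace SimpleGraph

variable {V : Type*} {T : SimpleGraph V}

/-! ## Betweenness in trees -/

/-- `x` lies on a shortest path from `u` to `w`. -/
def Btw (T : SimpleGraph V) (u x w : V) : Prop := T.dist u x + T.dist x w = T.dist u w

theorem Btw.symm {u x w : V} (h : T.Btw u x w) : T.Btw w x u := by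
  unfold Btw at *
  rw [T.dist_comm (u := w) (v := x), T.dist_comm (u := w) (v := u), T.dist_comm (u := x) (v := u)]
  omega

theorem btw_left (T : SimpleGraph V) (u w : V) : T.Btw u u w := by simp [Btw]

theorem btw_right (T : SimpleGraph V) (u w : V) : T.Btw u w w := by simp [Btw]

theorem Connected.eq_of_dist_eq_zero (hT : T.Connected) {u v : V} (h : T.dist u v = 0) : u = v :=
  hT.dist_eq_zero_iff.1 h

theorem Connected.btw_self (hT : T.Connected) {u x : V} (h : T.Btw u x u) : x = u := by
  unfold Btw at h
  rw [dist_self] at h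
  exact hT.eq_of_dist_eq_zero (by omega)

theorem Btw.trans_left (hT : T.Connected) {u x y v : V} (h : T.Btw u x v) (h' : T.Btw u y x) :
    T.Btw u y v := by
  unfold Btw at *
  have h1 := hT.dist_triangle (u := u) (v := y) (w := v)
  have h2 := hT.dist_triangle (u := y) (v := x) (w := v)
  omega

theorem Btw.trans_right (hT : T.Connected) {u x y v : V} (h : T.Btw u x v) (h' : T.Btw u y x) :
    T.Btw y x v := by
  unfold Btw at *
  have h1 := hT.dist_triangle (u := u) (v := y) (w := v)
  have h2 := hT.dist_triangle (u := y) (v := x) (w := v)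
  omega

theorem Btw.trans_left' (hT : T.Connected) {u x y v : V} (h : T.Btw u x v) (h' : T.Btw x y v) :
    T.Btw u y v := (h.symm.trans_left hT h'.symm).symm

theorem Btw.trans_right' (hT : T.Connected) {u x y v : V} (h : T.Btw u x v) (h' : T.Btw x y v) :
    T.Btw u x y := (h.symm.trans_right hT h'.symm).symm

theorem Walk.btw_of_mem_support (hT : T.Connected) {u v x : V} {p : T.Walk u v}
    (hp : p.length = T.dist u v) (hx : x ∈ p.support) : T.Btw u x v := by
  classical
  have h1 := T.dist_le (p.takeUntil x hx)
  have h2 := T.dist_le (p.dropUntil x hx)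
  have h3 := congrArg Walk.length (p.take_spec hx)
  have h4 := hT.dist_triangle (u := u) (v := x) (w := v)
  rw [Walk.length_append] at h3
  unfold Btw
  omega

theorem Connected.exists_adj_btw (hT : T.Connected) {u v : V} (h : u ≠ v) :
    ∃ y, T.Adj u y ∧ T.Btw u y v := by
  obtain ⟨p, hp⟩ := hT.exists_walk_length_eq_dist u v
  cases p with
  | nil => exact absurd rfl h
  | @cons _ y _ hadj q =>
    exact ⟨y, hadj, Walk.btw_of_mem_support hT hp (by simp)⟩

/-- A shortest walk visits one more vertex than its length, all distinct and all in `B`. -/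
theorem Connected.dist_lt_card_btw [Fintype V] (hT : T.Connected) (u v : V) {B : Finset V}
    (hB : ∀ x, T.Btw u x v → x ∈ B) : T.dist u v < B.card := by
  classical
  obtain ⟨p, hp⟩ := hT.exists_walk_length_eq_dist u v
  have h1 : p.support.toFinset ⊆ B := fun x hx =>
    hB x (Walk.btw_of_mem_support hT hp (List.mem_toFinset.1 hx))
  have h2 := Finset.card_le_card h1
  rw [List.toFinset_card_of_nodup (p.isPath_of_length_eq_dist hp).support_nodup,
    Walk.length_support] at h2
  omega

namespace IsTree

variable (hT : T.IsTree)
include hT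

theorem length_eq_dist {u v : V} {p : T.Walk u v} (hp : p.IsPath) : p.length = T.dist u v := by
  obtain ⟨q, hq, hl⟩ := hT.1.exists_path_of_dist u v
  rw [(hT.existsUnique_path u v).unique hp hq, hl]

theorem mem_support_of_btw {u v x : V} {p : T.Walk u v} (hp : p.IsPath) (hx : T.Btw u x v) :
    x ∈ p.support := by
  obtain ⟨q, hq⟩ := hT.1.exists_walk_length_eq_dist u x
  obtain ⟨r, hr⟩ := hT.1.exists_walk_length_eq_dist x v
  have h : (q.append r).IsPath := Walk.isPath_of_length_eq_dist _ (by
    rw [Walk.length_append, hq, hr, hx])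
  rw [(hT.existsUnique_path u v).unique hp h]
  simp

theorem chain {u x y v : V} (hx : T.Btw u x v) (hy : T.Btw u y v) :
    T.Btw u y x ∨ T.Btw x y v := by
  classical
  obtain ⟨p, hp⟩ := hT.1.exists_walk_length_eq_dist u v
  have hpp := p.isPath_of_length_eq_dist hp
  have h1 := hT.mem_support_of_btw hpp hx
  have h2 := hT.mem_support_of_btw hpp hy
  rw [← p.take_spec h1, Walk.mem_support_append_iff] at h2
  rcases h2 with h2 | h2
  · exact Or.inl (Walk.btw_of_mem_support hT.1 (hT.length_eq_dist (hpp.takeUntil h1)) h2)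
  · exact Or.inr (Walk.btw_of_mem_support hT.1 (hT.length_eq_dist (hpp.dropUntil h1)) h2)

/-- Geodesics from `u` to `m` and from `m` to `w` that meet only in `m` concatenate to a path, and
the only path between two vertices of a tree is the geodesic. -/
theorem btw_of_forall {u m w : V}
    (h : ∀ z, T.Btw u z m → T.Btw m z w → z = m) : T.Btw u m w := by
  obtain ⟨p, hp⟩ := hT.1.exists_walk_length_eq_dist u m
  obtain ⟨q, hq⟩ := hT.1.exists_walk_length_eq_dist m w
  have hpp := p.isPath_of_length_eq_dist hp
  have hqp := q.isPath_of_length_eq_dist hq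
  have hpath : (p.append q).IsPath := by
    rw [Walk.isPath_def, Walk.support_append]
    have hqs := hqp.support_nodup
    rw [← Walk.cons_tail_support] at hqs
    refine List.nodup_append'.2 ⟨hpp.support_nodup, (List.nodup_cons.1 hqs).2, ?_⟩
    intro z hz hz'
    have := h z (Walk.btw_of_mem_support hT.1 hp hz)
      (Walk.btw_of_mem_support hT.1 hq (List.mem_of_mem_tail hz'))
    subst this
    exact (List.nodup_cons.1 hqs).1 hz'
  have := hT.length_eq_dist hpath
  rw [Walk.length_append, hp, hq] at this
  exact this

/-- Take the vertex `m` on the geodesic from `u` to `v` that is nearest to `w`. By minimality the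
geodesic from `m` to `w` leaves the one from `u` to `v` at once. -/
theorem median (u v w : V) : ∃ m, T.Btw u m v ∧ T.Btw u m w ∧ T.Btw v m w := by
  obtain ⟨m, hm, hmin⟩ := (measure fun m => T.dist m w).wf.has_min {m | T.Btw u m v}
    ⟨u, btw_left T u v⟩
  have hmin' : ∀ z, T.Btw u z v → T.Btw m z w → z = m := by
    intro z hz hz'
    have h1 := hmin z hz
    have h2 : ¬ T.dist z w < T.dist m w := h1
    have h3 : T.dist m z + T.dist z w = T.dist m w := hz'
    exact (hT.1.eq_of_dist_eq_zero (by omega)).symm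
  refine ⟨m, hm, hT.btw_of_forall fun z hz hz' => hmin' z (Btw.trans_left hT.1 hm hz) hz',
    hT.btw_of_forall fun z hz hz' => hmin' z ?_ hz'⟩
  exact (Btw.trans_left hT.1 hm.symm hz).symm

/-- Deleting `x` cannot leave `r` connected with both `u` and `w`: on the geodesic from `u` to `w`,
the vertex `x` lies on one of the two sides of the median with `r`. -/
theorem btw_or_btw {u x w : V} (h : T.Btw u x w) (r : V) : T.Btw u x r ∨ T.Btw w x r := by
  obtain ⟨m, h1, h2, h3⟩ := hT.median u w r
  rcases hT.chain h1 h with h4 | h4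
  · exact Or.inl (h2.trans_left hT.1 h4)
  · exact Or.inr (h3.trans_left hT.1 h4.symm)

theorem eq_of_btw_of_dist_eq {u x y v : V} (hx : T.Btw u x v) (hy : T.Btw u y v)
    (h : T.dist u x = T.dist u y) : x = y := by
  rcases hT.chain hx hy with h1 | h1
  · unfold Btw at h1
    exact (hT.1.eq_of_dist_eq_zero (by omega)).symm
  · have h2 := hx.trans_right' hT.1 h1
    unfold Btw at h2
    exact hT.1.eq_of_dist_eq_zero (by omega)

/-- If `x` does not separate `u` from `w`, then the first step from `x` towards `u` is also the
first step towards `w`. -/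
theorem btw_of_adj {u x y w : V} (hxy : T.Adj x y) (hy : T.Btw x y u) (h : ¬ T.Btw u x w) :
    T.Btw x y w := by
  obtain ⟨m, h1, h2, h3⟩ := hT.median x u w
  rcases hT.chain hy h1 with h4 | h4
  -- The median lies on the edge from `x` to `y`, so it is one of the two ends. The end `x` would
  -- separate `u` from `w`.
  · have h5 := dist_eq_one_iff_adj.2 hxy
    have h6 : T.dist x m + T.dist m y = T.dist x y := h4
    have h7 : T.dist x m = 0 ∨ T.dist m y = 0 := by omega
    rcases h7 with h7 | h7
    · rw [← hT.1.eq_of_dist_eq_zero h7] at h3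
      exact absurd h3 h
    · rw [← hT.1.eq_of_dist_eq_zero h7]
      exact h2
  · exact h2.trans_left hT.1 (hy.trans_right' hT.1 h4)

/-- A vertex separates its descendants below a child from all other vertices. -/
theorem btw_parent {r b c u w : V} (hbc : T.Adj b c) (hd : T.dist r b + 1 = T.dist r c)
    (hu : T.Btw r c u) (hw : ¬ T.Btw r c w) : T.Btw u b w := by
  have h1 := dist_eq_one_iff_adj.2 hbc
  have hb : T.Btw r b c := by unfold Btw; omega
  obtain ⟨m, h2, h3, h4⟩ := hT.median r u w
  rcases hT.chain hu h2 with h5 | h5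
  · rcases hT.chain hb h5 with h6 | h6
    · have h7 : T.Btw m b c := hb.trans_right hT.1 h6
      have h8 : T.Btw m c u := hu.trans_right hT.1 h5
      exact h4.trans_left hT.1 (h8.trans_left hT.1 h7).symm
    · have h7 : T.dist b m + T.dist m c = T.dist b c := h6
      have h8 : T.dist b m = 0 ∨ T.dist m c = 0 := by omega
      rcases h8 with h8 | h8
      · rw [hT.1.eq_of_dist_eq_zero h8]; exact h4
      · rw [hT.1.eq_of_dist_eq_zero h8] at h3
        exact absurd h3 hw
  · exact absurd (h3.trans_left hT.1 (hu.trans_right' hT.1 h5)) hw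

end IsTree

/-! ## Deletions in trees -/

/-- No vertex of `S` lies on a shortest path from `u` to `w`. -/
def Live (T : SimpleGraph V) (S : Set V) (u w : V) : Prop := ∀ x ∈ S, ¬ T.Btw u x w

theorem Live.symm {S : Set V} {u w : V} (h : T.Live S u w) : T.Live S w u :=
  fun x hx hb => h x hx hb.symm

theorem Live.not_mem_left {S : Set V} {u w : V} (h : T.Live S u w) : u ∉ S :=
  fun hu => h u hu (btw_left T u w)

theorem Live.not_mem_right {S : Set V} {u w : V} (h : T.Live S u w) : w ∉ S :=
  fun hu => h w hu (btw_right T u w)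

theorem Live.of_btw (hT : T.Connected) {S : Set V} {u x w : V} (h : T.Live S u w)
    (hx : T.Btw u x w) : T.Live S u x := fun _ hy hb => h _ hy (hx.trans_left hT hb)

/-- A deleted vertex between `u` and `w` would by `btw_or_btw` also separate `v` from one of them.
-/
theorem IsTree.live_trans (hT : T.IsTree) {S : Set V} {u v w : V} (h : T.Live S u v)
    (h' : T.Live S v w) : T.Live S u w := fun x hx hb => by
  rcases hT.btw_or_btw hb v with h1 | h1
  · exact h x hx h1
  · exact h' x hx h1.symm

theorem IsTree.live_iff (hT : T.IsTree) {S : Set V} {u w : V} (hu : u ∉ S) (hw : w ∉ S) :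
    (T.induce {v | v ∉ S}).Reachable ⟨u, hu⟩ ⟨w, hw⟩ ↔ T.Live S u w := by
  constructor
  · rintro ⟨p⟩ x hx hb
    classical
    obtain ⟨q, hq⟩ := p.toPath
    have h1 : (q.map (Embedding.induce {v | v ∉ S}).toHom).IsPath :=
      hq.map (Embedding.induce (G := T) {v | v ∉ S}).injective
    have h2 := hT.mem_support_of_btw h1 hb
    rw [Walk.support_map, List.mem_map] at h2
    obtain ⟨y, -, rfl⟩ := h2
    exact y.2 hx
  · intro h
    obtain ⟨p, hp⟩ := hT.1.exists_walk_length_eq_dist u w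
    exact ⟨p.induce _ fun x hx hxS => h x hxS (Walk.btw_of_mem_support hT.1 hp hx)⟩

/-- A shortest path of the remaining graph is a path of the tree, hence the geodesic. -/
theorem IsTree.dist_induce (hT : T.IsTree) {S : Set V} {u w : V} (hu : u ∉ S) (hw : w ∉ S)
    (h : T.Live S u w) :
    (T.induce {v | v ∉ S}).dist ⟨u, hu⟩ ⟨w, hw⟩ = T.dist u w := by
  obtain ⟨q, hq⟩ := ((hT.live_iff hu hw).2 h).exists_walk_length_eq_dist
  have h1 : (q.map (Embedding.induce {v | v ∉ S}).toHom).IsPath :=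
    (q.isPath_of_length_eq_dist hq).map (Embedding.induce (G := T) {v | v ∉ S}).injective
  have h2 := hT.length_eq_dist h1
  rw [Walk.length_map, hq] at h2
  exact h2

open Classical in
-- Each unordered pair of distinct vertices is the image of exactly two ordered pairs, and the
-- diagonal contributes nothing.
theorem two_mul_sum_sym2 {V : Type*} [Fintype V] (f : V → V → ℝ) (hf : ∀ u w, f u w = f w u)
    (h0 : ∀ u, f u u = 0) :
    2 * ∑ e : Sym2 V with ¬ e.IsDiag, Sym2.lift ⟨f, hf⟩ e = ∑ u, ∑ w, f u w := by
  rw [← Finset.sum_product', Finset.univ_product_univ,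
    ← Finset.sum_fiberwise (s := Finset.univ) (g := fun p : V × V => s(p.1, p.2)),
    Finset.mul_sum, Finset.sum_filter]
  refine Finset.sum_congr rfl fun e _ => ?_
  induction e using Sym2.ind with
  | _ a b =>
    by_cases hab : a = b
    · subst hab
      rw [if_neg (by simp)]
      refine (Finset.sum_eq_zero fun p hp => ?_).symm
      simp only [Finset.mem_filter, Finset.mem_univ, true_and, Sym2.eq_iff] at hp
      rcases hp with hp | hp <;> rw [hp.1, hp.2, h0]
    · rw [if_pos (by simpa using hab)]
      have : Finset.univ.filter (fun p : V × V => s(p.1, p.2) = s(a, b)) = {(a, b), (b, a)} := by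
        ext ⟨x, y⟩
        simp
      rw [this, Finset.sum_pair (by simpa using fun h => absurd h hab)]
      simp [hf b a, two_mul]

open Classical in
/-- The sum of the inverse distances over all ordered pairs of vertices in `A` that are not
separated by `S`. -/
noncomputable def pairSum (T : SimpleGraph V) (A : Finset V) (S : Set V) : ℝ :=
  ∑ u ∈ A, ∑ w ∈ A, if T.Live S u w then ((T.dist u w : ℝ))⁻¹ else 0

/-- Working with ordered pairs of vertices of `T` itself avoids both `Sym2` and the induced subgraph
from here on. Deleted vertices contribute nothing because no pair containing one is live, and pairs
`(u, u)` nothing because `0⁻¹ = 0`. -/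
theorem IsTree.two_mul_igl [Fintype V] (hT : T.IsTree) (S : Finset V)
    [Fintype {v | v ∉ S}] :
    2 * (T.induce {v | v ∉ S}).igl = T.pairSum Finset.univ S := by
  classical
  rw [igl, two_mul_sum_sym2 _ _ (by intro u; simp [invDist]), pairSum]
  have key : ∀ f : V → ℝ, (∀ u ∈ S, f u = 0) → ∑ u, f u = ∑ u : {v | v ∉ S}, f u := by
    intro f hf
    rw [← Finset.sum_subset (Finset.subset_univ (Finset.univ.filter (· ∉ S)))]
    · exact (Finset.sum_subtype _ (by simp) f)
    · intro x _ hx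
      exact hf x (by simpa using hx)
  rw [key]
  · refine Finset.sum_congr rfl fun u _ => ?_
    rw [key]
    · refine Finset.sum_congr rfl fun w _ => ?_
      unfold invDist
      by_cases h : T.Live (S : Set V) u w
      · have h1 := (hT.live_iff (S := (S : Set V)) u.2 w.2).2 h
        have h2 := hT.dist_induce (S := (S : Set V)) u.2 w.2 h
        rw [if_pos h, ← h2]
        exact (if_pos h1).trans (one_div _)
      · have h1 := mt (hT.live_iff (S := (S : Set V)) u.2 w.2).1 h
        rw [if_neg h]
        exact if_neg h1
    · intro w hw
      exact if_neg fun h => h.not_mem_right hw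
  · intro u hu
    exact Finset.sum_eq_zero fun w _ => if_neg fun h => h.not_mem_left hu

theorem IsTree.minIGL_iff [Fintype V] (hT : T.IsTree) (k : ℕ) (τ : ℝ) :
    T.MinIGL k τ ↔ ∃ S : Finset V, S.card = k ∧ T.pairSum Finset.univ S ≤ 2 * τ := by
  classical
  unfold MinIGL
  refine exists_congr fun S => and_congr_right fun _ => ?_
  rw [← hT.two_mul_igl S]
  constructor <;> intro h <;> linarith

end SimpleGraph

/-! ### The exchange argument -/

namespace SimpleGraph

variable {V : Type*} [Fintype V] {T : SimpleGraph V}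

/-! ## Optimal deletions leave small components -/

open Classical in
/-- The sum of the inverse distances over all ordered pairs of vertices that are separated by `x`,
but not by `S`. -/
noncomputable def pairSumThrough (T : SimpleGraph V) (x : V) (S : Set V) : ℝ :=
  ∑ u, ∑ w, if T.Live S u w ∧ T.Btw u x w then ((T.dist u w : ℝ))⁻¹ else 0

/-- Compared pair by pair: a pair that is live after the exchange avoids `x`, and either avoids `s`
and was live before, or is restored by putting `s` back. There is no equality, because restored
pairs through both `x` and `s` are counted on the right only. -/
theorem pairSum_exchange_le (S : Set V) (x s : V) :
    T.pairSum Finset.univ (insert x (S \ {s})) ≤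
      T.pairSum Finset.univ S - T.pairSumThrough x S + T.pairSumThrough s (S \ {s}) := by
  classical
  unfold pairSum pairSumThrough
  simp only [← Finset.sum_sub_distrib, ← Finset.sum_add_distrib]
  refine Finset.sum_le_sum fun u _ => Finset.sum_le_sum fun w _ => ?_
  have h0 : (0 : ℝ) ≤ ((T.dist u w : ℝ))⁻¹ := by positivity
  have h1 : T.Live (insert x (S \ {s})) u w ↔ T.Live (S \ {s}) u w ∧ ¬ T.Btw u x w := by
    simp only [Live, Set.mem_insert_iff, forall_eq_or_imp]
    tauto
  have h2 : T.Live (S \ {s}) u w → ¬ T.Btw u s w → T.Live S u w := fun h hs y hy hb => by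
    by_cases hys : y = s
    · exact hs (hys ▸ hb)
    · exact h y ⟨hy, hys⟩ hb
  rw [h1]
  split_ifs <;> first | linarith | (exfalso; tauto)

open Classical in
/-- Every finite set of vertices has a centroid. -/
theorem IsTree.exists_centroid (hT : T.IsTree) (B : Finset V) :
    ∃ x, ∀ u ∈ B, u ≠ x → B.card ≤ 2 * (B.filter fun w => T.Btw u x w).card := by
  have := hT.1.nonempty
  obtain ⟨x, -, hx⟩ := Finset.exists_min_image Finset.univ (fun x => ∑ w ∈ B, (T.dist x w : ℤ))
    Finset.univ_nonempty
  refine ⟨x, fun u _ hux => ?_⟩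
  obtain ⟨y, hxy, hy⟩ := hT.1.exists_adj_btw hux.symm
  have h1 := hx y (Finset.mem_univ _)
  have hd := dist_eq_one_iff_adj.2 hxy
  -- Moving from the minimizer `x` one step towards `u` adds at most one to the distance to `w` if
  -- `x` lies between `u` and `w`, and removes one otherwise. Since the sum must not decrease, the
  -- first case makes up at least half of `B`.
  have h2 : ∑ w ∈ B, ((T.dist y w : ℤ) - T.dist x w) ≤
      ∑ w ∈ B, (2 * (if T.Btw u x w then 1 else 0) - 1) := by
    refine Finset.sum_le_sum fun w _ => ?_
    split_ifs with h
    · have := hT.1.dist_triangle (u := y) (v := x) (w := w)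
      rw [T.dist_comm (u := y) (v := x), hd] at this
      omega
    · have h3 : T.dist x y + T.dist y w = T.dist x w := hT.btw_of_adj hxy hy h
      omega
  rw [Finset.sum_sub_distrib, Finset.sum_sub_distrib, ← Finset.mul_sum, Finset.sum_boole] at h2
  simp only [Finset.sum_const, nsmul_eq_mul, mul_one] at h2
  zify
  linarith

theorem inv_natCast_le_one (d : ℕ) : ((d : ℝ))⁻¹ ≤ 1 := Nat.cast_inv_le_one d

/-- Take a centroid `x` of `B`. For each other `u` in `B`, at least half of `B` lies behind `x` as
seen from `u`, and each such pair is worth at least `1/D`. The centroid is not in `S` because it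
lies between two vertices of `B`. -/
theorem IsTree.exists_pairSumThrough_ge (hT : T.IsTree) {S : Set V} {B : Finset V} {D : ℕ}
    (hB : ∀ u ∈ B, ∀ w ∈ B, T.Live S u w) (hD : ∀ u ∈ B, ∀ w ∈ B, T.dist u w ≤ D)
    (h2 : 2 ≤ B.card) :
    ∃ x, x ∉ S ∧ (B.card * (B.card - 1) : ℝ) ≤ 2 * D * T.pairSumThrough x S := by
  classical
  obtain ⟨x, hx⟩ := hT.exists_centroid B
  refine ⟨x, ?_, ?_⟩
  · obtain ⟨u, hu, hux⟩ := Finset.exists_mem_ne (by omega : 1 < B.card) x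
    have := hx u hu hux
    obtain ⟨w, hw⟩ := Finset.card_pos.1 (by omega : 0 < (B.filter fun w => T.Btw u x w).card)
    rw [Finset.mem_filter] at hw
    exact fun hxS => hB u hu w hw.1 x hxS hw.2
  · have hrow : ∀ u ∈ B.erase x, (B.card : ℝ) ≤ 2 * D *
        ∑ w, if T.Live S u w ∧ T.Btw u x w then ((T.dist u w : ℝ))⁻¹ else 0 := by
      intro u hu
      obtain ⟨hux, hu⟩ := Finset.mem_erase.1 hu
      have h3 : (B.card : ℝ) ≤ 2 * (B.filter fun w => T.Btw u x w).card := by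
        exact_mod_cast hx u hu hux
      refine h3.trans ?_
      rw [mul_assoc]
      refine mul_le_mul_of_nonneg_left ?_ zero_le_two
      rw [Finset.mul_sum]
      calc ((B.filter fun w => T.Btw u x w).card : ℝ)
          = ∑ w ∈ B.filter fun w => T.Btw u x w, 1 := by simp
        _ ≤ ∑ w ∈ B.filter fun w => T.Btw u x w,
            (D : ℝ) * (if T.Live S u w ∧ T.Btw u x w then ((T.dist u w : ℝ))⁻¹ else 0) := by
          refine Finset.sum_le_sum fun w hw => ?_
          rw [Finset.mem_filter] at hw
          rw [if_pos ⟨hB u hu w hw.1, hw.2⟩]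
          have huw : u ≠ w := by
            rintro rfl
            exact hux (hT.1.btw_self hw.2).symm
          have hpos : (0 : ℝ) < T.dist u w := by exact_mod_cast hT.1.pos_dist_of_ne huw
          have hle : (T.dist u w : ℝ) ≤ D := by exact_mod_cast hD u hu w hw.1
          rw [← div_eq_mul_inv, le_div_iff₀ hpos]
          linarith
        _ ≤ _ := by
          refine Finset.sum_le_sum_of_subset_of_nonneg (Finset.subset_univ _) fun w _ _ => ?_
          split_ifs <;> positivity
    have h4 : (B.card - 1 : ℝ) ≤ (B.erase x).card := by
      have := Finset.pred_card_le_card_erase (s := B) (a := x)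
      have h5 : (B.card : ℝ) ≤ (B.erase x).card + 1 := by exact_mod_cast (by omega)
      linarith
    calc (B.card * (B.card - 1) : ℝ) ≤ B.card * (B.erase x).card := by gcongr
      _ = ∑ u ∈ B.erase x, (B.card : ℝ) := by simp [mul_comm]
      _ ≤ _ := Finset.sum_le_sum hrow
      _ = 2 * D * ∑ u ∈ B.erase x,
          ∑ w, if T.Live S u w ∧ T.Btw u x w then ((T.dist u w : ℝ))⁻¹ else 0 := by
        rw [Finset.mul_sum]
      _ ≤ _ := by
        refine mul_le_mul_of_nonneg_left ?_ (by positivity)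
        refine Finset.sum_le_sum_of_subset_of_nonneg (Finset.subset_univ _) fun u _ _ =>
          Finset.sum_nonneg fun w _ => ?_
        split_ifs <;> positivity

open Classical in
/-- The vertices whose last ancestor in `S` is `s`. -/
noncomputable def ownSet (T : SimpleGraph V) (r : V) (S : Set V) (s : V) : Finset V :=
  Finset.univ.filter fun u => T.Btw r s u ∧ T.Live (S \ {s}) s u

theorem mem_ownSet {r s u : V} {S : Set V} :
    u ∈ T.ownSet r S s ↔ T.Btw r s u ∧ T.Live (S \ {s}) s u := by simp [ownSet]

theorem IsTree.self_mem_ownSet (hT : T.IsTree) (r s : V) (S : Set V) : s ∈ T.ownSet r S s :=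
  mem_ownSet.2 ⟨btw_right T r s, fun _ hx hb => hx.2 (hT.1.btw_self hb)⟩

/-- A vertex has at most one last ancestor in `S`, so these sets are disjoint and one of them has at
most average size. -/
theorem IsTree.exists_small_ownSet (hT : T.IsTree) (r : V) {S : Finset V} (hS : S.Nonempty) :
    ∃ s ∈ S, S.card * (T.ownSet r S s).card ≤ Fintype.card V := by
  classical
  by_contra! h
  have hdisj : ∀ s ∈ S, ∀ s' ∈ S, s ≠ s' → Disjoint (T.ownSet r S s) (T.ownSet r S s') := by
    intro s hs s' hs' hne
    rw [Finset.disjoint_left]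
    intro u hu hu'
    rw [mem_ownSet] at hu hu'
    rcases hT.chain hu.1 hu'.1 with h1 | h1
    · exact hu'.2 s ⟨hs, hne⟩ (hu.1.trans_right hT.1 h1)
    · exact hu.2 s' ⟨hs', hne.symm⟩ h1
  have h1 := Finset.card_le_univ (S.biUnion (T.ownSet r S))
  rw [Finset.card_biUnion hdisj] at h1
  have h2 : ∑ s ∈ S, Fintype.card V < ∑ s ∈ S, S.card * (T.ownSet r S s).card :=
    Finset.sum_lt_sum_of_nonempty hS h
  rw [← Finset.mul_sum, Finset.sum_const, smul_eq_mul] at h2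
  exact absurd (Nat.mul_le_mul_left S.card h1) (by omega)

open Classical in
/-- The vertices outside of `ownSet` that become connected with `s` when it is not deleted. -/
noncomputable def upperSet (T : SimpleGraph V) (r : V) (S : Set V) (s : V) : Finset V :=
  Finset.univ.filter fun w => T.Live (S \ {s}) s w ∧ w ∉ T.ownSet r S s

theorem mem_upperSet {r s w : V} {S : Set V} :
    w ∈ T.upperSet r S s ↔ T.Live (S \ {s}) s w ∧ w ∉ T.ownSet r S s := by simp [upperSet]

/-- If `s` lay between `u` and `w`, it would be an ancestor of one of them, which would then belong
to `ownSet`. So the upper vertices lie in one component even while `s` is still deleted. -/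
theorem IsTree.live_of_mem_upperSet (hT : T.IsTree) {r s : V} {S : Set V} {u w : V}
    (hu : u ∈ T.upperSet r S s) (hw : w ∈ T.upperSet r S s) : T.Live S u w := by
  rw [mem_upperSet] at hu hw
  intro x hx hb
  by_cases hxs : x = s
  · subst hxs
    rcases hT.btw_or_btw hb r with h | h
    · exact hu.2 (mem_ownSet.2 ⟨h.symm, hu.1⟩)
    · exact hw.2 (mem_ownSet.2 ⟨h.symm, hw.1⟩)
  · exact hT.live_trans hu.1.symm hw.1 x ⟨hx, hxs⟩ hb

/-- Of two vertices separated by `s`, at least one is a descendant of `s` and hence in `ownSet`. The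
factor 2 accounts for which of the two it is. -/
theorem IsTree.pairSumThrough_le (hT : T.IsTree) (r s : V) (S : Set V) :
    T.pairSumThrough s (S \ {s}) ≤ 2 * ((T.ownSet r S s).card *
      ((T.ownSet r S s).card + ∑ w ∈ T.upperSet r S s, ((T.dist s w : ℝ))⁻¹)) := by
  classical
  set O := T.ownSet r S s with hO
  set g : V → V → ℝ := fun u w =>
    if T.Live (S \ {s}) u w ∧ T.Btw u s w then ((T.dist u w : ℝ))⁻¹ else 0 with hg
  have hg0 : ∀ u w, 0 ≤ g u w := fun u w => by
    simp only [hg]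
    split_ifs <;> positivity
  have hgs : ∀ u w, g u w = g w u := fun u w => by
    simp only [hg]
    rw [T.dist_comm]
    refine if_congr ⟨fun h => ⟨h.1.symm, h.2.symm⟩, fun h => ⟨h.1.symm, h.2.symm⟩⟩ rfl rfl
  have hcov : ∀ u w, g u w ≤ (if u ∈ O then g u w else 0) + if w ∈ O then g u w else 0 := by
    intro u w
    by_cases h : T.Live (S \ {s}) u w ∧ T.Btw u s w
    · have hu : T.Live (S \ {s}) s u := (h.1.of_btw hT.1 h.2).symm
      have hw : T.Live (S \ {s}) s w := (h.1.symm.of_btw hT.1 h.2.symm).symm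
      have := hg0 u w
      rcases hT.btw_or_btw h.2 r with h1 | h1
      · rw [if_pos (mem_ownSet.2 ⟨h1.symm, hu⟩ : u ∈ O)]
        split_ifs <;> linarith
      · rw [if_pos (mem_ownSet.2 ⟨h1.symm, hw⟩ : w ∈ O)]
        split_ifs <;> linarith
    · have : g u w = 0 := if_neg h
      rw [this]; simp
  have h1 : T.pairSumThrough s (S \ {s}) ≤ 2 * ∑ u ∈ O, ∑ w, g u w := by
    calc T.pairSumThrough s (S \ {s}) = ∑ u, ∑ w, g u w := rfl
      _ ≤ ∑ u, ∑ w, ((if u ∈ O then g u w else 0) + if w ∈ O then g u w else 0) :=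
        Finset.sum_le_sum fun u _ => Finset.sum_le_sum fun w _ => hcov u w
      _ = ∑ u, ∑ w, (if u ∈ O then g u w else 0) + ∑ u, ∑ w, (if u ∈ O then g u w else 0) := by
        simp only [Finset.sum_add_distrib]
        congr 1
        rw [Finset.sum_comm]
        exact Finset.sum_congr rfl fun u _ => Finset.sum_congr rfl fun w _ => by rw [hgs]
      _ = 2 * ∑ u ∈ O, ∑ w, g u w := by
        rw [← two_mul]
        congr 1
        rw [← Finset.sum_filter_add_sum_filter_not Finset.univ (· ∈ O)]
        rw [Finset.filter_mem_eq_inter, Finset.univ_inter,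
          Finset.sum_eq_zero (s := Finset.filter _ _),
          add_zero]
        · exact Finset.sum_congr rfl fun u hu => Finset.sum_congr rfl fun w _ => if_pos hu
        · intro u hu
          exact Finset.sum_eq_zero fun w _ => if_neg (Finset.mem_filter.1 hu).2
  refine h1.trans (mul_le_mul_of_nonneg_left ?_ zero_le_two)
  rw [← nsmul_eq_mul, ← Finset.sum_const]
  refine Finset.sum_le_sum fun u hu => ?_
  -- A partner in `ownSet` is worth at most 1. Any other partner is in `upperSet` and reached
  -- through `s`, so it is no nearer to `u` than to `s`.
  have h2 : ∀ w, g u w ≤ (if w ∈ O then 1 else 0) +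
      if w ∈ T.upperSet r S s then ((T.dist s w : ℝ))⁻¹ else 0 := by
    intro w
    by_cases h : T.Live (S \ {s}) u w ∧ T.Btw u s w
    · have h3 : g u w = _ := if_pos h
      rw [h3]
      by_cases hw : w ∈ O
      · rw [if_pos hw]
        have := inv_natCast_le_one (T.dist u w)
        split_ifs
        · have : (0 : ℝ) ≤ (T.dist s w : ℝ)⁻¹ := by positivity
          linarith
        · linarith
      · rw [if_neg hw, if_pos (mem_upperSet.2 ⟨(h.1.symm.of_btw hT.1 h.2.symm).symm, hw⟩), zero_add]
        have hsw : s ≠ w := by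
          rintro rfl
          exact hw (hT.self_mem_ownSet r s S)
        have hpos : (0 : ℝ) < T.dist s w := by exact_mod_cast hT.1.pos_dist_of_ne hsw
        have h4 : T.dist u s + T.dist s w = T.dist u w := h.2
        exact inv_anti₀ hpos (by exact_mod_cast (by omega : T.dist s w ≤ T.dist u w))
    · have h3 : g u w = 0 := if_neg h
      rw [h3]
      have : (0 : ℝ) ≤ (T.dist s w : ℝ)⁻¹ := by positivity
      split_ifs <;> linarith
  refine (Finset.sum_le_sum fun w _ => h2 w).trans (le_of_eq ?_)
  rw [Finset.sum_add_distrib, Finset.sum_ite_mem, Finset.sum_ite_mem]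
  simp

open Classical in
/-- The vertices that are not separated from `v` by `S`. -/
noncomputable def liveSet (T : SimpleGraph V) (S : Set V) (v : V) : Finset V :=
  Finset.univ.filter fun u => T.Live S v u

theorem mem_liveSet {S : Set V} {v u : V} : u ∈ T.liveSet S v ↔ T.Live S v u := by
  simp [liveSet]

/-- If no other deletion of as many vertices is better, then the components are small. -/
theorem IsTree.card_liveSet_lt (hT : T.IsTree) {S : Finset V} (hS : S.Nonempty)
    (hopt : ∀ S' : Finset V, S'.card = S.card →
      T.pairSum Finset.univ S ≤ T.pairSum Finset.univ S') (v : V) :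
    (T.liveSet S v).card * S.card ^ 3 < 3200 * Fintype.card V ^ 3 := by
  classical
  have hne := hT.1.nonempty
  obtain ⟨r⟩ := id hne
  -- It suffices to bound a largest component, which then also bounds the upper set of `s`.
  obtain ⟨v₀, -, hv₀⟩ := Finset.exists_max_image Finset.univ (fun v => (T.liveSet S v).card)
    Finset.univ_nonempty
  obtain ⟨s, hs, hq⟩ := hT.exists_small_ownSet r hS
  -- Optimality against the exchange of `s` for `x`.
  have hexch : ∀ x ∉ (S : Set V), T.pairSumThrough x S ≤ T.pairSumThrough s (S \ {s}) := by
    intro x hx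
    have hxS : x ∉ S := hx
    have h1 := hopt (insert x (S.erase s)) (by
      rw [Finset.card_insert_of_notMem (fun h => hxS (Finset.mem_of_mem_erase h)),
        Finset.card_erase_add_one hs])
    rw [Finset.coe_insert, Finset.coe_erase] at h1
    have h2 := T.pairSum_exchange_le (S : Set V) x s
    linarith
  set q := (T.ownSet r S s).card with hqdef
  have hq1 : 1 ≤ q := Finset.card_pos.2 ⟨s, hT.self_mem_ownSet r s S⟩
  set p := (T.liveSet S v₀).card with hp
  set A := T.upperSet r S s with hA
  set B := A.filter fun w => T.dist s w ≤ 16 * q with hB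
  set b := B.card with hb
  suffices hmain : p < 3200 * q ^ 3 by
    have h1 : (T.liveSet S v).card ≤ p := hv₀ v (Finset.mem_univ _)
    calc (T.liveSet S v).card * S.card ^ 3 < 3200 * q ^ 3 * S.card ^ 3 :=
          Nat.mul_lt_mul_of_pos_right (h1.trans_lt hmain) (pow_pos (Finset.card_pos.2 hS) 3)
      _ = 3200 * (S.card * q) ^ 3 := by ring
      _ ≤ _ := by gcongr
  by_contra! hlarge
  have hq1' : (1 : ℝ) ≤ q := by exact_mod_cast hq1
  -- Upper vertices within distance `16 q` of `s` are worth at most 1 each, the at most `p` others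
  -- at most `1/(16 q)`. With this radius the far ones account for only `p/8`, less than the gain
  -- `p/2` of a centroid below.
  have hL : T.pairSumThrough s (S \ {s}) ≤ 2 * q ^ 2 + 2 * q * b + p / 8 := by
    refine (hT.pairSumThrough_le r s S).trans ?_
    have hAp : A.card ≤ p := by
      rcases A.eq_empty_or_nonempty with h | ⟨w, hw⟩
      · rw [h]; simp
      · refine (Finset.card_le_card fun u hu => ?_).trans (hv₀ w (Finset.mem_univ _))
        exact mem_liveSet.2 (hT.live_of_mem_upperSet hw hu)
    have h1 : ∑ w ∈ A, ((T.dist s w : ℝ))⁻¹ ≤ b + p / (16 * q) := by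
      have h2 : ∀ w ∈ A, ((T.dist s w : ℝ))⁻¹ ≤
          (if T.dist s w ≤ 16 * q then 1 else 0) + 1 / (16 * q) := by
        intro w _
        have h0 : (0 : ℝ) ≤ 1 / (16 * q) := by positivity
        split_ifs with h
        · have := inv_natCast_le_one (T.dist s w)
          linarith
        · rw [zero_add, ← one_div]
          refine one_div_le_one_div_of_le (by positivity) ?_
          exact_mod_cast (by omega : 16 * q ≤ T.dist s w)
      refine (Finset.sum_le_sum h2).trans ?_
      rw [Finset.sum_add_distrib, Finset.sum_boole, Finset.sum_const, nsmul_eq_mul, mul_one_div]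
      have : (A.card : ℝ) ≤ p := by exact_mod_cast hAp
      gcongr
    calc 2 * ((q : ℝ) * (q + ∑ w ∈ A, ((T.dist s w : ℝ))⁻¹))
        ≤ 2 * ((q : ℝ) * (q + (b + p / (16 * q)))) := by gcongr
      _ = 2 * q ^ 2 + 2 * q * b + p / 8 := by field_simp; ring
  have hp2 : 2 ≤ p := by
    have : 1 ≤ q ^ 3 := Nat.one_le_pow _ _ hq1
    omega
  -- The component has `p` vertices, so its distances are at most `p - 1`. This factor cancels and
  -- leaves a gain of at least `p/2`.
  obtain ⟨x, hx, hG⟩ := hT.exists_pairSumThrough_ge (S := (S : Set V)) (B := T.liveSet S v₀)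
    (D := p - 1) (fun u hu w hw => hT.live_trans (mem_liveSet.1 hu).symm (mem_liveSet.1 hw))
    (fun u hu w hw => by
      have := hT.1.dist_lt_card_btw u w (B := T.liveSet S v₀) fun y hy =>
        mem_liveSet.2 (hT.live_trans (mem_liveSet.1 hu)
          ((hT.live_trans (mem_liveSet.1 hu).symm (mem_liveSet.1 hw)).of_btw hT.1 hy))
      omega) hp2
  have hxL := hexch x hx
  have hp2' : (2 : ℝ) ≤ p := by exact_mod_cast hp2
  have hG' : (p : ℝ) ≤ 2 * T.pairSumThrough x S := by
    rw [Nat.cast_sub (by omega), Nat.cast_one] at hG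
    have : (0 : ℝ) < p - 1 := by linarith
    refine le_of_mul_le_mul_right ?_ this
    linarith
  have hlarge' : (3200 : ℝ) * q ^ 3 ≤ p := by exact_mod_cast hlarge
  -- the ball `B` is large
  have hb1 : 3 * (p : ℝ) ≤ 16 * q ^ 2 + 16 * q * b := by linarith
  -- From `3 * 3200 q^3 ≤ 16 q^2 + 16 q b` one gets `b ≥ 600 q^2 - q`.
  have hb2 : (599 : ℝ) * q ^ 2 ≤ b := by
    have h1 : (9600 : ℝ) * q ^ 2 ≤ 16 * q + 16 * b := by
      refine le_of_mul_le_mul_right ?_ (by linarith : (0 : ℝ) < q)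
      nlinarith
    nlinarith
  have hb3 : 2 ≤ b := by
    have : (2 : ℝ) ≤ b := by nlinarith
    exact_mod_cast this
  -- Now a centroid of the ball, whose distances are at most `32 q` by way of `s`.
  obtain ⟨y, hy, hGy⟩ := hT.exists_pairSumThrough_ge (S := (S : Set V)) (B := B)
    (D := 32 * q) (fun u hu w hw => hT.live_of_mem_upperSet (Finset.mem_filter.1 hu).1
      (Finset.mem_filter.1 hw).1)
    (fun u hu w hw => by
      have h1 := (Finset.mem_filter.1 hu).2
      have h2 := (Finset.mem_filter.1 hw).2
      have h3 := hT.1.dist_triangle (u := u) (v := s) (w := w)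
      rw [T.dist_comm] at h1
      omega) hb3
  have hyL := hexch y hy
  push_cast at hGy
  have h1 : (b : ℝ) * (b - 1) ≤ 2 * (32 * q) * (2 * q ^ 2 + 2 * q * b + p / 8) := by
    refine hGy.trans ?_
    gcongr
    linarith
  -- By `hb1`, `p/8` is at most `(2/3) q (q + b)`.
  have h2 : (2 : ℝ) * q ^ 2 + 2 * q * b + p / 8 ≤ (8 / 3) * q * (q + b) := by nlinarith
  have h3 : (q : ℝ) ≤ b := by nlinarith
  have h4 : (b : ℝ) * (b - 1) ≤ 64 * q * ((8 / 3) * q * (2 * b)) := by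
    refine h1.trans ?_
    have : (8 / 3) * (q : ℝ) * (q + b) ≤ (8 / 3) * q * (2 * b) := by
      gcongr; linarith
    calc _ = 64 * (q : ℝ) * (2 * q ^ 2 + 2 * q * b + p / 8) := by ring
      _ ≤ _ := by gcongr; linarith
  have h5 : (b : ℝ) - 1 ≤ 64 * q * ((8 / 3) * q * 2) := by
    refine le_of_mul_le_mul_left (a := (b : ℝ)) ?_ (by linarith)
    linarith
  -- The ball has at most `1 + (1024/3) q^2` vertices, but also at least `599 q^2`.
  nlinarith

end SimpleGraph

/-! ### Splitting the objective of a subtree at the component of its root -/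

namespace SimpleGraph

variable {V : Type*} {T : SimpleGraph V}

/-! ## Decomposition of rooted trees -/

theorem btw_of_child {r b c : V} (hbc : T.Adj b c) (hd : T.dist r b + 1 = T.dist r c) :
    T.Btw r b c := by
  have := dist_eq_one_iff_adj.2 hbc
  unfold Btw; omega

/-- If `u` lies below the top `c` with parent `b`, then `b` separates `u` from `v`. -/
theorem IsTree.btw_of_top (hT : T.IsTree) {r v b c u : V} (hb : T.Btw r v b) (hbc : T.Adj b c)
    (hd : T.dist r b + 1 = T.dist r c) (hu : T.Btw r c u) :
    T.Btw r v u ∧ T.Btw v b u ∧ b ≠ u := by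
  have h1 := btw_of_child hbc hd
  have h2 := hu.trans_left hT.1 h1
  refine ⟨h2.trans_left hT.1 hb, h2.trans_right hT.1 hb, ?_⟩
  rintro rfl
  have h3 : T.dist r c + T.dist c b = T.dist r b := hu
  omega

variable [Fintype V]

open Classical in
/-- The descendants of `v`, where `r` is the root. -/
noncomputable def subtree (T : SimpleGraph V) (r v : V) : Finset V :=
  Finset.univ.filter fun u => T.Btw r v u

theorem mem_subtree {r v u : V} : u ∈ T.subtree r v ↔ T.Btw r v u := by simp [subtree]

open Classical in
/-- The descendants of `v` that are not separated from `v` by `X`. -/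
noncomputable def crown (T : SimpleGraph V) (r v : V) (X : Set V) : Finset V :=
  Finset.univ.filter fun u => T.Btw r v u ∧ T.Live X v u

theorem mem_crown {r v u : V} {X : Set V} :
    u ∈ T.crown r v X ↔ T.Btw r v u ∧ T.Live X v u := by simp [crown]

open Classical in
/-- The descendants of `v` just below `K`. -/
noncomputable def border (T : SimpleGraph V) (r v : V) (K : Finset V) : Finset V :=
  Finset.univ.filter fun u => T.Btw r v u ∧ u ∉ K ∧ ∀ w, T.Btw v w u → w ≠ u → w ∈ K

theorem mem_border {r v u : V} {K : Finset V} :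
    u ∈ T.border r v K ↔ T.Btw r v u ∧ u ∉ K ∧ ∀ w, T.Btw v w u → w ≠ u → w ∈ K := by
  simp [border]

open Classical in
/-- The children of the vertices in `D`. -/
noncomputable def childSet (T : SimpleGraph V) (r : V) (D : Finset V) : Finset V :=
  Finset.univ.filter fun c => ∃ u ∈ D, T.Adj u c ∧ T.dist r u + 1 = T.dist r c

theorem mem_childSet {r c : V} {D : Finset V} :
    c ∈ T.childSet r D ↔ ∃ u ∈ D, T.Adj u c ∧ T.dist r u + 1 = T.dist r c := by
  simp [childSet]

/-- The vertices where the subtrees below `K` and its border begin. -/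
noncomputable def tops (T : SimpleGraph V) (r v : V) (K : Finset V) : Finset V :=
  T.childSet r (T.border r v K)

theorem IsTree.mem_subtree_of_mem_tops (hT : T.IsTree) {r v c : V} {K : Finset V}
    (hc : c ∈ T.tops r v K) : T.Btw r v c ∧ T.dist r v < T.dist r c := by
  obtain ⟨b, hb, hbc, hd⟩ := mem_childSet.1 hc
  rw [mem_border] at hb
  have h1 := hT.btw_of_top hb.1 hbc hd (btw_right T r c)
  have h2 : T.dist r v + T.dist v b = T.dist r b := hb.1
  exact ⟨h1.1, by omega⟩

/-- On the way from `v` down to a vertex outside of the crown, the first vertex that is not in the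
crown is on the border, and the next one, if any, is a top. If `v` itself is in `X`, the crown is
empty and the border is `{v}`. -/
theorem IsTree.subtree_eq (hT : T.IsTree) {r v u : V} {X : Set V} :
    u ∈ T.subtree r v ↔ u ∈ T.crown r v X ∨ u ∈ T.border r v (T.crown r v X) ∨
      ∃ c ∈ T.tops r v (T.crown r v X), u ∈ T.subtree r c := by
  constructor
  · intro hu
    rw [mem_subtree] at hu
    by_cases hK : u ∈ T.crown r v X
    · exact Or.inl hK
    right
    obtain ⟨b, ⟨hb, hbK⟩, hmin⟩ := (measure fun m => T.dist v m).wf.has_min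
      {b | T.Btw v b u ∧ b ∉ T.crown r v X} ⟨u, btw_right T v u, hK⟩
    have hrb : T.Btw r v b := hu.trans_right' hT.1 hb
    have hbD : b ∈ T.border r v (T.crown r v X) := by
      refine mem_border.2 ⟨hrb, hbK, fun w hw hne => ?_⟩
      by_contra hwK
      refine hmin w ⟨hb.trans_left hT.1 hw, hwK⟩ ?_
      have h1 : T.dist v w + T.dist w b = T.dist v b := hw
      have h2 := hT.1.pos_dist_of_ne hne
      show T.dist v w < T.dist v b
      omega
    by_cases hbu : b = u
    · exact Or.inl (hbu ▸ hbD)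
    right
    obtain ⟨c, hbc, hc⟩ := hT.1.exists_adj_btw hbu
    have hrbu : T.Btw r b u := by
      have h1 := hu.trans_left' hT.1 hb
      exact h1
    have hrbc : T.Btw r b c := hrbu.trans_right' hT.1 hc
    have hd := dist_eq_one_iff_adj.2 hbc
    refine ⟨c, mem_childSet.2 ⟨b, hbD, hbc, ?_⟩, mem_subtree.2 (hrbu.trans_left' hT.1 hc)⟩
    have h2 : T.dist r b + T.dist b c = T.dist r c := hrbc
    omega
  · rintro (hu | hu | ⟨c, hc, hu⟩)
    · exact mem_subtree.2 (mem_crown.1 hu).1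
    · exact mem_subtree.2 (mem_border.1 hu).1
    · obtain ⟨b, hb, hbc, hd⟩ := mem_childSet.1 hc
      exact mem_subtree.2 (hT.btw_of_top (mem_border.1 hb).1 hbc hd (mem_subtree.1 hu)).1

theorem disjoint_crown_border {r v : V} {K : Finset V} : Disjoint K (T.border r v K) :=
  Finset.disjoint_right.2 fun _ hu => (mem_border.1 hu).2.1

theorem IsTree.mem_crown_of_btw (hT : T.IsTree) {r v x u : V} {X : Set V}
    (hu : u ∈ T.crown r v X) (hx : T.Btw v x u) : x ∈ T.crown r v X := by
  rw [mem_crown] at hu ⊢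
  exact ⟨hu.1.trans_right' hT.1 hx, hu.2.of_btw hT.1 hx⟩

theorem IsTree.disjoint_crown_subtree (hT : T.IsTree) {r v c : V} {X : Set V}
    (hc : c ∈ T.tops r v (T.crown r v X)) : Disjoint (T.crown r v X) (T.subtree r c) := by
  obtain ⟨b, hb, hbc, hd⟩ := mem_childSet.1 hc
  rw [mem_border] at hb
  refine Finset.disjoint_right.2 fun u hu hu' => hb.2.1 ?_
  exact hT.mem_crown_of_btw hu' (hT.btw_of_top hb.1 hbc hd (mem_subtree.1 hu)).2.1

theorem IsTree.disjoint_border_subtree (hT : T.IsTree) {r v c : V} {X : Set V}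
    (hc : c ∈ T.tops r v (T.crown r v X)) :
    Disjoint (T.border r v (T.crown r v X)) (T.subtree r c) := by
  obtain ⟨b, hb, hbc, hd⟩ := mem_childSet.1 hc
  rw [mem_border] at hb
  refine Finset.disjoint_right.2 fun u hu hu' => hb.2.1 ?_
  have := hT.btw_of_top hb.1 hbc hd (mem_subtree.1 hu)
  exact (mem_border.1 hu').2.2 b this.2.1 this.2.2

/-- If two of these subtrees meet, one top lies above the other. Then the parent of the upper top
lies strictly above the parent of the lower one, hence in the crown, although it is on the border.
-/
theorem IsTree.disjoint_subtree_subtree (hT : T.IsTree) {r v c c' : V} {X : Set V}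
    (hc : c ∈ T.tops r v (T.crown r v X)) (hc' : c' ∈ T.tops r v (T.crown r v X))
    (hne : c ≠ c') : Disjoint (T.subtree r c) (T.subtree r c') := by
  have key : ∀ c c' u, c ∈ T.tops r v (T.crown r v X) → c' ∈ T.tops r v (T.crown r v X) → c ≠ c' →
      T.Btw r c u → T.Btw r c' u → T.Btw r c c' → False := by
    intro c c' u hc hc' hne hu hu' hcc
    obtain ⟨b, hb, hbc, hd⟩ := mem_childSet.1 hc
    obtain ⟨b', hb', hbc', hd'⟩ := mem_childSet.1 hc'
    rw [mem_border] at hb hb'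
    have h1 := btw_of_child hbc' hd'
    have h2 : T.dist r c + T.dist c c' = T.dist r c' := hcc
    have h3 := hT.1.pos_dist_of_ne hne
    have h4 : T.Btw r c b' := by
      rcases hT.chain h1 hcc with h | h
      · exact h
      · have h5 : T.dist b' c + T.dist c c' = T.dist b' c' := h
        have h6 := dist_eq_one_iff_adj.2 hbc'
        have h7 : T.dist b' c = 0 := by omega
        rw [hT.1.eq_of_dist_eq_zero h7]
        exact btw_right T r c
    have h5 := hT.btw_of_top hb.1 hbc hd h4
    exact hb.2.1 (hb'.2.2 b h5.2.1 h5.2.2)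
  refine Finset.disjoint_left.2 fun u hu hu' => ?_
  rw [mem_subtree] at hu hu'
  rcases hT.chain hu hu' with h | h
  · exact key c' c u hc' hc hne.symm hu' hu h
  · exact key c c' u hc hc' hne hu hu' (hu.trans_right' hT.1 h)

theorem IsTree.sum_subtree (hT : T.IsTree) (r v : V) (X : Set V) {M : Type*} [AddCommMonoid M]
    (f : V → M) :
    ∑ u ∈ T.subtree r v, f u = ∑ u ∈ T.crown r v X, f u +
      (∑ u ∈ T.border r v (T.crown r v X), f u +
        ∑ c ∈ T.tops r v (T.crown r v X), ∑ u ∈ T.subtree r c, f u) := by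
  classical
  rw [← Finset.sum_biUnion fun c hc c' hc' hne => hT.disjoint_subtree_subtree hc hc' hne,
    ← Finset.sum_union, ← Finset.sum_union]
  · refine Finset.sum_congr ?_ fun _ _ => rfl
    ext u
    rw [hT.subtree_eq (X := X)]
    simp only [Finset.mem_union, Finset.mem_biUnion]
  · refine Finset.disjoint_union_right.2 ⟨disjoint_crown_border, ?_⟩
    rw [Finset.disjoint_biUnion_right]
    exact fun c hc => hT.disjoint_crown_subtree hc
  · rw [Finset.disjoint_biUnion_right]
    exact fun c hc => hT.disjoint_border_subtree hc

/-- The sum of the inverse distances over all ordered pairs of vertices in `K`. -/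
noncomputable def fullPairSum (T : SimpleGraph V) (K : Finset V) : ℝ :=
  ∑ u ∈ K, ∑ w ∈ K, ((T.dist u w : ℝ))⁻¹

/-- The deleted border separates the lower subtrees from each other and from the crown. A geodesic
between two crown vertices stays in the crown and so avoids `S`. Hence only pairs inside one piece
count. -/
theorem IsTree.pairSum_subtree (hT : T.IsTree) (r v : V) {X S : Set V}
    (hK : ∀ u ∈ T.crown r v X, u ∉ S) (hD : ∀ u ∈ T.border r v (T.crown r v X), u ∈ S) :
    T.pairSum (T.subtree r v) S = T.fullPairSum (T.crown r v X) +
      ∑ c ∈ T.tops r v (T.crown r v X), T.pairSum (T.subtree r c) S := by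
  classical
  have hsep : ∀ c ∈ T.tops r v (T.crown r v X), ∀ u ∈ T.subtree r c, ∀ w, w ∉ T.subtree r c →
      ¬ T.Live S u w := by
    intro c hc u hu w hw h
    obtain ⟨b, hb, hbc, hd⟩ := mem_childSet.1 hc
    exact h b (hD b hb) (hT.btw_parent hbc hd (mem_subtree.1 hu) fun h => hw (mem_subtree.2 h))
  unfold pairSum fullPairSum
  rw [hT.sum_subtree r v X]
  congr 1
  · refine Finset.sum_congr rfl fun u hu => ?_
    rw [hT.sum_subtree r v X, Finset.sum_eq_zero (s := T.border r v _), zero_add,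
      Finset.sum_eq_zero (s := T.tops r v _), add_zero]
    · refine Finset.sum_congr rfl fun w hw => if_pos fun x hx hb => ?_
      refine hK x ?_ hx
      rcases hT.btw_or_btw hb v with h | h
      · exact hT.mem_crown_of_btw hu h.symm
      · exact hT.mem_crown_of_btw hw h.symm
    · exact fun c hc => Finset.sum_eq_zero fun w hw => if_neg fun h => hsep c hc w hw u
        (Finset.disjoint_left.1 (hT.disjoint_crown_subtree hc) hu) h.symm
    · exact fun w hw => if_neg fun h => h.not_mem_right (hD w hw)
  · rw [Finset.sum_eq_zero (s := T.border r v _), zero_add]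
    · refine Finset.sum_congr rfl fun c hc => Finset.sum_congr rfl fun u hu => ?_
      symm
      refine Finset.sum_subset (fun w hw => ?_) fun w _ hw => if_neg (hsep c hc u hu w hw)
      exact (hT.subtree_eq (X := X)).2 (Or.inr (Or.inr ⟨c, hc, hw⟩))
    · exact fun u hu => Finset.sum_eq_zero fun w _ => if_neg fun h => h.not_mem_left (hD u hu)

theorem IsTree.card_inter_subtree [DecidableEq V] (hT : T.IsTree) (r v : V) {X : Set V}
    {S : Finset V}
    (hK : ∀ u ∈ T.crown r v X, u ∉ S) (hD : ∀ u ∈ T.border r v (T.crown r v X), u ∈ S) :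
    (T.subtree r v ∩ S).card = (T.border r v (T.crown r v X)).card +
      ∑ c ∈ T.tops r v (T.crown r v X), (T.subtree r c ∩ S).card := by
  have h1 : ∀ A : Finset V, (A ∩ S).card = ∑ u ∈ A, if u ∈ S then 1 else 0 := fun A => by
    rw [Finset.sum_boole, Finset.filter_mem_eq_inter]; simp
  simp only [h1]
  rw [hT.sum_subtree r v X, Finset.sum_eq_zero fun u hu => if_neg (hK u hu), zero_add,
    Finset.sum_congr rfl fun u hu => if_pos (hD u hu)]
  simp

theorem IsTree.mem_subtree_of_btw (hT : T.IsTree) {r c u x w : V} (hu : u ∈ T.subtree r c)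
    (hw : w ∈ T.subtree r c) (h : T.Btw u x w) : x ∈ T.subtree r c := by
  rw [mem_subtree] at *
  have key : ∀ u w, T.Btw r c u → T.Btw r c w → T.Btw u x w → T.Btw u x r → T.Btw r c x := by
    intro u w hu hw h hx
    rcases hT.chain hu hx.symm with h1 | h1
    -- Here `x` is an ancestor of `c`, so both halves of the geodesic pass through `c`. It would be
    -- shorter without the detour to `x`, unless `x = c`.
    · have h2 := hu.trans_right hT.1 h1
      have h3 := hw.trans_right hT.1 h1
      have h4 := hT.1.dist_triangle (u := u) (v := c) (w := w)
      unfold Btw at h h2 h3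
      rw [T.dist_comm (u := u) (v := x)] at h
      rw [T.dist_comm (u := u) (v := c)] at h4
      have h5 : T.dist x c = 0 := by omega
      rw [hT.1.eq_of_dist_eq_zero h5]
      exact btw_right T r c
    · exact hu.trans_right' hT.1 h1
  rcases hT.btw_or_btw h r with h1 | h1
  · exact key u w hu hw h h1
  · exact key w u hw hu h.symm h1

theorem IsTree.pairSum_subtree_congr (hT : T.IsTree) {r c : V} {S S' : Set V}
    (h : ∀ x ∈ T.subtree r c, x ∈ S ↔ x ∈ S') :
    T.pairSum (T.subtree r c) S = T.pairSum (T.subtree r c) S' := by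
  classical
  unfold pairSum
  refine Finset.sum_congr rfl fun u hu => Finset.sum_congr rfl fun w hw => ?_
  refine if_congr ⟨fun hl x hx hb => ?_, fun hl x hx hb => ?_⟩ rfl rfl
  · exact hl x ((h x (hT.mem_subtree_of_btw hu hw hb)).2 hx) hb
  · exact hl x ((h x (hT.mem_subtree_of_btw hu hw hb)).1 hx) hb

/-- Deletions in the subtrees below a crown can be combined. -/
theorem IsTree.exists_glue [DecidableEq V] (hT : T.IsTree) (r v : V) (X : Set V)
    (F : V → Finset V) :
    ∃ S : Finset V,
      (T.subtree r v ∩ S).card = (T.border r v (T.crown r v X)).card +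
        ∑ c ∈ T.tops r v (T.crown r v X), (T.subtree r c ∩ F c).card ∧
      T.pairSum (T.subtree r v) S = T.fullPairSum (T.crown r v X) +
        ∑ c ∈ T.tops r v (T.crown r v X), T.pairSum (T.subtree r c) (F c : Finset V) := by
  set S := T.border r v (T.crown r v X) ∪
    (T.tops r v (T.crown r v X)).biUnion fun c => T.subtree r c ∩ F c with hS
  have hmem : ∀ c ∈ T.tops r v (T.crown r v X), ∀ x ∈ T.subtree r c, x ∈ S ↔ x ∈ F c := by
    intro c hc x hx
    simp only [hS, Finset.mem_union, Finset.mem_biUnion, Finset.mem_inter]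
    constructor
    · rintro (h | ⟨c', hc', hx', h⟩)
      · exact absurd hx (Finset.disjoint_left.1 (hT.disjoint_border_subtree hc) h)
      · by_cases hcc : c = c'
        · exact hcc ▸ h
        · exact absurd hx' (Finset.disjoint_left.1 (hT.disjoint_subtree_subtree hc hc' hcc) hx)
    · exact fun h => Or.inr ⟨c, hc, hx, h⟩
  have hK : ∀ u ∈ T.crown r v X, u ∉ S := by
    intro u hu
    simp only [hS, Finset.mem_union, Finset.mem_biUnion, Finset.mem_inter, not_or, not_exists]
    refine ⟨Finset.disjoint_left.1 disjoint_crown_border hu, fun c h => ?_⟩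
    exact Finset.disjoint_left.1 (hT.disjoint_crown_subtree h.1) hu h.2.1
  have hD : ∀ u ∈ T.border r v (T.crown r v X), u ∈ S := fun u hu => Finset.mem_union_left _ hu
  refine ⟨S, ?_, ?_⟩
  · rw [hT.card_inter_subtree r v hK hD]
    congr 1
    refine Finset.sum_congr rfl fun c hc => congrArg _ ?_
    ext x
    simp only [Finset.mem_inter]
    exact and_congr_right fun hx => hmem c hc x hx
  · rw [hT.pairSum_subtree r v (S := (S : Set V)) hK hD]
    congr 1
    exact Finset.sum_congr rfl fun c hc => hT.pairSum_subtree_congr fun x hx => hmem c hc x hx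

/-- All vertices strictly between it and above, from `v` on, are in the crown and thus not deleted.
Were it not deleted either, it would belong to the crown. -/
theorem mem_of_mem_border_crown {r v u : V} {S : Set V}
    (hu : u ∈ T.border r v (T.crown r v S)) : u ∈ S := by
  obtain ⟨h1, h2, h3⟩ := mem_border.1 hu
  by_contra hS
  refine h2 (mem_crown.2 ⟨h1, fun x hx hb => ?_⟩)
  have := h3 x hb (by rintro rfl; exact hS hx)
  exact (mem_crown.1 this).2.not_mem_right hx

theorem not_mem_of_mem_crown {r v u : V} {S : Set V} (hu : u ∈ T.crown r v S) : u ∉ S :=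
  (mem_crown.1 hu).2.not_mem_right

/-- Keeping only the component of `v` separates `v` from the same vertices as deleting `S` does.
Thus a small component describes the crown as well as a small `S`. -/
theorem IsTree.crown_compl_liveSet (hT : T.IsTree) (r v : V) (S : Set V) :
    T.crown r v ((T.liveSet S v : Set V)ᶜ) = T.crown r v S := by
  ext u
  rw [mem_crown, mem_crown]
  refine and_congr_right fun _ => ⟨fun h => ?_, fun h x hx hb => ?_⟩
  · by_contra hu
    exact h u (by simpa [mem_liveSet] using hu) (btw_right T v u)
  · have : ¬ T.Live S v x := by simpa [mem_liveSet] using hx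
    exact this (h.of_btw hT.1 hb)

theorem subtree_root (T : SimpleGraph V) (r : V) : T.subtree r r = Finset.univ := by
  ext u
  simp [mem_subtree, btw_left]

end SimpleGraph

/-! ### The algorithm in the loop language, and its verification -/

namespace RealRAM

/-! ## Rules for expressions and for filling arrays -/

open Classical in
/-- The number `1` if `p` holds, and `0` otherwise. -/
noncomputable def flag (p : Prop) : ℝ := if p then 1 else 0

theorem flag_true {p : Prop} (h : p) : flag p = 1 := if_pos h

theorem flag_false {p : Prop} (h : ¬ p) : flag p = 0 := if_neg h

theorem flag_mul (p q : Prop) : flag p * flag q = flag (p ∧ q) := by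
  by_cases hp : p <;> by_cases hq : q <;> simp [flag, hp, hq]

theorem one_sub_flag (p : Prop) : 1 - flag p = flag (¬ p) := by
  by_cases hp : p <;> simp [flag, hp]

theorem flag_congr {p q : Prop} (h : p ↔ q) : flag p = flag q := by rw [propext h]

theorem flag_nonneg (p : Prop) : 0 ≤ flag p := by
  by_cases hp : p <;> simp [flag, hp]

/-- The loop language has no conditionals and no logic. Conjunctions are products of flags, and
quantifiers over vertices are sums of flags compared with `0` or `1`. -/
theorem sum_flag_le_zero {ι : Type*} (s : Finset ι) (p : ι → Prop) :
    ∑ i ∈ s, flag (p i) ≤ 0 ↔ ∀ i ∈ s, ¬ p i := by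
  have h0 : 0 ≤ ∑ i ∈ s, flag (p i) := Finset.sum_nonneg fun i _ => flag_nonneg _
  rw [h0.ge_iff_eq', Finset.sum_eq_zero_iff_of_nonneg fun i _ => flag_nonneg _]
  refine forall₂_congr fun i _ => ?_
  by_cases h : p i <;> simp [flag, h]

theorem one_le_sum_flag {ι : Type*} (s : Finset ι) (p : ι → Prop) :
    1 ≤ ∑ i ∈ s, flag (p i) ↔ ∃ i ∈ s, p i := by
  constructor
  · intro h
    by_contra! hn
    have := (sum_flag_le_zero s p).2 hn
    linarith
  · rintro ⟨i, hi, hp⟩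
    have := Finset.single_le_sum (f := fun i => flag (p i)) (fun i _ => flag_nonneg _) hi
    simpa [flag_true hp] using this

open Classical in
theorem sum_flag {ι : Type*} (s : Finset ι) (p : ι → Prop) :
    ∑ i ∈ s, flag (p i) = ((s.filter p).card : ℝ) := by
  unfold flag
  rw [Finset.sum_boole]

/-- The quotient is the number of positive multiples of `y` that are at most `x`. This replaces the
missing rounding operation; `B` only has to be large enough that no multiple is overlooked. -/
theorem natCast_div_eq_sum_flag {x y B : ℕ} (hy : 0 < y) (hx : x < B) :
    ∑ q ∈ Finset.range B, flag (((q : ℝ) + 1) * y ≤ x) = ((x / y : ℕ) : ℝ) := by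
  classical
  rw [sum_flag]
  congr 1
  have : (Finset.range B).filter (fun q : ℕ => ((q : ℝ) + 1) * y ≤ x) = Finset.range (x / y) := by
    ext q
    have h1 : ((q : ℝ) + 1) * y ≤ x ↔ q < x / y := by
      rw [Nat.lt_iff_add_one_le, Nat.le_div_iff_mul_le hy]
      exact_mod_cast Iff.rfl
    have h2 := Nat.div_le_self x y
    simp only [Finset.mem_filter, Finset.mem_range, h1]
    omega
  rw [this, Finset.card_range]

theorem iter_min_le (z : ℝ) (f : ℕ → ℝ) (c : ℕ) :
    iter .min z f c ≤ z ∧ ∀ i < c, iter .min z f c ≤ f i := by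
  induction c with
  | zero => simp [iter]
  | succ c ih =>
    simp only [iter, Op.app]
    refine ⟨(min_le_left _ _).trans ih.1, fun i hi => ?_⟩
    rcases Nat.lt_succ_iff_lt_or_eq.1 hi with hi | rfl
    · exact (min_le_left _ _).trans (ih.2 i hi)
    · exact min_le_right _ _

theorem iter_min_eq (z : ℝ) (f : ℕ → ℝ) (c : ℕ) :
    iter .min z f c = z ∨ ∃ i < c, iter .min z f c = f i := by
  induction c with
  | zero => simp [iter]
  | succ c ih =>
    simp only [iter, Op.app]
    rcases min_choice (iter .min z f c) (f c) with h | h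
    · rw [h]
      rcases ih with ih | ⟨i, hi, ih⟩
      · exact Or.inl ih
      · exact Or.inr ⟨i, by omega, ih⟩
    · exact Or.inr ⟨c, by omega, h⟩

theorem iter_add (z : ℝ) (f : ℕ → ℝ) (c : ℕ) :
    iter .add z f c = z + ∑ i ∈ Finset.range c, f i := by
  induction c with
  | zero => simp [iter]
  | succ c ih => simp [iter, Op.app, ih, Finset.sum_range_succ, add_assoc]

theorem iter_mul (z : ℝ) (f : ℕ → ℝ) (c : ℕ) :
    iter .mul z f c = z * ∏ i ∈ Finset.range c, f i := by
  induction c with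
  | zero => simp [iter]
  | succ c ih => simp [iter, Op.app, ih, Finset.prod_range_succ, mul_assoc]

instance : Add Ex := ⟨.bin .add⟩
instance : Sub Ex := ⟨.bin .sub⟩
instance : Mul Ex := ⟨.bin .mul⟩

section
variable {C : Ctx} {H : Heap} {ρ : Env}

@[simp] theorem Ex.eval_add (e f : Ex) : (e + f).eval C H ρ = e.eval C H ρ + f.eval C H ρ := rfl
@[simp] theorem Ex.eval_sub (e f : Ex) : (e - f).eval C H ρ = e.eval C H ρ - f.eval C H ρ := rfl
@[simp] theorem Ex.eval_mul (e f : Ex) : (e * f).eval C H ρ = e.eval C H ρ * f.eval C H ρ := rfl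
@[simp] theorem Ex.ok_add (e f : Ex) : (e + f).Ok C H ρ ↔ e.Ok C H ρ ∧ f.Ok C H ρ := Iff.rfl
@[simp] theorem Ex.ok_sub (e f : Ex) : (e - f).Ok C H ρ ↔ e.Ok C H ρ ∧ f.Ok C H ρ := Iff.rfl
@[simp] theorem Ex.ok_mul (e f : Ex) : (e * f).Ok C H ρ ↔ e.Ok C H ρ ∧ f.Ok C H ρ := Iff.rfl
@[simp] theorem Ex.eval_lit (q : ℚ) : (Ex.lit q).eval C H ρ = q := rfl
@[simp] theorem Ex.eval_var (x : ℕ) : (Ex.var x).eval C H ρ = ρ x := rfl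
@[simp] theorem Ex.eval_inv (e : Ex) : (Ex.inv e).eval C H ρ = (e.eval C H ρ)⁻¹ := rfl
@[simp] theorem Ex.eval_get (a : ℕ) (i j k : Ix) :
    (Ex.get a i j k).eval C H ρ = H a (i.eval ρ) (j.eval ρ) (k.eval ρ) := rfl
@[simp] theorem Ex.ok_lit (q : ℚ) : (Ex.lit q).Ok C H ρ := trivial
@[simp] theorem Ex.ok_var (x : ℕ) : (Ex.var x).Ok C H ρ := trivial
@[simp] theorem Ex.ok_inv (e : Ex) : (Ex.inv e).Ok C H ρ ↔ e.Ok C H ρ := Iff.rfl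
@[simp] theorem Ex.ok_get (a : ℕ) (i j k : Ix) : (Ex.get a i j k).Ok C H ρ ↔
    a < arrCount ∧ i.eval ρ ≤ C.n ∧ j.eval ρ ≤ C.n ∧ k.eval ρ ≤ C.n := Iff.rfl
@[simp] theorem Ix.eval_lit (c : ℕ) : (Ix.lit c).eval ρ = c := rfl
@[simp] theorem Ix.eval_var (x c : ℕ) : (Ix.var x c).eval ρ = ρ x + c := rfl

/-- `1` if `e ≤ f`, and `0` otherwise -/
def Ex.le (e f : Ex) : Ex := .bin .le e f

/-- `1` if `e = f`, and `0` otherwise -/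
def Ex.eq (e f : Ex) : Ex := e.le f * f.le e

def Ex.not (e : Ex) : Ex := .lit 1 - e

def Ex.min (e f : Ex) : Ex := .bin .min e f

def Ex.sum (x : ℕ) (b e : Ex) : Ex := .fold .add x b (.lit 0) e

def Ex.prod (x : ℕ) (b e : Ex) : Ex := .fold .mul x b (.lit 1) e

@[simp] theorem Ex.eval_le (e f : Ex) :
    (e.le f).eval C H ρ = flag (e.eval C H ρ ≤ f.eval C H ρ) := rfl

@[simp] theorem Ex.eval_eq (e f : Ex) :
    (e.eq f).eval C H ρ = flag (e.eval C H ρ = f.eval C H ρ) := by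
  simp only [Ex.eq, Ex.eval_mul, Ex.eval_le, flag_mul]
  exact flag_congr le_antisymm_iff.symm

@[simp] theorem Ex.eval_not (e : Ex) : e.not.eval C H ρ = 1 - e.eval C H ρ := by simp [Ex.not]

@[simp] theorem Ex.eval_min (e f : Ex) :
    (e.min f).eval C H ρ = Min.min (e.eval C H ρ) (f.eval C H ρ) := rfl

@[simp] theorem Ex.ok_le (e f : Ex) : (e.le f).Ok C H ρ ↔ e.Ok C H ρ ∧ f.Ok C H ρ := Iff.rfl

@[simp] theorem Ex.ok_eq (e f : Ex) : (e.eq f).Ok C H ρ ↔ e.Ok C H ρ ∧ f.Ok C H ρ := by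
  simp only [Ex.eq, Ex.ok_mul, Ex.ok_le]; tauto

@[simp] theorem Ex.ok_not (e : Ex) : e.not.Ok C H ρ ↔ e.Ok C H ρ := by simp [Ex.not]

@[simp] theorem Ex.ok_min (e f : Ex) : (e.min f).Ok C H ρ ↔ e.Ok C H ρ ∧ f.Ok C H ρ := Iff.rfl

theorem Ex.ok_fold {op : Op} {x c : ℕ} {b z e : Ex} (hb : b.Ok C H ρ) (hc : b.eval C H ρ = c)
    (hle : c ≤ C.bd) : (Ex.fold op x b z e).Ok C H ρ ↔
      z.Ok C H ρ ∧ ∀ i < c, e.Ok C H (Function.update ρ x i) := by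
  constructor
  · rintro ⟨-, h1, c', h2, -, h3⟩
    rw [hc] at h2
    rw [Nat.cast_injective h2]
    exact ⟨h1, h3⟩
  · rintro ⟨h1, h2⟩
    exact ⟨hb, h1, c, hc, hle, h2⟩

theorem Ex.ok_sum {x c : ℕ} {b e : Ex} (hb : b.Ok C H ρ) (hc : b.eval C H ρ = c)
    (hle : c ≤ C.bd) :
    (Ex.sum x b e).Ok C H ρ ↔ ∀ i < c, e.Ok C H (Function.update ρ x i) := by
  rw [Ex.sum, Ex.ok_fold hb hc hle]; simp

theorem Ex.eval_sum {x c : ℕ} {b e : Ex} (hc : b.eval C H ρ = c) :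
    (Ex.sum x b e).eval C H ρ = ∑ i ∈ Finset.range c, e.eval C H (Function.update ρ x i) := by
  simp [Ex.sum, Ex.eval, hc, iter_add]

theorem Ex.eval_prod {x c : ℕ} {b e : Ex} (hc : b.eval C H ρ = c) :
    (Ex.prod x b e).eval C H ρ = ∏ i ∈ Finset.range c, e.eval C H (Function.update ρ x i) := by
  simp [Ex.prod, Ex.eval, hc, iter_mul]

end

/-- The heaps agree outside of the entries of the array `a` whose indices satisfy `p`. -/
def Heap.AgreeOff (a : ℕ) (p : ℕ → ℕ → ℕ → Prop) (H H' : Heap) : Prop :=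
  ∀ a' i j k, ¬ (a' = a ∧ p i j k) → H' a' i j k = H a' i j k

theorem Heap.AgreeOff.array {a a' : ℕ} {p : ℕ → ℕ → ℕ → Prop} {H H' : Heap}
    (h : Heap.AgreeOff a p H H') (ha : a' ≠ a) : H' a' = H a' := by
  funext i j k
  exact h a' i j k fun h => ha h.1

theorem Heap.AgreeOff.same {a i j k : ℕ} {p : ℕ → ℕ → ℕ → Prop} {H H' : Heap}
    (h : Heap.AgreeOff a p H H') (hp : ¬ p i j k) : H' a i j k = H a i j k :=
  h a i j k fun h => hp h.2

/-- The invariant is that the entries already written hold their values and all others are as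
before. Injectivity keeps later rounds from overwriting earlier ones. The expression may still
depend on old entries of `a` that are yet to be written. -/
theorem wp_fill {C : Ctx} {ρ : Env} {Q : Heap → Prop} {H : Heap} {x a c : ℕ} {b e : Ex}
    {i j k : Ix} (v : ℕ → ℝ) (hb : b.Ok C H ρ) (hc : b.eval C H ρ = c) (hle : c ≤ C.bd)
    (ha : a < arrCount)
    (hinj : ∀ s t, s < c → t < c → i.eval (Function.update ρ x s) = i.eval (Function.update ρ x t) →
      j.eval (Function.update ρ x s) = j.eval (Function.update ρ x t) →
      k.eval (Function.update ρ x s) = k.eval (Function.update ρ x t) → s = t)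
    (hidx : ∀ t < c, i.eval (Function.update ρ x t) ≤ C.n ∧ j.eval (Function.update ρ x t) ≤ C.n ∧
      k.eval (Function.update ρ x t) ≤ C.n)
    (he : ∀ t < c, ∀ H', Heap.AgreeOff a (fun i' j' k' => ∃ s < t,
        i' = i.eval (Function.update ρ x s) ∧ j' = j.eval (Function.update ρ x s) ∧
        k' = k.eval (Function.update ρ x s)) H H' →
      e.Ok C H' (Function.update ρ x t) ∧ e.eval C H' (Function.update ρ x t) = v t)
    (hQ : ∀ H', Heap.AgreeOff a (fun i' j' k' => ∃ s < c,
        i' = i.eval (Function.update ρ x s) ∧ j' = j.eval (Function.update ρ x s) ∧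
        k' = k.eval (Function.update ρ x s)) H H' →
      (∀ t < c, H' a (i.eval (Function.update ρ x t)) (j.eval (Function.update ρ x t))
        (k.eval (Function.update ρ x t)) = v t) → Q H') :
    wp C (.loop x b (.put a i j k e)) ρ Q H := by
  refine ⟨hb, c, hc, hle, fun t H' => Heap.AgreeOff a (fun i' j' k' => ∃ s < t,
        i' = i.eval (Function.update ρ x s) ∧ j' = j.eval (Function.update ρ x s) ∧
        k' = k.eval (Function.update ρ x s)) H H' ∧
      ∀ s < t, H' a (i.eval (Function.update ρ x s)) (j.eval (Function.update ρ x s))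
        (k.eval (Function.update ρ x s)) = v s,
    ⟨fun _ _ _ _ _ => rfl, fun s hs => absurd hs (Nat.not_lt_zero s)⟩, ?_,
    fun H' h => hQ H' h.1 h.2⟩
  rintro t ht H' ⟨h1, h2⟩
  obtain ⟨h3, h4⟩ := he t ht H' h1
  obtain ⟨h5, h6, h7⟩ := hidx t ht
  refine ⟨h3, ha, h5, h6, h7, fun a' i' j' k' hn => ?_, fun s hs => ?_⟩
  · have hne : ¬ (a' = a ∧ i' = i.eval (Function.update ρ x t) ∧
        j' = j.eval (Function.update ρ x t) ∧ k' = k.eval (Function.update ρ x t)) :=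
      fun h => hn ⟨h.1, t, by omega, h.2⟩
    rw [Heap.set, if_neg hne]
    refine h1 a' i' j' k' fun h => hn ⟨h.1, ?_⟩
    obtain ⟨s, hs, h⟩ := h.2
    exact ⟨s, by omega, h⟩
  · unfold Heap.set
    rcases Nat.lt_succ_iff_lt_or_eq.1 hs with hs | rfl
    · rw [if_neg, h2 s hs]
      rintro ⟨-, g1, g2, g3⟩
      have := hinj s t (by omega) ht g1 g2 g3
      omega
    · rw [if_pos ⟨rfl, rfl, rfl, rfl⟩, h4]

/-- Fill a two-dimensional section of an array. -/
theorem wp_fill₂ {C : Ctx} {ρ : Env} {Q : Heap → Prop} {H : Heap} {x y a c d : ℕ} {b b' e : Ex}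
    {i j k : Ix} (v : ℕ → ℕ → ℝ) (hb : b.Ok C H ρ) (hc : b.eval C H ρ = c) (hle : c ≤ C.bd)
    (hb' : ∀ s < c, ∀ H', (∀ a' ≠ a, H' a' = H a') → b'.Ok C H' (Function.update ρ x s) ∧
      b'.eval C H' (Function.update ρ x s) = d) (hle' : d ≤ C.bd) (ha : a < arrCount)
    (hinj : ∀ s t s' t', s < c → t < d → s' < c → t' < d →
      i.eval (Function.update (Function.update ρ x s) y t) =
        i.eval (Function.update (Function.update ρ x s') y t') →
      j.eval (Function.update (Function.update ρ x s) y t) =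
        j.eval (Function.update (Function.update ρ x s') y t') →
      k.eval (Function.update (Function.update ρ x s) y t) =
        k.eval (Function.update (Function.update ρ x s') y t') → s = s' ∧ t = t')
    (hidx : ∀ s < c, ∀ t < d, i.eval (Function.update (Function.update ρ x s) y t) ≤ C.n ∧
      j.eval (Function.update (Function.update ρ x s) y t) ≤ C.n ∧
      k.eval (Function.update (Function.update ρ x s) y t) ≤ C.n)
    (he : ∀ s < c, ∀ t < d, ∀ H', Heap.AgreeOff a (fun i' j' k' => ∃ s < c, ∃ t < d,
        i' = i.eval (Function.update (Function.update ρ x s) y t) ∧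
        j' = j.eval (Function.update (Function.update ρ x s) y t) ∧
        k' = k.eval (Function.update (Function.update ρ x s) y t)) H H' →
      e.Ok C H' (Function.update (Function.update ρ x s) y t) ∧
      e.eval C H' (Function.update (Function.update ρ x s) y t) = v s t)
    (hQ : ∀ H', Heap.AgreeOff a (fun i' j' k' => ∃ s < c, ∃ t < d,
        i' = i.eval (Function.update (Function.update ρ x s) y t) ∧
        j' = j.eval (Function.update (Function.update ρ x s) y t) ∧
        k' = k.eval (Function.update (Function.update ρ x s) y t)) H H' →
      (∀ s < c, ∀ t < d, H' a (i.eval (Function.update (Function.update ρ x s) y t))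
        (j.eval (Function.update (Function.update ρ x s) y t))
        (k.eval (Function.update (Function.update ρ x s) y t)) = v s t) → Q H') :
    wp C (.loop x b (.loop y b' (.put a i j k e))) ρ Q H := by
  refine ⟨hb, c, hc, hle, fun m H' => Heap.AgreeOff a (fun i' j' k' => ∃ s < m, ∃ t < d,
        i' = i.eval (Function.update (Function.update ρ x s) y t) ∧
        j' = j.eval (Function.update (Function.update ρ x s) y t) ∧
        k' = k.eval (Function.update (Function.update ρ x s) y t)) H H' ∧
      (∀ s < m, ∀ t < d, H' a (i.eval (Function.update (Function.update ρ x s) y t))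
        (j.eval (Function.update (Function.update ρ x s) y t))
        (k.eval (Function.update (Function.update ρ x s) y t)) = v s t),
    ⟨fun _ _ _ _ _ => rfl, fun s hs => absurd hs (Nat.not_lt_zero s)⟩, ?_,
    fun H' h => hQ H' h.1 h.2⟩
  rintro m hm H' ⟨h1, h2⟩
  obtain ⟨h3, h4⟩ := hb' m hm H' fun a' ha' => h1.array ha'
  refine wp_fill (v m) h3 h4 hle' ha (fun s t hs ht g1 g2 g3 =>
    (hinj m s m t hm hs hm ht g1 g2 g3).2) (fun t ht => hidx m hm t ht) ?_ ?_
  · intro t ht H'' h5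
    refine he m hm t ht H'' fun a' i' j' k' hn => ?_
    rw [h5 a' i' j' k' fun h => hn ⟨h.1, ?_⟩, h1 a' i' j' k' fun h => hn ⟨h.1, ?_⟩]
    · obtain ⟨s, hs, t, ht, h⟩ := h.2
      exact ⟨s, by omega, t, ht, h⟩
    · obtain ⟨s, hs, h⟩ := h.2
      exact ⟨m, hm, s, by omega, h⟩
  · intro H'' h5 h6
    refine ⟨fun a' i' j' k' hn => ?_, fun s hs t ht => ?_⟩
    · rw [h5 a' i' j' k' fun h => hn ⟨h.1, ?_⟩, h1 a' i' j' k' fun h => hn ⟨h.1, ?_⟩]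
      · obtain ⟨s, hs, t, ht, h⟩ := h.2
        exact ⟨s, by omega, t, ht, h⟩
      · obtain ⟨s, hs, h⟩ := h.2
        exact ⟨m, by omega, s, by omega, h⟩
    · rcases Nat.lt_succ_iff_lt_or_eq.1 hs with hs | rfl
      · rw [h5.same, h2 s hs t ht]
        rintro ⟨t', ht', g1, g2, g3⟩
        have := (hinj s t m t' (by omega) ht hm ht' g1 g2 g3).1
        omega
      · exact h6 t ht

/-! ## Tables indexed by vertices -/

section
variable {C : Ctx} {n : ℕ} {H : Heap} {ρ : Env} {Q : Heap → Prop} {x y a : ℕ} {b b' e : Ex}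

/-- Fill the entries `a[0], …, a[n - 1]`. -/
theorem wp_row (v : Fin n → ℝ) (hn : C.n = n) (hb : b.Ok C H ρ) (hc : b.eval C H ρ = n)
    (hle : n ≤ C.bd) (ha : a < arrCount)
    (he : ∀ u : Fin n, ∀ H', (∀ a' ≠ a, H' a' = H a') →
      e.Ok C H' (Function.update ρ x u) ∧ e.eval C H' (Function.update ρ x u) = v u)
    (hQ : ∀ H', (∀ a' ≠ a, H' a' = H a') → (∀ u : Fin n, H' a u 0 0 = v u) → Q H') :
    wp C (.loop x b (.put a (.var x 0) (.lit 0) (.lit 0) e)) ρ Q H := by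
  refine wp_fill (fun t => if h : t < n then v ⟨t, h⟩ else 0) hb hc hle ha ?_ ?_ ?_ ?_
  · intro s t _ _ h _ _
    simpa using h
  · intro t ht
    simp; omega
  · intro t ht H' h
    have := he ⟨t, ht⟩ H' fun a' ha' => h.array ha'
    simpa [ht] using this
  · intro H' h h'
    refine hQ H' (fun a' ha' => h.array ha') fun u => ?_
    have := h' u u.2
    simpa using this

/-- Fill the entries `a[0, 0], …, a[n - 1, n - 1]`. -/
theorem wp_table (v : Fin n → Fin n → ℝ) (hxy : x ≠ y) (hn : C.n = n) (hb : ∀ H ρ, b.Ok C H ρ)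
    (hc : ∀ H ρ, b.eval C H ρ = n) (hle : n ≤ C.bd) (ha : a < arrCount)
    (he : ∀ u w : Fin n, ∀ H', (∀ a' ≠ a, H' a' = H a') →
      e.Ok C H' (Function.update (Function.update ρ x u) y w) ∧
      e.eval C H' (Function.update (Function.update ρ x u) y w) = v u w)
    (hQ : ∀ H', (∀ a' ≠ a, H' a' = H a') → (∀ u w : Fin n, H' a u w 0 = v u w) → Q H') :
    wp C (.loop x b (.loop y b (.put a (.var x 0) (.var y 0) (.lit 0) e))) ρ Q H := by
  refine wp_fill₂ (fun s t => if h : s < n ∧ t < n then v ⟨s, h.1⟩ ⟨t, h.2⟩ else 0) (hb _ _)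
    (hc _ _) hle (fun _ _ _ _ => ⟨hb _ _, hc _ _⟩) hle ha ?_ ?_ ?_ ?_
  · intro s t s' t' _ _ _ _ h h' _
    simp [Function.update_of_ne hxy] at h h'
    exact ⟨h, h'⟩
  · intro s hs t ht
    simp [Function.update_of_ne hxy]; omega
  · intro s hs t ht H' h
    have := he ⟨s, hs⟩ ⟨t, ht⟩ H' fun a' ha' => h.array ha'
    simpa [hs, ht] using this
  · intro H' h h'
    refine hQ H' (fun a' ha' => h.array ha') fun u w => ?_
    have := h' u u.2 w w.2
    simpa [Function.update_of_ne hxy] using this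

/-- Fill the entries `a[i, 0, 0], …, a[i, n - 1, n - 1]`. -/
theorem wp_slice {i : Ix} (v : Fin n → Fin n → ℝ) (hxy : x ≠ y) (hn : C.n = n)
    (hb : ∀ H ρ, b.Ok C H ρ) (hc : ∀ H ρ, b.eval C H ρ = n) (hle : n ≤ C.bd) (ha : a < arrCount)
    {m : ℕ} (hi : ∀ s t, i.eval (Function.update (Function.update ρ x s) y t) = m) (hm : m ≤ n)
    (he : ∀ u w : Fin n, ∀ H', (∀ a' ≠ a, H' a' = H a') → (∀ m' ≠ m, H' a m' = H a m') →
      e.Ok C H' (Function.update (Function.update ρ x u) y w) ∧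
      e.eval C H' (Function.update (Function.update ρ x u) y w) = v u w)
    (hQ : ∀ H', (∀ a' ≠ a, H' a' = H a') → (∀ m' ≠ m, H' a m' = H a m') →
      (∀ u w : Fin n, H' a m u w = v u w) → Q H') :
    wp C (.loop x b (.loop y b (.put a i (.var x 0) (.var y 0) e))) ρ Q H := by
  have hother : ∀ H', Heap.AgreeOff a (fun i' j' k' => ∃ s < n, ∃ t < n,
        i' = i.eval (Function.update (Function.update ρ x s) y t) ∧
        j' = (Ix.var x 0).eval (Function.update (Function.update ρ x s) y t) ∧
        k' = (Ix.var y 0).eval (Function.update (Function.update ρ x s) y t)) H H' →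
      ∀ m' ≠ m, H' a m' = H a m' := by
    intro H' h m' hm'
    funext j k
    refine h.same ?_
    rintro ⟨s, -, t, -, h1, -⟩
    exact hm' (h1.trans (hi s t))
  refine wp_fill₂ (fun s t => if h : s < n ∧ t < n then v ⟨s, h.1⟩ ⟨t, h.2⟩ else 0) (hb _ _)
    (hc _ _) hle (fun _ _ _ _ => ⟨hb _ _, hc _ _⟩) hle ha ?_ ?_ ?_ ?_
  · intro s t s' t' _ _ _ _ _ h h'
    simp [Function.update_of_ne hxy] at h h'
    exact ⟨h, h'⟩
  · intro s hs t ht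
    rw [hi]
    simp [Function.update_of_ne hxy]; omega
  · intro s hs t ht H' h
    have := he ⟨s, hs⟩ ⟨t, ht⟩ H' (fun a' ha' => h.array ha') (hother H' h)
    simpa [hs, ht] using this
  · intro H' h h'
    refine hQ H' (fun a' ha' => h.array ha') (hother H' h) fun u w => ?_
    have := h' u u.2 w w.2
    rw [hi] at this
    simpa [Function.update_of_ne hxy] using this

/-- Fill the entries `a[i, 0], …, a[i, n]`. -/
theorem wp_rowAt {i : Ix} (v : ℕ → ℝ) (hn : C.n = n) (hb : b.Ok C H ρ)
    (hc : b.eval C H ρ = (n + 1 : ℕ)) (hle : n + 1 ≤ C.bd) (ha : a < arrCount)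
    {m : ℕ} (hi : ∀ t, i.eval (Function.update ρ x t) = m) (hm : m ≤ n)
    (he : ∀ t ≤ n, ∀ H', (∀ a' ≠ a, H' a' = H a') → (∀ m' ≠ m, H' a m' = H a m') →
      H' a m t 0 = H a m t 0 →
      e.Ok C H' (Function.update ρ x t) ∧ e.eval C H' (Function.update ρ x t) = v t)
    (hQ : ∀ H', (∀ a' ≠ a, H' a' = H a') → (∀ m' ≠ m, H' a m' = H a m') →
      (∀ t ≤ n, H' a m t 0 = v t) → Q H') :
    wp C (.loop x b (.put a i (.var x 0) (.lit 0) e)) ρ Q H := by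
  have hother : ∀ c H', Heap.AgreeOff a (fun i' j' k' => ∃ s < c,
        i' = i.eval (Function.update ρ x s) ∧ j' = (Ix.var x 0).eval (Function.update ρ x s) ∧
        k' = (Ix.lit 0).eval (Function.update ρ x s)) H H' →
      ∀ m' ≠ m, H' a m' = H a m' := by
    intro c H' h m' hm'
    funext j k
    refine h.same ?_
    rintro ⟨s, -, h1, -⟩
    exact hm' (h1.trans (hi s))
  refine wp_fill v hb hc hle ha ?_ ?_ ?_ ?_
  · intro s t _ _ _ h _
    simpa using h
  · intro t ht
    rw [hi]
    simp; omega
  · intro t ht H' h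
    refine he t (by omega) H' (fun a' ha' => h.array ha') (hother t H' h) (h.same ?_)
    rintro ⟨s, hs, -, h1, -⟩
    simp at h1
    omega
  · intro H' h h'
    refine hQ H' (fun a' ha' => h.array ha') (hother _ H' h) fun t ht => ?_
    have := h' t (by omega)
    rw [hi] at this
    simpa using this

end

theorem flag_add {p q : Prop} (h : ¬ (p ∧ q)) : flag p + flag q = flag (p ∨ q) := by
  by_cases hp : p <;> by_cases hq : q <;> simp_all [flag]

/-! ## The algorithm: distances -/

/-- The number of vertices. -/
def nE : Ex := .inp (.lit 0)

def wE : Ex := nE + .lit 1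

/-- The standing assumptions on an execution for the tree `T`. -/
structure Std (C : Ctx) {n : ℕ} (T : SimpleGraph (Fin n)) (M : ℕ) (r : Fin n) : Prop where
  tree : T.IsTree
  root : (r : ℕ) = 0
  cn : C.n = n
  imm0 : C.imm 0 = n
  bd1 : n + 1 ≤ C.bd
  bdM : (n + 1) ^ M ≤ C.bd
  Mn : M ≤ n

section
variable {C : Ctx} {n : ℕ} {T : SimpleGraph (Fin n)} {M : ℕ} {r : Fin n} {H : Heap} {ρ : Env}
  {Q : Heap → Prop}

theorem ok_nE : nE.Ok C H ρ := ⟨trivial, 0, by simp, Or.inl (by norm_num)⟩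

theorem ok_wE : wE.Ok C H ρ := ⟨ok_nE, trivial⟩

theorem Std.eval_nE (hs : Std C T M r) : nE.eval C H ρ = n := by
  simp [nE, Ex.eval, hs.imm0]

theorem Std.eval_wE (hs : Std C T M r) : wE.eval C H ρ = (n + 1 : ℕ) := by
  simp [wE, hs.eval_nE]

theorem Std.le_bd (hs : Std C T M r) : n ≤ C.bd := (Nat.le_succ n).trans hs.bd1

theorem Std.ok_sum (hs : Std C T M r) {x : ℕ} {e : Ex} :
    (Ex.sum x nE e).Ok C H ρ ↔ ∀ u : Fin n, e.Ok C H (Function.update ρ x u) := by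
  rw [Ex.ok_sum ok_nE hs.eval_nE hs.le_bd]
  exact ⟨fun h u => h u u.2, fun h i hi => h ⟨i, hi⟩⟩

theorem Std.eval_sum (hs : Std C T M r) {x : ℕ} {e : Ex} :
    (Ex.sum x nE e).eval C H ρ = ∑ u : Fin n, e.eval C H (Function.update ρ x u) := by
  rw [Ex.eval_sum hs.eval_nE, Finset.sum_range]

/-- The position of an adjacency matrix entry in the input, after the registers are freed. -/
def inputAddr (n i j : ℕ) : ℕ :=
  if regCount ≤ 3 + i * n + j then 3 + i * n + j else n * n + (regCount + (3 + i * n + j)) * n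

def entryE : Ex := .lit 3 + .var 5 * nE + .var 6

/-- The two cases of `inputAddr` are chosen by multiplying with complementary flags. -/
def adjE : Ex :=
  .inp ((Ex.lit regCount).le entryE * entryE +
    ((Ex.lit regCount).le entryE).not * (nE * nE + (.lit regCount + entryE) * nE))

/-- Copy the adjacency matrix. -/
def adjSt : St := .loop 5 nE (.loop 6 nE (.put 0 (.var 5 0) (.var 6 0) (.lit 0) adjE))

theorem wp_adjSt (hs : Std C T M r)
    (hadj : ∀ i j : Fin n, C.Readable (inputAddr n i j) ∧
      C.imm (inputAddr n i j) = flag (T.Adj i j))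
    (hQ : ∀ H', (∀ a' ≠ 0, H' a' = H a') → (∀ u w : Fin n, H' 0 u w 0 = flag (T.Adj u w)) → Q H') :
    wp C adjSt ρ Q H := by
  refine wp_table (fun u w => flag (T.Adj u w)) (by norm_num) hs.cn (fun _ _ => ok_nE)
    (fun _ _ => hs.eval_nE) hs.le_bd (by decide) ?_ hQ
  intro u w H' _
  have h1 : entryE.eval C H' (Function.update (Function.update ρ 5 u) 6 w) =
      (3 + u * n + w : ℕ) := by
    simp [entryE, hs.eval_nE]
  have h2 : ((Ex.lit regCount).le entryE * entryE +
      ((Ex.lit regCount).le entryE).not * (nE * nE + (.lit regCount + entryE) * nE)).eval C H'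
        (Function.update (Function.update ρ 5 u) 6 w) = (inputAddr n u w : ℕ) := by
    simp only [Ex.eval_add, Ex.eval_mul, Ex.eval_le, Ex.eval_not, h1, hs.eval_nE, Ex.eval_lit,
      inputAddr, Rat.cast_natCast, Nat.cast_le]
    by_cases h : regCount ≤ 3 + u * n + w
    · simp [flag, h]
    · simp [flag, h]
  refine ⟨⟨?_, _, h2, (hadj u w).1⟩, ?_⟩
  · simp [entryE, ok_nE]
  · rw [adjE, Ex.eval, h2, Nat.floor_natCast, (hadj u w).2]

/-- Compute which pairs have distance at most `m`, for `m = 0, …, n`. -/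
def reachSt : St :=
  .seq (.loop 5 nE (.loop 6 nE (.put 1 (.lit 0) (.var 5 0) (.var 6 0) ((Ex.var 5).eq (.var 6)))))
    (.loop 0 nE (.loop 5 nE (.loop 6 nE (.put 1 (.var 0 1) (.var 5 0) (.var 6 0)
      ((Ex.lit 1).le (.sum 7 nE (.get 1 (.var 0 0) (.var 5 0) (.var 7 0) *
        ((Ex.var 7).eq (.var 6) + .get 0 (.var 7 0) (.var 6 0) (.lit 0)))))))))

/-- Split off the last edge of a geodesic. -/
theorem dist_le_succ_iff (hT : T.IsTree) (u w : Fin n) (m : ℕ) :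
    T.dist u w ≤ m + 1 ↔ ∃ q, T.dist u q ≤ m ∧ (q = w ∨ T.Adj q w) := by
  constructor
  · intro h
    by_cases huw : w = u
    · exact ⟨u, by simp, Or.inl huw.symm⟩
    · obtain ⟨q, hq, hb⟩ := hT.1.exists_adj_btw huw
      have h1 : T.dist w q + T.dist q u = T.dist w u := hb
      have h2 := SimpleGraph.dist_eq_one_iff_adj.2 hq
      rw [T.dist_comm (u := w) (v := u), T.dist_comm (u := q)] at h1
      exact ⟨q, by omega, Or.inr hq.symm⟩
  · rintro ⟨q, hq, rfl | hqw⟩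
    · omega
    · have h1 := hT.1.dist_triangle (u := u) (v := q) (w := w)
      have h2 := SimpleGraph.dist_eq_one_iff_adj.2 hqw
      omega

theorem wp_reachSt (hs : Std C T M r) (hadj : ∀ u w : Fin n, H 0 u w 0 = flag (T.Adj u w))
    (hQ : ∀ H', (∀ a' ≠ 1, H' a' = H a') →
      (∀ m ≤ n, ∀ u w : Fin n, H' 1 m u w = flag (T.dist u w ≤ m)) → Q H') :
    wp C reachSt ρ Q H := by
  have hcn := hs.cn
  refine wp_slice (fun u w => flag (T.dist u w ≤ 0)) (by norm_num) hs.cn (fun _ _ => ok_nE)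
    (fun _ _ => hs.eval_nE) hs.le_bd (by decide) (m := 0) (by simp) (by omega) ?_ ?_
  · intro u w H' _ _
    refine ⟨by simp, ?_⟩
    simp only [Ex.eval_eq, Ex.eval_var]
    refine flag_congr ?_
    simp [hs.tree.1.dist_eq_zero_iff, Fin.ext_iff]
  intro H1 hH1 _ h0
  refine ⟨ok_nE, n, hs.eval_nE, hs.le_bd, fun m H' => (∀ a' ≠ 1, H' a' = H a') ∧
      ∀ l ≤ m, ∀ u w : Fin n, H' 1 l u w = flag (T.dist u w ≤ l), ⟨hH1, fun l hl => ?_⟩, ?_,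
    fun H' h => hQ H' h.1 h.2⟩
  · obtain rfl : l = 0 := by omega
    exact h0
  rintro m hm H2 ⟨h1, h2⟩
  refine wp_slice (fun u w => flag (T.dist u w ≤ m + 1)) (by norm_num) hs.cn (fun _ _ => ok_nE)
    (fun _ _ => hs.eval_nE) hs.le_bd (by decide) (m := m + 1) (by simp) (by omega) ?_ ?_
  · intro u w H' h3 h4
    constructor
    · simp only [Ex.ok_le, Ex.ok_lit, true_and, hs.ok_sum]
      intro q
      simp [arrCount]
      omega
    · simp only [Ex.eval_le, hs.eval_sum]
      have h5 : ∀ q : Fin n, H' 1 m u q = flag (T.dist u q ≤ m) := fun q => by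
        rw [h4 m (by omega), h2 m le_rfl]
      have h6 : ∀ q : Fin n, H' 0 q w 0 = flag (T.Adj q w) := fun q => by
        rw [h3 0 (by norm_num), h1 0 (by norm_num), hadj]
      have h7 : ∀ q : Fin n, flag ((q : ℕ) = (w : ℕ)) + flag (T.Adj q w) =
          flag (q = w ∨ T.Adj q w) := fun q => by
        rw [← Fin.ext_iff, flag_add]
        rintro ⟨rfl, h⟩
        exact h.ne rfl
      simp [h5, h6, h7, flag_mul, one_le_sum_flag,
        dist_le_succ_iff hs.tree]
  · intro H' h3 h4 h5
    refine ⟨fun a' ha' => (h3 a' ha').trans (h1 a' ha'), fun l hl => ?_⟩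
    rcases Nat.le_succ_iff_eq_or_le.1 hl with rfl | hl
    · simpa using h5
    · rw [h4 l (by omega)]
      exact h2 l hl

/-- Compute the distances. -/
def distSt : St := .loop 5 nE (.loop 6 nE (.put 2 (.var 5 0) (.var 6 0) (.lit 0)
  (.sum 0 nE (Ex.get 1 (.var 0 0) (.var 5 0) (.var 6 0)).not)))

/-- A distance is less than `n`, so it equals the number of `q < n` for which it is not at most `q`.
-/
theorem wp_distSt (hs : Std C T M r)
    (hreach : ∀ m ≤ n, ∀ u w : Fin n, H 1 m u w = flag (T.dist u w ≤ m))
    (hQ : ∀ H', (∀ a' ≠ 2, H' a' = H a') → (∀ u w : Fin n, H' 2 u w 0 = (T.dist u w : ℝ)) → Q H') :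
    wp C distSt ρ Q H := by
  have hcn := hs.cn
  refine wp_table (fun u w => (T.dist u w : ℝ)) (by norm_num) hs.cn (fun _ _ => ok_nE)
    (fun _ _ => hs.eval_nE) hs.le_bd (by decide) ?_ hQ
  intro u w H' h1
  constructor
  · rw [hs.ok_sum]
    intro q
    simp [arrCount]
    omega
  · rw [hs.eval_sum]
    have h2 : ∀ q : Fin n, H' 1 q u w = flag (T.dist u w ≤ q) := fun q => by
      rw [h1 1 (by norm_num), hreach _ q.2.le]
    have h3 : T.dist u w < n := by
      have := hs.tree.1.dist_lt_card_btw u w (B := Finset.univ) (by simp)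
      simpa using this
    simp [h2, one_sub_flag]
    rw [← Finset.sum_range (fun q => flag (q < T.dist u w)), sum_flag]
    congr 1
    refine (congrArg Finset.card (?_ : _ = Finset.range (T.dist u w))).trans (Finset.card_range _)
    ext q
    simp only [Finset.mem_filter, Finset.mem_range]
    omega

/-! ## The algorithm: parameters -/

/-- The size up to which all sets are tried. -/
def cutoff (n : ℕ) : ℕ := ((Finset.range n).filter fun i => i ^ 4 < 3200 * n ^ 3).card

/-- Compute the parameter `M` and the number of tuples. -/
def paramSt : St :=
  .seq (.put 4 (.lit 0) (.lit 0) (.lit 0) (.sum 5 nE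
      ((.var 5 * .var 5 * .var 5 * .var 5 + .lit 1 : Ex).le (.lit 3200 * nE * nE * nE))))
    (.put 5 (.lit 0) (.lit 0) (.lit 0) (.prod 5 (.get 4 (.lit 0) (.lit 0) (.lit 0)) wE))

theorem wp_paramSt (hs : Std C T (cutoff n) r)
    (hQ : ∀ H', (∀ a' ≠ 4, a' ≠ 5 → H' a' = H a') → H' 4 0 0 0 = (cutoff n : ℝ) →
      H' 5 0 0 0 = (((n + 1) ^ cutoff n : ℕ) : ℝ) → Q H') :
    wp C paramSt ρ Q H := by
  have h1 : (Ex.sum 5 nE ((.var 5 * .var 5 * .var 5 * .var 5 + .lit 1 : Ex).le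
      (.lit 3200 * nE * nE * nE))).eval C H ρ = cutoff n := by
    rw [Ex.eval_sum hs.eval_nE]
    simp only [Ex.eval_le, Ex.eval_add, Ex.eval_mul, Ex.eval_var, Ex.eval_lit, hs.eval_nE,
      Function.update_self]
    rw [sum_flag, cutoff]
    congr 2
    refine Finset.filter_congr fun i _ => ?_
    rw [← Nat.add_one_le_iff]
    push_cast
    rw [show ((i : ℝ) * i * i * i + 1 ≤ 3200 * n * n * n) ↔
      ((i ^ 4 + 1 : ℕ) : ℝ) ≤ (3200 * n ^ 3 : ℕ) by push_cast; ring_nf]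
    exact Nat.cast_le
  refine ⟨?_, by decide, by simp, by simp, by simp, ?_, by decide, by simp, by simp, by simp, ?_⟩
  · rw [hs.ok_sum]
    simp [ok_nE]
  · refine ⟨by simp [arrCount], trivial, cutoff n, ?_, ?_, fun _ _ => ok_wE⟩
    · simp only [Ex.eval_get, Ix.eval_lit, Heap.set]
      simpa using h1
    · exact hs.Mn.trans hs.le_bd
  · have h2 : (Ex.prod 5 (.get 4 (.lit 0) (.lit 0) (.lit 0)) wE).eval C
        (H.set 4 0 0 0 (cutoff n)) ρ = ((n + 1) ^ cutoff n : ℕ) := by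
      rw [Ex.eval_prod (c := cutoff n) (by simp [Heap.set])]
      simp [hs.eval_wE]
    simp only [Ix.eval_lit, h1, h2]
    refine hQ _ (fun a' h4 h5 => ?_) (by simp [Heap.set]) (by simp [Heap.set])
    funext i j k
    simp [Heap.set, h4, h5]

/-- A number that is too large. -/
def infE : Ex := .lit 4 * (.inp (.lit 2) * .inp (.lit 2)) + .lit 1

/-- With `τ` in place of `C.imm 2` this is nonnegative and exceeds `2 τ` for every real `τ`. Entries
of at least this size are never accepted, so the tables need not be accurate there. -/
noncomputable def infVal (C : Ctx) : ℝ := 4 * (C.imm 2 * C.imm 2) + 1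

theorem infVal_nonneg : 0 ≤ infVal C := by
  unfold infVal; nlinarith [mul_self_nonneg (C.imm 2)]

theorem ok_infE : infE.Ok C H ρ := by
  have : (Ex.inp (.lit 2)).Ok C H ρ := ⟨trivial, 2, by simp, Or.inl (by norm_num)⟩
  simp [infE, this]

theorem eval_infE : infE.eval C H ρ = infVal C := by
  have : (Ex.inp (.lit 2)).eval C H ρ = C.imm 2 := by
    simp only [Ex.eval]
    congr 1
    simp
  simp [infE, infVal, this]

/-- Initialize the table of the optimal values. -/
def initSt : St := .loop 1 nE (.loop 8 wE (.put 6 (.var 1 0) (.var 8 0) (.lit 0) infE))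

theorem wp_initSt (hs : Std C T M r)
    (hQ : ∀ H', (∀ a' ≠ 6, H' a' = H a') →
      (∀ u : Fin n, ∀ j ≤ n, H' 6 u j 0 = infVal C) → Q H') :
    wp C initSt ρ Q H := by
  have hcn := hs.cn
  refine wp_fill₂ (fun _ _ => infVal C) ok_nE hs.eval_nE hs.le_bd
    (fun _ _ _ _ => ⟨ok_wE, hs.eval_wE⟩) hs.bd1 (by decide) ?_ ?_ ?_ ?_
  · intro s t s' t' _ _ _ _ h h' _
    simp at h h'
    exact ⟨h, h'⟩
  · intro s hs t ht
    simp; omega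
  · exact fun _ _ _ _ _ _ => ⟨ok_infE, eval_infE⟩
  · intro H' h h'
    refine hQ H' (fun a' ha' => h.array ha') fun u j hj => ?_
    have := h' u u.2 j (by omega)
    simpa [Function.update_apply] using this

end

/-! ### Min-plus combination of rows, with values truncated at a large number -/

open SimpleGraph

/-! ## Combining optimal values -/

/-- The minimum of `f a + g b` over all `a, b ≤ n` with `a + b = j`; it is at most `z`. -/
noncomputable def minConv (z : ℝ) (n : ℕ) (f g : ℕ → ℝ) (j : ℕ) : ℝ :=
  iter .min z (fun a => iter .min z (fun b => f a + g b + flag (¬ a + b = j) * z) (n + 1)) (n + 1)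

theorem minConv_le {z : ℝ} {n : ℕ} {f g : ℕ → ℝ} {a b : ℕ} (ha : a ≤ n) (hb : b ≤ n) :
    minConv z n f g (a + b) ≤ f a + g b := by
  refine ((iter_min_le z _ (n + 1)).2 a (by omega)).trans
    (((iter_min_le z _ (n + 1)).2 b (by omega)).trans (le_of_eq ?_))
  rw [flag_false (by simp)]
  ring

theorem minConv_eq (z : ℝ) (n : ℕ) (f g : ℕ → ℝ) (j : ℕ) : minConv z n f g j = z ∨
    ∃ a ≤ n, ∃ b ≤ n, minConv z n f g j = f a + g b + flag (¬ a + b = j) * z := by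
  unfold minConv
  rcases iter_min_eq z (fun a => iter .min z (fun b => f a + g b + flag (¬ a + b = j) * z) (n + 1))
    (n + 1) with h | ⟨a, ha, h⟩
  · exact Or.inl h
  · rcases iter_min_eq z (fun b => f a + g b + flag (¬ a + b = j) * z) (n + 1) with h' | ⟨b, hb, h'⟩
    · exact Or.inl (h.trans h')
    · exact Or.inr ⟨a, by omega, b, by omega, h.trans h'⟩

section
variable {n : ℕ} {T : SimpleGraph (Fin n)} {r : Fin n}

/-- Every entry below `z` is attained by a deletion in the subtree of `v`. -/
def SoundRow (T : SimpleGraph (Fin n)) (r v : Fin n) (z : ℝ) (f : ℕ → ℝ) : Prop :=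
  ∀ j ≤ n, 0 ≤ f j ∧ (z ≤ f j ∨ ∃ S : Finset (Fin n),
    (T.subtree r v ∩ S).card = j ∧ f j = T.pairSum (T.subtree r v) S)

/-- The deletion `S` is taken into account in the subtree of `v`. -/
def CompleteRow (T : SimpleGraph (Fin n)) (r v : Fin n) (S : Finset (Fin n)) (f : ℕ → ℝ) : Prop :=
  f (T.subtree r v ∩ S).card ≤ T.pairSum (T.subtree r v) S

theorem fullPairSum_nonneg {V : Type*} (T : SimpleGraph V) (A : Finset V) :
    0 ≤ T.fullPairSum A :=
  Finset.sum_nonneg fun u _ => Finset.sum_nonneg fun w _ => by positivity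

theorem filter_lt_succ_of_mem {A : Finset (Fin n)} {c : Fin n} (hc : c ∈ A) :
    (A.filter fun x : Fin n => (x : ℕ) < (c : ℕ) + 1) =
      insert c (A.filter fun x : Fin n => (x : ℕ) < (c : ℕ)) := by
  ext x
  simp only [Finset.mem_filter, Finset.mem_insert, Fin.ext_iff]
  constructor
  · rintro ⟨h1, h2⟩
    by_cases h : (x : ℕ) = c
    · exact Or.inl h
    · exact Or.inr ⟨h1, by omega⟩
  · rintro (h | ⟨h1, h2⟩)
    · rw [← Fin.ext_iff] at h
      subst h
      exact ⟨hc, by omega⟩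
    · exact ⟨h1, by omega⟩

theorem filter_lt_succ_of_not_mem {A : Finset (Fin n)} {c : Fin n} (hc : c ∉ A) :
    (A.filter fun x : Fin n => (x : ℕ) < (c : ℕ) + 1) =
      A.filter fun x : Fin n => (x : ℕ) < (c : ℕ) := by
  ext x
  simp only [Finset.mem_filter]
  refine and_congr_right fun h1 => ⟨fun h2 => ?_, fun h2 => by omega⟩
  have : x ≠ c := by rintro rfl; exact hc h1
  rw [Ne, Fin.ext_iff] at this
  omega

open Classical in
/-- The values `h m` combine the crown of `X` with the rows `f c` for the tops `c < m`. -/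
structure Combines (T : SimpleGraph (Fin n)) (r v : Fin n) (X : Set (Fin n)) (z : ℝ)
    (f : Fin n → ℕ → ℝ) (h : ℕ → ℕ → ℝ) : Prop where
  zero : ∀ j ≤ n, h 0 j =
    if j = (T.border r v (T.crown r v X)).card then T.fullPairSum (T.crown r v X) else z
  succ : ∀ c : Fin n, ∀ j ≤ n, h (c + 1) j =
    if c ∈ T.tops r v (T.crown r v X) then minConv z n (h c) (f c) j else h c j

/-- By induction on `m`, each entry below `z` is attained by a choice of one deletion per top `c <
m`, with matching total number. Entries with a summand of size `z`, or with the penalty for `a + b ≠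
j`, are at least `z` by nonnegativity. In the end the chosen deletions are glued by `exists_glue`.
-/
theorem Combines.soundRow {v : Fin n} {X : Set (Fin n)} {z : ℝ} {f : Fin n → ℕ → ℝ}
    {h : ℕ → ℕ → ℝ} (hc : Combines T r v X z f h) (hT : T.IsTree) (hz : 0 ≤ z)
    (hf : ∀ c, SoundRow T r c z (f c)) : SoundRow T r v z (h n) := by
  classical
  set A := T.tops r v (T.crown r v X) with hA
  have key : ∀ m ≤ n, ∀ j ≤ n, 0 ≤ h m j ∧ (z ≤ h m j ∨ ∃ F : Fin n → Finset (Fin n),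
      (T.border r v (T.crown r v X)).card +
        ∑ c ∈ A.filter (fun x : Fin n => (x : ℕ) < m), (T.subtree r c ∩ F c).card = j ∧
      h m j = T.fullPairSum (T.crown r v X) +
        ∑ c ∈ A.filter (fun x : Fin n => (x : ℕ) < m), T.pairSum (T.subtree r c) (F c : Finset _))
      := by
    intro m
    induction m with
    | zero =>
      intro _ j hj
      rw [hc.zero j hj]
      split_ifs with h1
      · refine ⟨fullPairSum_nonneg _ _, Or.inr ⟨fun _ => ∅, ?_, ?_⟩⟩
        · simp [h1]
        · simp
      · exact ⟨hz, Or.inl le_rfl⟩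
    | succ m ih =>
      intro hm j hj
      have hs := hc.succ ⟨m, hm⟩ j hj
      simp only at hs
      rw [hs]
      split_ifs with h1
      · have hins := filter_lt_succ_of_mem (A := A) (c := ⟨m, hm⟩) h1
        simp only at hins
        rcases minConv_eq z n (h m) (f ⟨m, hm⟩) j with h2 | ⟨a, ha, b, hb, h2⟩
        · rw [h2]
          exact ⟨hz, Or.inl le_rfl⟩
        · obtain ⟨h3, h4⟩ := ih (by omega) a ha
          obtain ⟨h5, h6⟩ := hf ⟨m, hm⟩ b hb
          rw [h2]
          have h7 := mul_nonneg (flag_nonneg (¬ a + b = j)) hz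
          refine ⟨by positivity, ?_⟩
          by_cases hab : a + b = j
          · rw [flag_false (by simpa using hab), zero_mul, add_zero]
            rcases h4 with h4 | ⟨F, h4, h4'⟩
            · left; linarith
            rcases h6 with h6 | ⟨S, h6, h6'⟩
            · left; linarith
            right
            have hne : ∀ c ∈ A.filter (fun x : Fin n => (x : ℕ) < m), c ≠ ⟨m, hm⟩ := by
              intro c hc
              have := (Finset.mem_filter.1 hc).2
              rintro rfl
              simp at this
            refine ⟨Function.update F ⟨m, hm⟩ S, ?_, ?_⟩
            · rw [hins, Finset.sum_insert (by simp), Function.update_self, h6,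
                Finset.sum_congr rfl fun c hc => by
                rw [Function.update_of_ne (hne c hc)]]
              omega
            · rw [hins, Finset.sum_insert (by simp), Function.update_self, ← h6',
                Finset.sum_congr rfl fun c hc => by
                rw [Function.update_of_ne (hne c hc)]]
              linarith
          · left
            rw [flag_true (by simpa using hab)]
            linarith
      · rw [filter_lt_succ_of_not_mem (A := A) (c := ⟨m, hm⟩) h1]
        exact ih (by omega) j hj
  intro j hj
  obtain ⟨h1, h2⟩ := key n le_rfl j hj
  refine ⟨h1, h2.imp id ?_⟩
  rintro ⟨F, h3, h4⟩
  rw [Finset.filter_true_of_mem fun x _ => x.2] at h3 h4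
  obtain ⟨S, h5, h6⟩ := hT.exists_glue r v X F
  exact ⟨S, by rw [h5]; convert h3, by rw [h6, h4]⟩

/-- Follow `S` itself through the convolutions: after the tops below `m`, the entry at the number of
vertices that `S` has on the border and under these tops is at most the corresponding partial
objective. -/
theorem Combines.completeRow {v : Fin n} {X : Set (Fin n)} {z : ℝ} {f : Fin n → ℕ → ℝ}
    {h : ℕ → ℕ → ℝ} (hc : Combines T r v X z f h) (hT : T.IsTree) {S : Finset (Fin n)}
    (hX : T.crown r v X = T.crown r v S)
    (hf : ∀ c ∈ T.tops r v (T.crown r v X), CompleteRow T r c S (f c)) :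
    CompleteRow T r v S (h n) := by
  classical
  set A := T.tops r v (T.crown r v X) with hA
  have hK : ∀ u ∈ T.crown r v X, u ∉ S := fun u hu => by
    rw [hX] at hu
    exact not_mem_of_mem_crown hu
  have hD : ∀ u ∈ T.border r v (T.crown r v X), u ∈ S := fun u hu => by
    rw [hX] at hu
    exact mem_of_mem_border_crown hu
  have hcard := hT.card_inter_subtree r v (X := X) hK hD
  have hsum := hT.pairSum_subtree r v (X := X) (S := (S : Set _)) hK hD
  have hle : (T.subtree r v ∩ S).card ≤ n := (Finset.card_le_univ _).trans (by simp)
  have key : ∀ m ≤ n, h m ((T.border r v (T.crown r v X)).card +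
        ∑ c ∈ A.filter (fun x : Fin n => (x : ℕ) < m), (T.subtree r c ∩ S).card) ≤
      T.fullPairSum (T.crown r v X) +
        ∑ c ∈ A.filter (fun x : Fin n => (x : ℕ) < m), T.pairSum (T.subtree r c) S := by
    intro m
    induction m with
    | zero =>
      intro _
      have : (T.border r v (T.crown r v X)).card ≤ n := (Finset.card_le_univ _).trans (by simp)
      simp [hc.zero _ this]
    | succ m ih =>
      intro hm
      have hidx : (T.border r v (T.crown r v X)).card +
          ∑ c ∈ A.filter (fun x : Fin n => (x : ℕ) < m + 1), (T.subtree r c ∩ S).card ≤ n := by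
        refine le_trans ?_ hle
        rw [hcard]
        exact Nat.add_le_add_left
          (Finset.sum_le_sum_of_subset (Finset.filter_subset _ _)) _
      have hs := hc.succ ⟨m, hm⟩ _ hidx
      simp only at hs
      rw [hs]
      split_ifs with h1
      · rw [filter_lt_succ_of_mem (A := A) (c := ⟨m, hm⟩) h1] at hidx ⊢
        rw [Finset.sum_insert (by simp)] at hidx ⊢
        rw [Finset.sum_insert (by simp)]
        have h2 := hf ⟨m, hm⟩ h1
        have h3 := ih (by omega)
        rw [show ∀ a b c : ℕ, a + (b + c) = a + c + b by intros; omega]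
        refine (minConv_le (by omega) (by omega)).trans ?_
        unfold CompleteRow at h2
        linarith
      · rw [filter_lt_succ_of_not_mem (A := A) (c := ⟨m, hm⟩) h1]
        exact ih (by omega)
  have := key n le_rfl
  rw [Finset.filter_true_of_mem fun x _ => x.2] at this
  unfold CompleteRow
  rw [hsum]
  convert this using 2

end

/-! ## The algorithm: one crown -/

/-- The digits of `x` in base `n + 1`. -/
def digit (n x p : ℕ) : ℕ := x / (n + 1) ^ p % (n + 1)

/-- The set that is encoded by the number `x` and the bit `b`. -/
def probe (n M x b : ℕ) : Set (Fin n) := {u | (b : ℝ) = flag (∃ p < M, digit n x p = u)}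

/-- The tables that do not change any more. -/
structure Static {n : ℕ} (T : SimpleGraph (Fin n)) (M : ℕ) (H : Heap) : Prop where
  adj : ∀ u w : Fin n, H 0 u w 0 = flag (T.Adj u w)
  dist : ∀ u w : Fin n, H 2 u w 0 = (T.dist u w : ℝ)
  size : H 4 0 0 0 = (M : ℝ)
  count : H 5 0 0 0 = (((n + 1) ^ M : ℕ) : ℝ)

def btwE (i j k : Ix) : Ex := (Ex.get 2 i j (.lit 0) + .get 2 j k (.lit 0)).eq (.get 2 i k (.lit 0))

/-- The number of multiples of `e` that are at most the code. -/
def quotE (e : Ex) : Ex := .sum 11 (.get 5 (.lit 0) (.lit 0) (.lit 0))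
  (((.var 11 + .lit 1) * e).le (.var 2))

/-- The digit is `⌊x / w^p⌋ - w ⌊x / w^(p+1)⌋` with `w = n + 1`, where both quotients are obtained
by counting multiples. -/
def digitE : Ex := quotE (.prod 12 (.var 4) wE) - wE * quotE (.prod 12 (.var 4 + .lit 1) wE)

def digitSt : St := .loop 4 (.get 4 (.lit 0) (.lit 0) (.lit 0))
  (.put 7 (.var 4 0) (.lit 0) (.lit 0) digitE)

def probeSt : St := .loop 5 nE (.put 8 (.var 5 0) (.lit 0) (.lit 0)
  ((Ex.var 3).eq ((Ex.lit 1).le (.sum 4 (.get 4 (.lit 0) (.lit 0) (.lit 0))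
    ((Ex.get 7 (.var 4 0) (.lit 0) (.lit 0)).eq (.var 5))))))

/-- The literal index `0` is the root. That no probed vertex lies in between is tested by a sum of
flags being at most `0`. -/
def crownSt : St := .loop 5 nE (.put 9 (.var 5 0) (.lit 0) (.lit 0)
  (btwE (.lit 0) (.var 1 0) (.var 5 0) *
    (Ex.sum 6 nE (btwE (.var 1 0) (.var 6 0) (.var 5 0) *
      .get 8 (.var 6 0) (.lit 0) (.lit 0))).le (.lit 0)))

def borderSt : St := .loop 5 nE (.put 10 (.var 5 0) (.lit 0) (.lit 0)
  (btwE (.lit 0) (.var 1 0) (.var 5 0) * (Ex.get 9 (.var 5 0) (.lit 0) (.lit 0)).not *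
    (Ex.sum 6 nE (btwE (.var 1 0) (.var 6 0) (.var 5 0) * ((Ex.var 6).eq (.var 5)).not *
      (Ex.get 9 (.var 6 0) (.lit 0) (.lit 0)).not)).le (.lit 0)))

def topSt : St := .loop 7 nE (.put 11 (.var 7 0) (.lit 0) (.lit 0)
  ((Ex.lit 1).le (.sum 5 nE (.get 10 (.var 5 0) (.lit 0) (.lit 0) *
    .get 0 (.var 5 0) (.var 7 0) (.lit 0) *
    (Ex.get 2 (.lit 0) (.var 5 0) (.lit 0) + .lit 1).eq
      (.get 2 (.lit 0) (.var 7 0) (.lit 0))))))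

def borderCardE : Ex := .sum 5 nE (.get 10 (.var 5 0) (.lit 0) (.lit 0))

def crownSumE : Ex := .sum 5 nE (.sum 6 nE (.get 9 (.var 5 0) (.lit 0) (.lit 0) *
  .get 9 (.var 6 0) (.lit 0) (.lit 0) * .inv (.get 2 (.var 5 0) (.var 6 0) (.lit 0))))

def crownValueSt : St := .loop 8 wE (.put 12 (.lit 0) (.var 8 0) (.lit 0)
  ((Ex.var 8).eq borderCardE * crownSumE + ((Ex.var 8).eq borderCardE).not * infE))

def minConvE : Ex := .fold .min 9 wE infE (.fold .min 10 wE infE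
  (.get 12 (.var 7 0) (.var 9 0) (.lit 0) + .get 6 (.var 7 0) (.var 10 0) (.lit 0) +
    ((Ex.var 9 + .var 10).eq (.var 8)).not * infE))

def combineSt : St := .loop 7 nE (.loop 8 wE (.put 12 (.var 7 1) (.var 8 0) (.lit 0)
  (.get 11 (.var 7 0) (.lit 0) (.lit 0) * minConvE +
    (Ex.get 11 (.var 7 0) (.lit 0) (.lit 0)).not * .get 12 (.var 7 0) (.var 8 0) (.lit 0))))

/-- An array index cannot be the number `n`, only a constant or a loop variable plus a constant. The
sum over variable `7` with the flag for equality to `n` therefore picks the last row of array `12`,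
which combines all tops. -/
def updateSt : St := .loop 8 wE (.put 6 (.var 1 0) (.var 8 0) (.lit 0)
  ((Ex.get 6 (.var 1 0) (.var 8 0) (.lit 0)).min
    (.sum 7 wE ((Ex.var 7).eq nE * .get 12 (.var 7 0) (.var 8 0) (.lit 0)))))

section
variable {C : Ctx} {n : ℕ} {T : SimpleGraph (Fin n)} {M : ℕ} {r : Fin n} {H : Heap} {ρ : Env}
  {Q : Heap → Prop}

theorem Static.congr {H' : Heap} (h : Static T M H)
    (hH : ∀ a ∈ ({0, 2, 4, 5} : Finset ℕ), H' a = H a) : Static T M H' := by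
  obtain ⟨h1, h2, h3, h4⟩ := h
  exact ⟨by rwa [hH 0 (by decide)], by rwa [hH 2 (by decide)], by rwa [hH 4 (by decide)],
    by rwa [hH 5 (by decide)]⟩

theorem Static.congr_array {H' : Heap} {a : ℕ} (h : Static T M H)
    (hH : ∀ a' ≠ a, H' a' = H a') (ha : a ∉ ({0, 2, 4, 5} : Finset ℕ)) : Static T M H' :=
  h.congr fun a' ha' => hH a' (by rintro rfl; exact ha ha')

theorem Static.dist_root (h : Static T M H) (hs : Std C T M r) (u : Fin n) :
    H 2 0 u 0 = (T.dist r u : ℝ) := by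
  rw [← h.dist, hs.root]

theorem Std.ok_btwE (hs : Std C T M r) {i j k : Ix} {u v w : Fin n} (hi : i.eval ρ = u)
    (hj : j.eval ρ = v) (hk : k.eval ρ = w) : (btwE i j k).Ok C H ρ := by
  have := hs.cn
  simp [btwE, arrCount, hi, hj, hk]
  omega

theorem Static.eval_btwE (h : Static T M H) {i j k : Ix} {u v w : Fin n} (hi : i.eval ρ = u)
    (hj : j.eval ρ = v) (hk : k.eval ρ = w) :
    (btwE i j k).eval C H ρ = flag (T.Btw u v w) := by
  simp only [btwE, Ex.eval_eq, Ex.eval_add, Ex.eval_get, hi, hj, hk, Ix.eval_lit, h.dist]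
  exact flag_congr (by unfold SimpleGraph.Btw; exact_mod_cast Iff.rfl)

theorem wp_digitSt (hs : Std C T M r) (h : Static T M H) {x : ℕ} (hx : ρ 2 = x)
    (hxB : x < (n + 1) ^ M)
    (hQ : ∀ H', (∀ a' ≠ 7, H' a' = H a') → (∀ p < M, H' 7 p 0 0 = (digit n x p : ℝ)) → Q H') :
    wp C digitSt ρ Q H := by
  have hcn := hs.cn
  have hMn := hs.Mn
  have hMb := hMn.trans hs.le_bd
  refine wp_fill (fun p => (digit n x p : ℝ)) (c := M) (by simp [arrCount]) h.size
    hMb (by decide) (fun s t _ _ hst _ _ => by simpa using hst) ?_ ?_ ?_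
  · intro t ht; simp; omega
  · intro p hp H' hH
    have h5 : H' 5 0 0 0 = (((n + 1) ^ M : ℕ) : ℝ) := by
      rw [hH.array (by norm_num)]; exact h.count
    have hquot : ∀ (e : Ex) (d : ℕ), 0 < d →
        (∀ q : ℕ, e.eval C H' (Function.update (Function.update ρ 4 p) 11 q) = d) →
        (quotE e).eval C H' (Function.update ρ 4 p) = ((x / d : ℕ) : ℝ) := by
      intro e d hd he
      have h5' : (Ex.get 5 (.lit 0) (.lit 0) (.lit 0)).eval C H' (Function.update ρ 4 p) =
        (((n + 1) ^ M : ℕ) : ℝ) := h5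
      rw [quotE, Ex.eval_sum h5', ← natCast_div_eq_sum_flag hd hxB]
      refine Finset.sum_congr rfl fun q _ => ?_
      simp [he, hx]
    have hokq : ∀ (e : Ex),
        (∀ q : ℕ, e.Ok C H' (Function.update (Function.update ρ 4 p) 11 q)) →
        (quotE e).Ok C H' (Function.update ρ 4 p) := by
      intro e he
      have h5' : (Ex.get 5 (.lit 0) (.lit 0) (.lit 0)).eval C H' (Function.update ρ 4 p) =
        (((n + 1) ^ M : ℕ) : ℝ) := h5
      rw [quotE, Ex.ok_sum (by simp [arrCount]) h5' hs.bdM]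
      intro q _
      simp [he]
    have h1 : ∀ q : ℕ, (Ex.prod 12 (.var 4) wE).eval C H'
        (Function.update (Function.update ρ 4 p) 11 q) = (((n + 1) ^ p : ℕ) : ℝ) := by
      intro q
      rw [Ex.eval_prod (c := p) (by simp)]
      simp [hs.eval_wE]
    have h2 : ∀ q : ℕ, (Ex.prod 12 (.var 4 + .lit 1) wE).eval C H'
        (Function.update (Function.update ρ 4 p) 11 q) = (((n + 1) ^ (p + 1) : ℕ) : ℝ) := by
      intro q
      rw [Ex.eval_prod (c := p + 1) (by simp)]
      simp [hs.eval_wE]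
    constructor
    · rw [digitE, Ex.ok_sub, Ex.ok_mul]
      refine ⟨hokq _ fun q => ?_, ok_wE, hokq _ fun q => ?_⟩
      · exact (Ex.ok_fold (c := p) (by simp) (by simp) (by omega)).2 ⟨trivial, fun _ _ => ok_wE⟩
      · exact (Ex.ok_fold (c := p + 1) (by simp) (by simp) (by omega)).2
          ⟨trivial, fun _ _ => ok_wE⟩
    · rw [digitE, Ex.eval_sub, Ex.eval_mul, hquot _ _ (by positivity) h1,
        hquot _ _ (by positivity) h2, hs.eval_wE, pow_succ, ← Nat.div_div_eq_div_mul, digit,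
        sub_eq_iff_eq_add]
      exact_mod_cast (Nat.mod_add_div _ _).symm
  · intro H' hH hp
    exact hQ H' (fun a' ha' => hH.array ha') fun p hpM => by simpa using hp p hpM

theorem wp_probeSt (hs : Std C T M r) (h : Static T M H) {x b : ℕ} (hb : ρ 3 = b)
    (h7 : ∀ p < M, H 7 p 0 0 = (digit n x p : ℝ))
    (hQ : ∀ H', (∀ a' ≠ 8, H' a' = H a') →
      (∀ u : Fin n, H' 8 u 0 0 = flag (u ∈ probe n M x b)) → Q H') :
    wp C probeSt ρ Q H := by
  have hcn := hs.cn
  have hMn := hs.Mn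
  refine wp_row _ hs.cn ok_nE hs.eval_nE hs.le_bd (by decide) ?_ hQ
  intro u H' hH
  have h4 : ∀ ρ', (Ex.get 4 (.lit 0) (.lit 0) (.lit 0)).eval C H' ρ' = M := fun _ => by
    rw [Ex.eval_get, hH 4 (by norm_num)]; exact h.size
  constructor
  · simp only [Ex.ok_eq, Ex.ok_var, Ex.ok_le, Ex.ok_lit, true_and]
    rw [Ex.ok_sum (by simp [arrCount]) (h4 _) (hMn.trans hs.le_bd)]
    intro p hp
    simp [arrCount]; omega
  · simp only [Ex.eval_eq, Ex.eval_var, Ex.eval_le, Ex.eval_sum (h4 _), Ex.eval_lit]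
    have : ∀ p ∈ Finset.range M, (Ex.get 7 (.var 4 0) (.lit 0) (.lit 0)).eval C H'
        (Function.update (Function.update ρ 5 u) 4 p) = (digit n x p : ℝ) := fun p hp => by
      simp [hH 7 (by norm_num), h7 p (Finset.mem_range.1 hp)]
    rw [Finset.sum_congr rfl fun p hp => by rw [this p hp]]
    simp [one_le_sum_flag, probe, hb]

theorem wp_crownSt (hs : Std C T M r) (h : Static T M H) {v : Fin n} {X : Set (Fin n)}
    (hv : ρ 1 = v) (h8 : ∀ u : Fin n, H 8 u 0 0 = flag (u ∈ X))
    (hQ : ∀ H', (∀ a' ≠ 9, H' a' = H a') →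
      (∀ u : Fin n, H' 9 u 0 0 = flag (u ∈ T.crown r v X)) → Q H') :
    wp C crownSt ρ Q H := by
  have hcn := hs.cn
  refine wp_row _ hs.cn ok_nE hs.eval_nE hs.le_bd (by decide) ?_ hQ
  intro u H' hH
  have h' := h.congr_array hH (by decide)
  have g1 : (Ix.lit 0).eval (Function.update ρ 5 u) = r := by simp [hs.root]
  have g2 : (Ix.var 1 0).eval (Function.update ρ 5 u) = v := by simp [hv]
  have g3 : (Ix.var 5 0).eval (Function.update ρ 5 u) = u := by simp
  have g4 : ∀ w : Fin n, (Ix.var 1 0).eval (Function.update (Function.update ρ 5 u) 6 w) = v :=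
    fun w => by simp [hv]
  have g5 : ∀ w : Fin n, (Ix.var 5 0).eval (Function.update (Function.update ρ 5 u) 6 w) = u :=
    fun w => by simp
  have g6 : ∀ w : Fin n, (Ix.var 6 0).eval (Function.update (Function.update ρ 5 u) 6 w) = w :=
    fun w => by simp
  constructor
  · simp only [Ex.ok_mul, Ex.ok_le, Ex.ok_lit, hs.ok_btwE g1 g2 g3, hs.ok_sum,
      hs.ok_btwE (g4 _) (g6 _) (g5 _), Ex.ok_get, g6, Ix.eval_lit]
    simp [arrCount]; omega
  · simp only [Ex.eval_mul, Ex.eval_le, h'.eval_btwE g1 g2 g3, hs.eval_sum, Ex.eval_lit,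
      h'.eval_btwE (g4 _) (g6 _) (g5 _), Ex.eval_get, g6, Ix.eval_lit, hH 8 (by norm_num), h8,
      flag_mul, Rat.cast_zero, sum_flag_le_zero]
    refine flag_congr ?_
    rw [mem_crown]
    refine and_congr_right fun _ => ?_
    unfold Live
    exact ⟨fun hl w hw hb => hl w (Finset.mem_univ _) ⟨hb, hw⟩, fun hl w _ hw => hl w hw.2 hw.1⟩

theorem wp_borderSt (hs : Std C T M r) (h : Static T M H) {v : Fin n} {K : Finset (Fin n)}
    (hv : ρ 1 = v) (h9 : ∀ u : Fin n, H 9 u 0 0 = flag (u ∈ K))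
    (hQ : ∀ H', (∀ a' ≠ 10, H' a' = H a') →
      (∀ u : Fin n, H' 10 u 0 0 = flag (u ∈ T.border r v K)) → Q H') :
    wp C borderSt ρ Q H := by
  have hcn := hs.cn
  refine wp_row _ hs.cn ok_nE hs.eval_nE hs.le_bd (by decide) ?_ hQ
  intro u H' hH
  have h' := h.congr_array hH (by decide)
  have g1 : (Ix.lit 0).eval (Function.update ρ 5 u) = r := by simp [hs.root]
  have g2 : (Ix.var 1 0).eval (Function.update ρ 5 u) = v := by simp [hv]
  have g3 : (Ix.var 5 0).eval (Function.update ρ 5 u) = u := by simp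
  have g4 : ∀ w : Fin n, (Ix.var 1 0).eval (Function.update (Function.update ρ 5 u) 6 w) = v :=
    fun w => by simp [hv]
  have g5 : ∀ w : Fin n, (Ix.var 5 0).eval (Function.update (Function.update ρ 5 u) 6 w) = u :=
    fun w => by simp
  have g6 : ∀ w : Fin n, (Ix.var 6 0).eval (Function.update (Function.update ρ 5 u) 6 w) = w :=
    fun w => by simp
  constructor
  · simp only [Ex.ok_mul, Ex.ok_le, Ex.ok_lit, hs.ok_btwE g1 g2 g3, hs.ok_sum, Ex.ok_not,
      hs.ok_btwE (g4 _) (g6 _) (g5 _), Ex.ok_get, g6, g3, Ix.eval_lit, Ex.ok_eq, Ex.ok_var]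
    simp [arrCount]
    exact ⟨by omega, fun u => by omega⟩
  · have g7 : ∀ w : Fin n, (Function.update (Function.update ρ 5 (u : ℕ)) 6 (w : ℕ)) 5 = u :=
      fun w => by simp
    simp only [Ex.eval_mul, Ex.eval_le, h'.eval_btwE g1 g2 g3, hs.eval_sum, Ex.eval_lit,
      Ex.eval_not, h'.eval_btwE (g4 _) (g6 _) (g5 _), Ex.eval_get, g6, g3, Ix.eval_lit, hH 9 (by norm_num), h9,
      one_sub_flag, Ex.eval_eq, Ex.eval_var, g7, Function.update_self,
      flag_mul, Rat.cast_zero, sum_flag_le_zero, Nat.cast_inj, ← Fin.ext_iff]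
    refine flag_congr ?_
    rw [mem_border, and_assoc]
    refine and_congr_right fun _ => and_congr_right fun _ => ?_
    exact ⟨fun hl w hb hne => not_not.1 fun hw => hl w (Finset.mem_univ _) ⟨⟨hb, hne⟩, hw⟩,
      fun hl w _ hw => hw.2 (hl w hw.1.1 hw.1.2)⟩

theorem wp_topSt (hs : Std C T M r) (h : Static T M H) {D : Finset (Fin n)}
    (h10 : ∀ u : Fin n, H 10 u 0 0 = flag (u ∈ D))
    (hQ : ∀ H', (∀ a' ≠ 11, H' a' = H a') →
      (∀ c : Fin n, H' 11 c 0 0 = flag (c ∈ T.childSet r D)) → Q H') :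
    wp C topSt ρ Q H := by
  have hcn := hs.cn
  refine wp_row _ hs.cn ok_nE hs.eval_nE hs.le_bd (by decide) ?_ hQ
  intro c H' hH
  have h' := h.congr_array hH (by decide)
  have g1 : ∀ u : Fin n, (Ix.var 7 0).eval (Function.update (Function.update ρ 7 c) 5 u) = c :=
    fun u => by simp
  have g2 : ∀ u : Fin n, (Ix.var 5 0).eval (Function.update (Function.update ρ 7 c) 5 u) = u :=
    fun u => by simp
  constructor
  · simp only [Ex.ok_mul, Ex.ok_le, Ex.ok_lit, hs.ok_sum, Ex.ok_get, g1, g2, Ix.eval_lit, Ex.ok_eq,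
      Ex.ok_add]
    simp [arrCount]; omega
  · simp only [Ex.eval_mul, Ex.eval_le, hs.eval_sum, Ex.eval_lit, Ex.eval_get, g1, g2, Ix.eval_lit,
      hH 10 (by norm_num), h10, h'.adj, h'.dist_root hs, Ex.eval_eq, Ex.eval_add, flag_mul,
      Rat.cast_one, one_le_sum_flag]
    refine flag_congr ?_
    rw [mem_childSet]
    refine exists_congr fun u => ?_
    rw [← Nat.cast_succ, Nat.cast_inj, and_assoc]
    simp

end

section
variable {C : Ctx} {n : ℕ} {T : SimpleGraph (Fin n)} {M : ℕ} {r : Fin n} {H : Heap} {ρ : Env}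
  {Q : Heap → Prop}

theorem sum_flag_mem (K : Finset (Fin n)) : ∑ u : Fin n, flag (u ∈ K) = (K.card : ℝ) := by
  classical
  rw [sum_flag]
  congr 2
  ext u
  simp

theorem sum_sum_flag_mem (K : Finset (Fin n)) (f : Fin n → Fin n → ℝ) :
    ∑ u : Fin n, ∑ w : Fin n, flag (u ∈ K) * flag (w ∈ K) * f u w =
      ∑ u ∈ K, ∑ w ∈ K, f u w := by
  classical
  have : ∀ u, ∑ w : Fin n, flag (u ∈ K) * flag (w ∈ K) * f u w =
      if u ∈ K then ∑ w ∈ K, f u w else 0 := fun u => by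
    by_cases h : u ∈ K <;> simp [flag, h]
  simp [this]

open Classical in
theorem wp_crownValueSt (hs : Std C T M r) (h : Static T M H) {K D : Finset (Fin n)}
    (h9 : ∀ u : Fin n, H 9 u 0 0 = flag (u ∈ K)) (h10 : ∀ u : Fin n, H 10 u 0 0 = flag (u ∈ D))
    (hQ : ∀ H', (∀ a' ≠ 12, H' a' = H a') → (∀ j ≤ n, H' 12 0 j 0 =
      if j = D.card then T.fullPairSum K else infVal C) → Q H') :
    wp C crownValueSt ρ Q H := by
  have hcn := hs.cn
  refine wp_rowAt _ hs.cn ok_wE hs.eval_wE hs.bd1 (by decide) (m := 0) (fun _ => rfl)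
    (Nat.zero_le _) ?_ fun H' h1 _ => hQ H' h1
  intro j hj H' hH _ _
  have h' := h.congr_array hH (by decide)
  have g1 : ∀ ρ', borderCardE.Ok C H' ρ' := fun ρ' => by
    rw [borderCardE, hs.ok_sum]
    intro u
    simp [arrCount]; omega
  have g2 : ∀ ρ', borderCardE.eval C H' ρ' = (D.card : ℝ) := fun ρ' => by
    rw [borderCardE, hs.eval_sum, ← sum_flag_mem]
    refine Finset.sum_congr rfl fun u _ => ?_
    simp [hH 10 (by norm_num), h10]
  have g3 : ∀ ρ', crownSumE.Ok C H' ρ' := fun ρ' => by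
    simp only [crownSumE, hs.ok_sum]
    intro u w
    simp [arrCount]; omega
  have g4 : ∀ ρ', crownSumE.eval C H' ρ' = T.fullPairSum K := fun ρ' => by
    rw [crownSumE, hs.eval_sum, fullPairSum, ← sum_sum_flag_mem]
    refine Finset.sum_congr rfl fun u _ => ?_
    rw [hs.eval_sum]
    refine Finset.sum_congr rfl fun w _ => ?_
    simp [hH 9 (by norm_num), h9, h'.dist]
  constructor
  · simp [g1, g3, ok_infE]
  · simp only [Ex.eval_add, Ex.eval_mul, Ex.eval_eq, Ex.eval_not, Ex.eval_var, g2, g4, eval_infE,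
      Function.update_self, Nat.cast_inj]
    by_cases hj : j = D.card <;> simp [hj, flag]

theorem iter_congr {op : Op} {z : ℝ} {f g : ℕ → ℝ} {c : ℕ} (h : ∀ i < c, f i = g i) :
    iter op z f c = iter op z g c := by
  induction c with
  | zero => rfl
  | succ c ih => rw [iter, iter, ih fun i hi => h i (by omega), h c (by omega)]

open Classical in
theorem wp_combineSt (hs : Std C T M r) {A : Finset (Fin n)}
    (h11 : ∀ c : Fin n, H 11 c 0 0 = flag (c ∈ A))
    (hQ : ∀ H', (∀ a' ≠ 12, H' a' = H a') → (∀ j, H' 12 0 j 0 = H 12 0 j 0) →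
      (∀ c : Fin n, ∀ j ≤ n, H' 12 (c + 1) j 0 = if c ∈ A then
        minConv (infVal C) n (fun j => H' 12 c j 0) (fun j => H 6 c j 0) j else H' 12 c j 0) →
      Q H') :
    wp C combineSt ρ Q H := by
  have hcn := hs.cn
  refine ⟨ok_nE, n, hs.eval_nE, hs.le_bd, fun m H' => (∀ a' ≠ 12, H' a' = H a') ∧
    (∀ j, H' 12 0 j 0 = H 12 0 j 0) ∧ ∀ c : Fin n, (c : ℕ) < m → ∀ j ≤ n,
      H' 12 (c + 1) j 0 = if c ∈ A then
        minConv (infVal C) n (fun j => H' 12 c j 0) (fun j => H 6 c j 0) j else H' 12 c j 0,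
    ⟨fun _ _ => rfl, fun _ => rfl, fun c hc => absurd hc (Nat.not_lt_zero _)⟩, ?_,
    fun H' h => hQ H' h.1 h.2.1 fun c => h.2.2 c c.2⟩
  rintro m hm H1 ⟨h1, h2, h3⟩
  refine wp_rowAt (fun j => if (⟨m, hm⟩ : Fin n) ∈ A then
        minConv (infVal C) n (fun j => H1 12 m j 0) (fun j => H 6 m j 0) j else H1 12 m j 0)
    hs.cn ok_wE hs.eval_wE hs.bd1 (by decide) (m := m + 1) (by simp) hm ?_ ?_
  · intro j hj H2 h4 h5 _
    have e11 : H2 11 m 0 0 = flag ((⟨m, hm⟩ : Fin n) ∈ A) := by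
      rw [h4 11 (by norm_num), h1 11 (by norm_num)]
      exact h11 ⟨m, hm⟩
    have e12 : H2 12 m = H1 12 m := h5 m (by omega)
    have e6 : H2 6 = H 6 := by rw [h4 6 (by norm_num), h1 6 (by norm_num)]
    constructor
    · simp only [Ex.ok_add, Ex.ok_mul, Ex.ok_not, minConvE]
      rw [Ex.ok_fold ok_wE hs.eval_wE hs.bd1]
      refine ⟨⟨by simp [arrCount]; omega, ok_infE, fun a ha => ?_⟩, by simp [arrCount]; omega,
        by simp [arrCount]; omega⟩
      rw [Ex.ok_fold ok_wE hs.eval_wE hs.bd1]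
      refine ⟨ok_infE, fun b hb => ?_⟩
      simp [arrCount, ok_infE]
      omega
    · have hconv : minConvE.eval C H2 (Function.update (Function.update ρ 7 m) 8 j) =
          minConv (infVal C) n (fun j => H1 12 m j 0) (fun j => H 6 m j 0) j := by
        simp only [minConvE, Ex.eval, hs.eval_wE, Nat.floor_natCast, minConv, eval_infE]
        refine iter_congr fun a ha => iter_congr fun b hb => ?_
        simp only [Ex.eval_add, Ex.eval_eq, Ex.eval_not, Ex.eval_var, Ix.eval_var, Ix.eval_lit,
          one_sub_flag, e6]
        simp [e12]
        norm_cast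
      simp only [Ex.eval_add, Ex.eval_mul, Ex.eval_not, hconv, Ex.eval_get]
      simp [e11, e12]
      by_cases hA : (⟨m, hm⟩ : Fin n) ∈ A <;> simp [hA, flag]
  · intro H2 h4 h5 h6
    refine ⟨fun a' ha' => (h4 a' ha').trans (h1 a' ha'), fun j => ?_, fun c hc j hj => ?_⟩
    · rw [h5 0 (by omega), h2]
    · rw [h5 c (by omega)]
      rcases Nat.lt_succ_iff_lt_or_eq.1 hc with hc | hc
      · rw [h5 (c + 1) (by omega)]
        exact h3 c hc j hj
      · obtain rfl : c = ⟨m, hm⟩ := Fin.ext hc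
        exact h6 j hj

theorem wp_updateSt (hs : Std C T M r) {v : Fin n} (hv : ρ 1 = v)
    (hQ : ∀ H', (∀ a' ≠ 6, H' a' = H a') → (∀ u : Fin n, u ≠ v → H' 6 u = H 6 u) →
      (∀ j ≤ n, H' 6 v j 0 = min (H 6 v j 0) (H 12 n j 0)) → Q H') :
    wp C updateSt ρ Q H := by
  have hcn := hs.cn
  refine wp_rowAt (fun j => min (H 6 v j 0) (H 12 n j 0)) hs.cn ok_wE hs.eval_wE hs.bd1 (by decide)
    (m := v) (by simp [hv]) v.2.le ?_ fun H' h1 h2 h3 => hQ H' h1 (fun u hu => h2 u ?_) h3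
  · intro j hj H' h1 h2 h3
    constructor
    · rw [Ex.ok_min, Ex.ok_sum ok_wE hs.eval_wE hs.bd1]
      refine ⟨by simp [arrCount, hv]; omega, fun c hc => ?_⟩
      simp [arrCount, ok_nE]; omega
    · rw [Ex.eval_min, Ex.eval_sum hs.eval_wE, Finset.sum_eq_single n]
      · simp [hv, hs.eval_nE, flag, h3, h1 12 (by norm_num)]
      · intro c _ hc
        simp [hs.eval_nE, flag, hc]
      · simp
  · rwa [Ne, ← Fin.ext_iff]

def stepSt : St := .seq digitSt (.seq probeSt (.seq crownSt (.seq borderSt (.seq topSt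
  (.seq crownValueSt (.seq combineSt updateSt))))))

theorem wp_stepSt (hs : Std C T M r) (h : Static T M H) {v : Fin n} {x b : ℕ} (hv : ρ 1 = v)
    (hx : ρ 2 = x) (hb : ρ 3 = b) (hxB : x < (n + 1) ^ M)
    (hQ : ∀ (H' : Heap) (g : ℕ → ℕ → ℝ), Static T M H' → (∀ u : Fin n, u ≠ v → H' 6 u = H 6 u) →
      Combines T r v (probe n M x b) (infVal C) (fun c j => H 6 c j 0) g →
      (∀ j ≤ n, H' 6 v j 0 = min (H 6 v j 0) (g n j)) → Q H') :
    wp C stepSt ρ Q H := by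
  refine wp_digitSt hs h hx hxB fun H1 e1 d1 => ?_
  have s1 := h.congr_array e1 (by decide)
  refine wp_probeSt hs s1 hb d1 fun H2 e2 d2 => ?_
  have s2 := s1.congr_array e2 (by decide)
  refine wp_crownSt hs s2 hv d2 fun H3 e3 d3 => ?_
  have s3 := s2.congr_array e3 (by decide)
  refine wp_borderSt hs s3 hv d3 fun H4 e4 d4 => ?_
  have s4 := s3.congr_array e4 (by decide)
  refine wp_topSt hs s4 d4 fun H5 e5 d5 => ?_
  have s5 := s4.congr_array e5 (by decide)
  refine wp_crownValueSt hs s5 (by rwa [e5 9 (by norm_num), e4 9 (by norm_num)])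
    (by rwa [e5 10 (by norm_num)]) fun H6 e6 d6 => ?_
  have s6 := s5.congr_array e6 (by decide)
  refine wp_combineSt hs (by rwa [e6 11 (by norm_num)]) fun H7 e7 d7 c7 => ?_
  have s7 := s6.congr_array e7 (by decide)
  refine wp_updateSt hs hv fun H8 e8 f8 d8 => ?_
  have t6 : H6 6 = H 6 := by
    rw [e6 6 (by norm_num), e5 6 (by norm_num), e4 6 (by norm_num), e3 6 (by norm_num),
      e2 6 (by norm_num), e1 6 (by norm_num)]
  have t7 : H7 6 = H 6 := by rw [e7 6 (by norm_num), t6]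
  refine hQ H8 (fun m j => H7 12 m j 0) (s7.congr_array e8 (by decide))
    (fun u hu => by rw [f8 u hu, t7]) ⟨fun j hj => ?_, fun c j hj => ?_⟩ fun j hj => by
      rw [d8 j hj, t7]
  · show H7 12 0 j 0 = _
    rw [d7, d6 j hj]
  · show H7 12 (c + 1) j 0 = _
    rw [c7 c j hj, t6]
    rfl

/-! ## The algorithm: all crowns -/

/-- All values in the table are attained by deletions. -/
structure Sound (C : Ctx) {n : ℕ} (T : SimpleGraph (Fin n)) (M : ℕ) (r : Fin n) (H : Heap) :
    Prop where
  static : Static T M H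
  row : ∀ u : Fin n, SoundRow T r u (infVal C) fun j => H 6 u j 0

/-- The deletions that the table takes into account in the subtree of a vertex. -/
def settled {n : ℕ} (T : SimpleGraph (Fin n)) (r : Fin n) (H : Heap) :
    Set (Fin n × Finset (Fin n)) :=
  {a | CompleteRow T r a.1 a.2 fun j => H 6 a.1 j 0}

/-- The deletions that agree with `X` near the `i`-th vertex, and are taken into account below. -/
def reduced {n : ℕ} (T : SimpleGraph (Fin n)) (r : Fin n) (i : ℕ) (X : Set (Fin n))
    (D : Set (Fin n × Finset (Fin n))) : Set (Fin n × Finset (Fin n)) :=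
  {a | (a.1 : ℕ) = i ∧ T.crown r a.1 X = T.crown r a.1 a.2 ∧
    ∀ c, T.dist r a.1 < T.dist r c → (c, a.2) ∈ D}

theorem reduced_mono {i : ℕ} {X : Set (Fin n)} : Monotone (reduced T r i X) :=
  fun _ _ h _ ha => ⟨ha.1, ha.2.1, fun c hc => h (ha.2.2 c hc)⟩

/-- The new row of `v` is the minimum of the old one and the combination for the probed crown, so
nothing settled is lost and every entry remains sound. If the probe yields the crown of `S`, the
tops are deeper than `v` and already settled, and `Combines.completeRow` applies. -/
theorem wp_stepSt_settled (hs : Std C T M r) (h : Sound C T M r H) {v x b : ℕ} (hvn : v < n)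
    (hv : ρ 1 = v) (hx : ρ 2 = x) (hb : ρ 3 = b) (hxB : x < (n + 1) ^ M) :
    wp C stepSt ρ (fun H' => Sound C T M r H' ∧ settled T r H ⊆ settled T r H' ∧
      reduced T r v (probe n M x b) (settled T r H) ⊆ settled T r H') H := by
  have hcard : ∀ (u : Fin n) (S : Finset (Fin n)), (T.subtree r u ∩ S).card ≤ n := fun u S =>
    (Finset.card_le_univ _).trans (by simp)
  refine wp_stepSt hs h.static (v := ⟨v, hvn⟩) hv hx hb hxB fun H' g h1 h2 h3 h4 =>
    ⟨⟨h1, fun u => ?_⟩, ?_, ?_⟩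
  · by_cases hu : u = ⟨v, hvn⟩
    · subst hu
      intro j hj
      simp only [h4 j hj]
      rcases min_choice (H 6 v j 0) (g n j) with h5 | h5
      · rw [h5]; exact h.row ⟨v, hvn⟩ j hj
      · rw [h5]; exact h3.soundRow hs.tree infVal_nonneg h.row j hj
    · simp only [h2 u hu]; exact h.row u
  · rintro ⟨u, S⟩ ha
    simp only [settled, CompleteRow, Set.mem_ofPred_eq] at ha ⊢
    by_cases hu : u = ⟨v, hvn⟩
    · subst hu
      rw [h4 _ (hcard _ _)]
      exact (min_le_left _ _).trans ha
    · rw [h2 u hu]; exact ha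
  · rintro ⟨u, S⟩ ⟨hu, hX, hD⟩
    obtain rfl : u = ⟨v, hvn⟩ := Fin.ext hu
    have := h3.completeRow hs.tree hX fun c hc =>
      hD c (hs.tree.mem_subtree_of_mem_tops hc).2
    simp only [settled, CompleteRow, Set.mem_ofPred_eq] at this ⊢
    rw [h4 _ (hcard _ _)]
    exact (min_le_right _ _).trans this

/-- A loop in which a growing set collects what each round contributes. -/
theorem wp_collect {α : Type*} {s : St} {b : Ex} {x c : ℕ} {I : Heap → Prop} {A : Heap → Set α}
    {N : ℕ → Set α → Set α} (hN : ∀ i, Monotone (N i)) (hb : b.Ok C H ρ) (hc : b.eval C H ρ = c)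
    (hle : c ≤ C.bd) (hI : I H)
    (hs : ∀ i < c, ∀ H', I H' → wp C s (Function.update ρ x i)
      (fun H'' => I H'' ∧ A H' ⊆ A H'' ∧ N i (A H') ⊆ A H'') H') :
    wp C (.loop x b s) ρ
      (fun H' => I H' ∧ A H ⊆ A H' ∧ {a | ∃ i < c, a ∈ N i (A H)} ⊆ A H') H := by
  refine ⟨hb, c, hc, hle, fun k H' => I H' ∧ A H ⊆ A H' ∧ {a | ∃ i < k, a ∈ N i (A H)} ⊆ A H',
    ⟨hI, subset_rfl, by rintro a ⟨i, hi, -⟩; exact absurd hi (Nat.not_lt_zero i)⟩, ?_,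
    fun _ h => h⟩
  rintro i hi H' ⟨h1, h2, h3⟩
  refine (hs i hi H' h1).mono fun H'' ⟨h4, h5, h6⟩ => ⟨h4, h2.trans h5, ?_⟩
  rintro a ⟨k, hk, ha⟩
  rcases Nat.lt_succ_iff_lt_or_eq.1 hk with hk | rfl
  · exact h5 (h3 ⟨k, hk, ha⟩)
  · exact h6 (hN k h2 ha)

/-- Try all crowns at all vertices. -/
def sweepSt : St := .loop 1 nE (.loop 2 (.get 5 (.lit 0) (.lit 0) (.lit 0))
  (.loop 3 (.lit 2) stepSt))

theorem wp_sweepSt (hs : Std C T M r) (h : Sound C T M r H) :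
    wp C sweepSt ρ (fun H' => Sound C T M r H' ∧ settled T r H ⊆ settled T r H' ∧
      {a | ∃ v < n, ∃ x < (n + 1) ^ M, ∃ b < 2,
        a ∈ reduced T r v (probe n M x b) (settled T r H)} ⊆ settled T r H') H := by
  have hn1 : 1 ≤ n := r.pos
  have m1 : ∀ v x, Monotone fun D : Set (Fin n × Finset (Fin n)) =>
      {a | ∃ b < 2, a ∈ reduced T r v (probe n M x b) D} :=
    fun v x D D' hD a ⟨b, hb, ha⟩ => ⟨b, hb, reduced_mono hD ha⟩
  have m2 : ∀ v, Monotone fun D : Set (Fin n × Finset (Fin n)) =>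
      {a | ∃ x < (n + 1) ^ M, ∃ b < 2, a ∈ reduced T r v (probe n M x b) D} :=
    fun v D D' hD a ⟨x, hx, ha⟩ => ⟨x, hx, m1 v x hD ha⟩
  refine wp_collect (N := fun v D => {a | ∃ x < (n + 1) ^ M, ∃ b < 2,
        a ∈ reduced T r v (probe n M x b) D}) m2 ok_nE hs.eval_nE hs.le_bd h ?_
  intro v hv H1 h1
  refine wp_collect (N := fun x D => {a | ∃ b < 2, a ∈ reduced T r v (probe n M x b) D}) (m1 v)
    (by simp [arrCount]) (by simpa using h1.static.count) hs.bdM h1 ?_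
  intro x hx H2 h2
  refine wp_collect (N := fun b D => reduced T r v (probe n M x b) D) (fun _ => reduced_mono)
    (by simp) (by simp) (by have := hs.bd1; omega) h2 ?_
  intro b hb H3 h3
  exact wp_stepSt_settled hs h3 hv (by simp) (by simp) (by simp) hx

/-- Everything near a vertex that `S` does is encoded by a number and a bit. -/
def Encodable {n : ℕ} (T : SimpleGraph (Fin n)) (M : ℕ) (r : Fin n) (S : Finset (Fin n)) : Prop :=
  ∀ v, ∃ x < (n + 1) ^ M, ∃ b < 2, T.crown r v (probe n M x b) = T.crown r v S

/-- Vertices are not sorted by depth. Instead the whole sweep is repeated `n` times: after `t`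
sweeps all vertices at distance at least `n - t` from the root are settled, and distances are less
than `n`. -/
theorem wp_sweeps (hs : Std C T M r) (h : Sound C T M r H) :
    wp C (.loop 0 nE sweepSt) ρ (fun H' => Sound C T M r H' ∧
      ∀ S, Encodable T M r S → (r, S) ∈ settled T r H') H := by
  refine ⟨ok_nE, n, hs.eval_nE, hs.le_bd, fun t H' => Sound C T M r H' ∧
    ∀ S, Encodable T M r S → ∀ u, n ≤ T.dist r u + t → (u, S) ∈ settled T r H',
    ⟨h, fun S _ u hu => ?_⟩, ?_, fun H' h => ⟨h.1, fun S hS => h.2 S hS r (by simp)⟩⟩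
  · have := hs.tree.1.dist_lt_card_btw r u (B := Finset.univ) (by simp)
    simp at this
    omega
  · rintro t ht H1 ⟨h1, h2⟩
    refine (wp_sweepSt hs h1).mono fun H2 ⟨h3, h4, h5⟩ => ⟨h3, fun S hS u hu => ?_⟩
    obtain ⟨x, hx, b, hb, hX⟩ := hS u
    exact h5 ⟨u, u.2, x, hx, b, hb, rfl, hX, fun c hc => h2 S hS c (by
      have : T.dist r u < T.dist r c := hc
      omega)⟩

end

/-! ## The algorithm: the answer -/

section
variable {C : Ctx} {n : ℕ} {T : SimpleGraph (Fin n)} {M : ℕ} {r : Fin n} {H : Heap} {ρ : Env}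
  {Q : Heap → Prop}

def mainSt : St :=
  .seq adjSt (.seq reachSt (.seq distSt (.seq paramSt (.seq initSt (.loop 0 nE sweepSt)))))

theorem wp_mainSt (hs : Std C T (cutoff n) r)
    (hadj : ∀ i j : Fin n, C.Readable (inputAddr n i j) ∧
      C.imm (inputAddr n i j) = flag (T.Adj i j)) :
    wp C mainSt ρ (fun H' => Sound C T (cutoff n) r H' ∧
      ∀ S, Encodable T (cutoff n) r S → (r, S) ∈ settled T r H') H := by
  refine wp_adjSt hs hadj fun H1 _ d1 => ?_
  refine wp_reachSt hs d1 fun H2 e2 d2 => ?_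
  refine wp_distSt hs d2 fun H3 e3 d3 => ?_
  refine wp_paramSt hs fun H4 e4 d4 d4' => ?_
  refine wp_initSt hs fun H5 e5 d5 => ?_
  refine wp_sweeps hs ⟨⟨?_, ?_, ?_, ?_⟩, fun u j hj => ?_⟩
  · rwa [e5 0 (by norm_num), e4 0 (by norm_num) (by norm_num), e3 0 (by norm_num),
      e2 0 (by norm_num)]
  · rwa [e5 2 (by norm_num), e4 2 (by norm_num) (by norm_num)]
  · rwa [e5 4 (by norm_num)]
  · rwa [e5 5 (by norm_num)]
  · simp only [d5 u j hj]
    exact ⟨infVal_nonneg, Or.inl le_rfl⟩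

theorem exists_digits {m w : ℕ} (f : Fin m → Fin (w + 1)) :
    ∃ x < (w + 1) ^ m, ∀ p : Fin m, digit w x p = f p := by
  refine ⟨finFunctionFinEquiv f, (finFunctionFinEquiv f).2, fun p => ?_⟩
  have := congrFun (finFunctionFinEquiv.symm_apply_apply f) p
  rw [← this, finFunctionFinEquiv_symm_apply_val]
  rfl

theorem exists_marks {A : Finset (Fin n)} (hA : A.card ≤ M) :
    ∃ x < (n + 1) ^ M, ∀ u : Fin n, (∃ p < M, digit n x p = u) ↔ u ∈ A := by
  obtain ⟨x, hx, h⟩ := exists_digits (m := M) (w := n) fun p =>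
    -- The digits enumerate `A`; unused ones are filled with `n`, which is no vertex. This is why
    -- the base is `n + 1`.
    if hp : (p : ℕ) < A.card then (A.equivFin.symm ⟨p, hp⟩ : Fin n).castSucc else Fin.last n
  refine ⟨x, hx, fun u => ⟨?_, fun hu => ?_⟩⟩
  · rintro ⟨p, hp, hpu⟩
    have := h ⟨p, hp⟩
    simp only at this
    rw [hpu] at this
    split_ifs at this with hc
    · have h2 : u = (A.equivFin.symm ⟨p, hc⟩ : Fin n) := Fin.ext this
      rw [h2]
      exact (A.equivFin.symm ⟨p, hc⟩).2
    · have := u.2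
      simp at *
      omega
  · have h1 := (A.equivFin ⟨u, hu⟩).2
    refine ⟨A.equivFin ⟨u, hu⟩, by omega, ?_⟩
    have := h ⟨A.equivFin ⟨u, hu⟩, by omega⟩
    simp only at this
    rw [this, dif_pos h1]
    simp

theorem exists_probe_eq {A : Finset (Fin n)} (hA : A.card ≤ M) :
    ∃ x < (n + 1) ^ M, probe n M x 1 = A ∧ probe n M x 0 = (A : Set (Fin n))ᶜ := by
  obtain ⟨x, hx, h⟩ := exists_marks hA
  refine ⟨x, hx, ?_, ?_⟩
  · ext u
    simp only [probe, Set.mem_ofPred_eq, h]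
    by_cases hu : u ∈ A <;> simp [flag, hu]
  · ext u
    simp only [probe, Set.mem_ofPred_eq, h]
    by_cases hu : u ∈ A <;> simp [flag, hu]

theorem cutoff_le (n : ℕ) : cutoff n ≤ n :=
  (Finset.card_filter_le _ _).trans (by simp)

/-- The condition is inherited by smaller `i`, so counting its solutions gives its threshold. In
this way the machine finds the parameter without extracting roots. -/
theorem lt_cutoff_iff {n i : ℕ} (hi : i < n) : i < cutoff n ↔ i ^ 4 < 3200 * n ^ 3 := by
  have hfil : ∀ i, i ^ 4 < 3200 * n ^ 3 → i < n →
      Finset.range (i + 1) ⊆ (Finset.range n).filter fun i => i ^ 4 < 3200 * n ^ 3 := by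
    intro i h hi j hj
    rw [Finset.mem_range] at hj
    rw [Finset.mem_filter, Finset.mem_range]
    exact ⟨by omega, (Nat.pow_le_pow_left (by omega) 4).trans_lt h⟩
  constructor
  · intro h
    by_contra! hn
    have : (Finset.range n).filter (fun i => i ^ 4 < 3200 * n ^ 3) ⊆ Finset.range i := by
      intro j hj
      rw [Finset.mem_filter] at hj
      rw [Finset.mem_range]
      by_contra! hij
      have := Nat.pow_le_pow_left hij 4
      omega
    have := Finset.card_le_card this
    rw [Finset.card_range] at this
    unfold cutoff at h
    omega
  · intro h
    have := Finset.card_le_card (hfil i h hi)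
    rw [Finset.card_range] at this
    unfold cutoff
    omega

/-- If `S` has at most `M = cutoff n` vertices, probe `S` itself with bit `1`. Otherwise `M < n` and
`M^4 ≥ 3200 n^3`, so the component bound leaves components of size at most `M`; then probe the
component of `v` with bit `0`, which stands for the complement. -/
theorem encodable_of_optimal (hT : T.IsTree) {S : Finset (Fin n)}
    (hopt : ∀ S' : Finset (Fin n), S'.card = S.card →
      T.pairSum Finset.univ S ≤ T.pairSum Finset.univ S') :
    Encodable T (cutoff n) r S := by
  intro v
  by_cases hS : S.card ≤ cutoff n
  · obtain ⟨x, hx, h, -⟩ := exists_probe_eq hS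
    exact ⟨x, hx, 1, by norm_num, by rw [h]⟩
  · have hSn : S.card ≤ n := (Finset.card_le_univ _).trans (by simp)
    -- The threshold property at `cutoff n` itself, which is less than `n` because `S` is larger
    -- than it.
    have hM : ¬ cutoff n < cutoff n := lt_irrefl _
    rw [lt_cutoff_iff (by omega)] at hM
    have h := hT.card_liveSet_lt (Finset.card_pos.1 (by omega)) hopt v
    rw [Fintype.card_fin] at h
    have hle : (T.liveSet S v).card ≤ cutoff n := by
      by_contra! hc
      have h1 : cutoff n ^ 3 ≤ S.card ^ 3 := Nat.pow_le_pow_left (by omega) 3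
      have h2 := Nat.mul_le_mul hc.le h1
      have h3 : cutoff n * cutoff n ^ 3 = cutoff n ^ 4 := by ring
      omega
    obtain ⟨x, hx, -, h⟩ := exists_probe_eq hle
    exact ⟨x, hx, 0, by norm_num, by rw [h, hT.crown_compl_liveSet]⟩

def bestE : Ex := .fold .min 8 wE infE (.get 6 (.lit 0) (.var 8 0) (.lit 0) +
  ((Ex.var 8).eq (.inp (.lit 1))).not * infE)

theorem ok_bestE (hs : Std C T M r) : bestE.Ok C H ρ := by
  have hcn := hs.cn
  rw [bestE, Ex.ok_fold ok_wE hs.eval_wE hs.bd1]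
  refine ⟨ok_infE, fun j hj => ?_⟩
  have : ∀ ρ', (Ex.inp (.lit 1)).Ok C H ρ' := fun _ => ⟨trivial, 1, by simp, Or.inl (by norm_num)⟩
  simp [arrCount, ok_infE, this]
  omega

/-- A value of at most `2 τ` is below `infVal`, hence comes from the entry with index `k` and is
attained. Conversely the table only has to account for optimal sets, and these alone are guaranteed
to be encodable. If `k > n`, no index matches and the value is too large. -/
theorem bestE_le_iff (hs : Std C T M r) (hk : C.imm 1 = (k : ℕ)) (h : Sound C T M r H)
    (hset : ∀ S : Finset (Fin n), (∀ S' : Finset (Fin n), S'.card = S.card →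
      T.pairSum Finset.univ S ≤ T.pairSum Finset.univ S') → (r, S) ∈ settled T r H) :
    bestE.eval C H ρ ≤ 2 * C.imm 2 ↔ T.MinIGL k (C.imm 2) := by
  have hlt : 2 * C.imm 2 < infVal C := by
    unfold infVal
    nlinarith [mul_self_nonneg (2 * C.imm 2 - 1)]
  have hinp : ∀ ρ', (Ex.inp (.lit 1)).eval C H ρ' = k := fun _ => by
    rw [← hk]
    simp only [Ex.eval, Rat.cast_one, Nat.floor_one]
  have heval : bestE.eval C H ρ = iter .min (infVal C)
      (fun j => H 6 r j 0 + flag (¬ j = k) * infVal C) (n + 1) := by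
    simp only [bestE, Ex.eval, hs.eval_wE, Nat.floor_natCast, eval_infE]
    refine iter_congr fun j _ => ?_
    simp only [Ex.eval_not, Ex.eval_eq, Ex.eval_var, hinp, one_sub_flag, hs.root]
    simp [Op.app]
  rw [heval, hs.tree.minIGL_iff]
  constructor
  · intro hle
    rcases iter_min_eq (infVal C) (fun j => H 6 r j 0 + flag (¬ j = k) * infVal C) (n + 1)
      with h1 | ⟨j, hj, h1⟩
    · linarith
    · obtain ⟨h2, h3⟩ := h.row r j (by omega)
      simp only at h2 h3
      rw [h1] at hle
      by_cases hjk : j = k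
      · subst hjk
        rw [flag_false (by simp), zero_mul, add_zero] at hle
        rcases h3 with h3 | ⟨S, h3, h4⟩
        · linarith
        · rw [subtree_root, Finset.univ_inter] at h3
          rw [subtree_root] at h4
          exact ⟨S, h3, by linarith⟩
      · rw [flag_true hjk, one_mul] at hle
        linarith
  · rintro ⟨S, hS, hle⟩
    -- Replace `S` by an optimal set of the same size, for which completeness is available.
    obtain ⟨S', hS', hmin⟩ := (Finset.powersetCard k Finset.univ).exists_min_image
      (fun S : Finset (Fin n) => T.pairSum Finset.univ S)
      ⟨S, Finset.mem_powersetCard.2 ⟨Finset.subset_univ _, hS⟩⟩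
    obtain ⟨-, hS'⟩ := Finset.mem_powersetCard.1 hS'
    have h1 := hset S' fun S'' h'' => hmin S''
      (Finset.mem_powersetCard.2 ⟨Finset.subset_univ _, h''.trans hS'⟩)
    have h2 := hmin S (Finset.mem_powersetCard.2 ⟨Finset.subset_univ _, hS⟩)
    simp only [settled, CompleteRow, Set.mem_ofPred_eq, subtree_root, Finset.univ_inter, hS'] at h1
    have h3 : k ≤ n := hS' ▸ (Finset.card_le_univ _).trans (by simp)
    have h4 := (iter_min_le (infVal C) (fun j => H 6 r j 0 + flag (¬ j = k) * infVal C) (n + 1)).2 k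
      (by omega)
    simp only at h4
    rw [flag_false (by simp)] at h4
    linarith

end

/-! ## Freeing the registers -/

/-- Add the number of vertices `k` times to cell `3`. -/
def advanceCode : ℕ → List Instr
  | 0 => []
  | k + 1 => cat (advanceCode k) [.add 3 3 0]

theorem advanceCode_runs {s n y : ℕ} (k : ℕ) {m : Mem} (hs : 4 ≤ s) (h0 : m 0 = n) (h3 : m 3 = y) :
    RunsIn (advanceCode k) s k m fun m' => m' = Function.update m 3 ((y + k * n : ℕ) : ℝ) := by
  induction k with
  | zero =>
    refine RunsIn.nil ?_
    rw [Nat.zero_mul, Nat.add_zero, ← h3, Function.update_eq_self]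
  | succ k ih =>
    refine RunsIn.cat ih ?_
    rintro _ rfl
    refine RunsIn.effect (i := .add 3 3 0) rfl hs ?_
    simp only [Function.update_idem, Function.update_self,
      Function.update_of_ne (show 0 ≠ 3 by norm_num), h0]
    congr 1
    push_cast
    ring

/-- Copy the cells `4, …, k + 3` to distant places. -/
def saveCode : ℕ → List Instr
  | 0 => []
  | k + 1 => cat (saveCode k) (cat [.store 3 (4 + k)] [.add 3 3 0])

/-- Before the registers are free, only cell `3` can be used as a pointer and only `n` in cell `0`
as an increment, so the copies are placed `n` cells apart. They start at `n^2 + 68 n ≥ 69`, beyond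
all the cells that are being copied. -/
theorem saveCode_runs {s n : ℕ} (k : ℕ) {m : Mem} (hn : 1 ≤ n) (hk : k ≤ 60)
    (hs : n * n + 128 * n + 64 ≤ s)
    (h0 : m 0 = n) (h3 : m 3 = (n * n + 68 * n : ℕ)) :
    RunsIn (saveCode k) s (2 * k) m fun m' => m' 3 = (n * n + (68 + k) * n : ℕ) ∧
      (∀ a < k, m' (n * n + (68 + a) * n) = m (4 + a)) ∧
      ∀ c ≠ 3, (∀ a < k, c ≠ n * n + (68 + a) * n) → m' c = m c := by
  induction k with
  | zero => exact RunsIn.nil ⟨h3, fun a ha => absurd ha (Nat.not_lt_zero a), fun _ _ _ => rfl⟩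
  | succ k ih =>
    have hdest : ∀ a, 68 ≤ n * n + (68 + a) * n := fun a => by nlinarith [Nat.zero_le (a * n)]
    have hkn : (68 + k) * n ≤ 127 * n := Nat.mul_le_mul_right _ (by omega)
    refine RunsIn.cat (T₂ := 1 + 1) (ih (by omega)) fun m1 ⟨g3, gs, gc⟩ => ?_
    refine RunsIn.cat (Q₁ := fun m2 => m2 = Function.update m1 (n * n + (68 + k) * n) (m1 (4 + k)))
      (RunsIn.store (c := n * n + (68 + k) * n) g3 (by omega) (by omega) (by omega) rfl) ?_
    rintro _ rfl
    have e3 := hdest k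
    have g0 : m1 0 = n := by
      rw [gc 0 (by norm_num) fun a _ => by have := hdest a; omega, h0]
    have g4 : m1 (4 + k) = m (4 + k) := gc _ (by omega) fun a _ => by have := hdest a; omega
    refine RunsIn.effect (i := .add 3 3 0) rfl (show 4 ≤ s by omega) ⟨?_, fun a ha => ?_,
      fun c hc hca => ?_⟩
    · rw [Function.update_self, Function.update_of_ne (by omega), Function.update_of_ne (by omega),
        g3, g0]
      push_cast
      ring
    · rw [Function.update_of_ne (by have := hdest a; omega)]
      rcases Nat.lt_succ_iff_lt_or_eq.1 ha with ha | rfl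
      · rw [Function.update_of_ne, gs a ha]
        intro h
        have := Nat.eq_of_mul_eq_mul_right (by omega) (Nat.add_left_cancel h)
        omega
      · rw [Function.update_self, g4]
    · rw [Function.update_of_ne hc, Function.update_of_ne (hca k (by omega)),
        gc c hc fun a ha => hca a (by omega)]

/-- Move the input out of the registers, and set up the constants that the compiled code uses. -/
def prologue : List Instr :=
  cat [.mul 3 0 0] (cat (advanceCode 68) (cat (saveCode 60)
    -- After 60 copies the pointer is `n^2 + 128 n`, so adding 64 gives `baseCell n`. Cell `3` is
    -- then reused for `n + 1`.
    [.const 4 64, .add 4 3 4, .const 3 1, .add 3 0 3, .const 5 0]))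

/-- The cell where the arrays begin. -/
def baseCell (n : ℕ) : ℕ := n * n + 128 * n + 64

theorem prologue_runs {s n : ℕ} {m : Mem} (hn : 1 ≤ n) (hs : baseCell n ≤ s) (h0 : m 0 = n) :
    RunsIn prologue s 194 m fun m' => m' 3 = (n + 1 : ℕ) ∧ m' 4 = baseCell n ∧ m' 5 = 0 ∧
      (∀ a < 60, m' (n * n + (68 + a) * n) = m (4 + a)) ∧
      ∀ c, (c < 3 ∨ 64 ≤ c) → (∀ a < 60, c ≠ n * n + (68 + a) * n) → m' c = m c := by
  have hs4 : 64 ≤ s := by unfold baseCell at hs; omega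
  have hdest : ∀ a, 68 ≤ n * n + (68 + a) * n := fun a => by nlinarith [Nat.zero_le (a * n)]
  refine RunsIn.cat (T₁ := 1) (T₂ := 193)
    (Q₁ := fun m1 => m1 = Function.update m 3 ((n * n : ℕ) : ℝ))
    (RunsIn.effect (i := .mul 3 0 0) rfl (show 4 ≤ s by omega) (by simp [h0])) ?_
  rintro _ rfl
  refine RunsIn.cat (T₁ := 68) (T₂ := 125) (advanceCode_runs 68 (by omega) (n := n) (y := n * n)
    (by simpa using h0) (by simp)) ?_
  rintro _ rfl
  rw [Function.update_idem]
  refine RunsIn.cat (T₁ := 120) (T₂ := 5) (saveCode_runs 60 hn le_rfl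
    (by unfold baseCell at hs; omega) (by simpa using h0) (by simp)) ?_
  rintro m1 ⟨g3, gs, gc⟩
  have g0 : m1 0 = n := by
    rw [gc 0 (by norm_num) fun a _ => by have := hdest a; omega]
    simpa using h0
  refine RunsIn.effects (s := s)
    (c := [.const 4 64, .add 4 3 4, .const 3 1, .add 3 0 3, .const 5 0]) rfl ?_
    ⟨?_, ?_, ?_, fun a ha => ?_, fun c hc hca => ?_⟩
  · simp [Instr.bound]; omega
  · simp [g0]
  · simp [g3, baseCell]
  · simp
  · have := hdest a
    have h2 := gs a ha
    simp only [ne_eq, show n * n + (68 + a) * n ≠ 3 by omega,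
      show n * n + (68 + a) * n ≠ 4 by omega,
      show n * n + (68 + a) * n ≠ 5 by omega, not_false_eq_true, Function.update_of_ne, h2,
      show 4 + a ≠ 3 by omega]
  · have h3 : c ≠ 3 := by omega
    have := gc c h3 hca
    simp only [ne_eq, h3, show c ≠ 4 by omega, show c ≠ 5 by omega, not_false_eq_true,
      Function.update_of_ne, this]

/-! ## The program -/

def answerE : Ex := bestE.le (.lit 2 * .inp (.lit 2))

def frontCode : List Instr :=
  -- Variables outside of their loops share register `5`, which holds `0`. The registers from `6` on
  -- are free for computation.
  cat prologue (cat (mainSt.code (fun _ => 5) 6) (answerE.code (fun _ => 5) 6))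

def haltCode : List Instr := [.const 7 1, .jumpLE 7 6 3, .halt false, .halt true]

/-- The program that decides MinIGL on trees. -/
def program : Program := cat frontCode haltCode

def spaceBound (n : ℕ) : ℕ := baseCell n + arrCount * (n + 1) ^ 3

/-- The additional factor makes this a bound for `n + 1` as well as for `(n + 1)^(cutoff n)`, the
two largest numbers of rounds needed. -/
def roundBound (n : ℕ) : ℕ := (n + 1) ^ (cutoff n + 1)

def timeBound (B : ℕ) : ℕ := 194 + (mainSt.cost B + answerE.cost B)

theorem input_adj {n : ℕ} (T : SimpleGraph (Fin n)) (k : ℕ) (τ : ℝ) (i j : Fin n) :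
    input T k τ (3 + i * n + j) = flag (T.Adj i j) := by
  have h1 : 3 + (i : ℕ) * n + j = (i * n + j) + 3 := by ring
  rw [h1]
  simp only [input, flag]
  by_cases hadj : T.Adj i j
  · rw [if_pos hadj, if_pos ⟨i, j, by rw [Nat.mul_comm], hadj⟩]
  · rw [if_neg hadj, if_neg]
    rintro ⟨i', j', h, hadj'⟩
    rw [Nat.mul_comm n] at h
    obtain ⟨h2, h3⟩ := mul_add_inj j.2 j'.2 h
    exact hadj (by rwa [Fin.ext h2, Fin.ext h3])

theorem input_eq_zero {n : ℕ} (T : SimpleGraph (Fin n)) (k : ℕ) (τ : ℝ) {c : ℕ}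
    (hc : n * n + 3 ≤ c) : input T k τ c = 0 := by
  obtain ⟨a, rfl⟩ : ∃ a, c = a + 3 := ⟨c - 3, by omega⟩
  simp only [input]
  refine if_neg ?_
  rintro ⟨i, j, h, -⟩
  have h1 := i.2
  have h2 := j.2
  nlinarith

/-- After the prologue, the input can be read at its new places. -/
theorem input_moved {n : ℕ} {T : SimpleGraph (Fin n)} {k : ℕ} {τ : ℝ} {m : Mem} (hn : 1 ≤ n)
    (hsave : ∀ a < 60, m (n * n + (68 + a) * n) = input T k τ (4 + a))
    (hkeep : ∀ c, (c < 3 ∨ 64 ≤ c) → (∀ a < 60, c ≠ n * n + (68 + a) * n) → m c = input T k τ c)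
    (i j : Fin n) : (regCount ≤ inputAddr n i j ∧ inputAddr n i j < baseCell n) ∧
      m (inputAddr n i j) = flag (T.Adj i j) := by
  have hdest : ∀ a, n * n + 68 * n ≤ n * n + (68 + a) * n := fun a =>
    Nat.add_le_add_left (Nat.mul_le_mul_right _ (by omega)) _
  have hdest' : ∀ a < 60, n * n + (68 + a) * n < baseCell n := fun a ha => by
    have := Nat.mul_le_mul_right n (show 68 + a ≤ 128 by omega)
    unfold baseCell
    omega
  have hx : (i : ℕ) * n + j + 1 ≤ n * n := by
    have h1 := i.2
    have h2 := j.2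
    nlinarith
  rw [← input_adj T k τ]
  unfold inputAddr regCount
  split_ifs with h
  · refine ⟨⟨h, ?_⟩, hkeep _ (Or.inr h) fun a _ => ?_⟩
    · unfold baseCell; omega
    · have := hdest a; omega
  -- Cell `3` was used as the pointer and never copied. It held the diagonal entry of vertex `0`,
  -- which is `0`, and its new place `n^2 + 67 n` is an untouched cell that also holds `0`.
  · by_cases hx0 : (i : ℕ) * n + j = 0
    · have e1 : 3 + (i : ℕ) * n + j = 3 := by omega
      have hin := input_adj T k τ i j
      rw [e1] at hin ⊢
      refine ⟨⟨by nlinarith, by unfold baseCell; omega⟩, ?_⟩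
      rw [hkeep _ (Or.inr (by nlinarith)) fun a _ => by have := hdest a; omega,
        input_eq_zero T k τ (by omega), hin, flag_false]
      have hj0 : (j : ℕ) = 0 := by omega
      have hi0 : (i : ℕ) = 0 := by
        rcases Nat.mul_eq_zero.1 (show (i : ℕ) * n = 0 by omega) with h | h <;> omega
      rw [show i = j from Fin.ext (hi0.trans hj0.symm)]
      exact T.loopless.irrefl j
    · obtain ⟨a, ha⟩ : ∃ a, 3 + (i : ℕ) * n + j = 4 + a := ⟨i * n + j - 1, by omega⟩
      have h64 : 64 + (4 + a) = 68 + a := by omega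
      rw [ha, h64]
      have h1 := hdest a
      exact ⟨⟨by nlinarith, hdest' a (by omega)⟩, hsave a (by omega)⟩

theorem mainSt_regs : 6 + mainSt.regs ≤ regCount := by decide

theorem answerE_regs : 6 + answerE.regs ≤ regCount := by decide

theorem algorithm_runs {C : Ctx} {n : ℕ} {T : SimpleGraph (Fin n)} {r : Fin n} {m : Mem} {k : ℕ}
    (hs : Std C T (cutoff n) r) (hk : C.imm 1 = (k : ℕ))
    (hadj : ∀ i j : Fin n, C.Readable (inputAddr n i j) ∧
      C.imm (inputAddr n i j) = flag (T.Adj i j))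
    (hrep : Rep C 6 (fun _ => 5) (fun _ => 0) (fun _ _ _ _ => 0) m) :
    RunsIn (cat (mainSt.code (fun _ => 5) 6) (answerE.code (fun _ => 5) 6)) C.space
      (mainSt.cost C.bd + answerE.cost C.bd) m fun m' => m' 6 = flag (T.MinIGL k (C.imm 2)) := by
  refine RunsIn.cat (mainSt.runs hrep (wp_mainSt hs hadj) mainSt_regs) ?_
  rintro m1 ⟨⟨H, hrep1, hsound, hset⟩, -⟩
  have h2 : (Ex.inp (.lit 2)).Ok C H (fun _ => 0) := ⟨trivial, 2, by simp, Or.inl (by norm_num)⟩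
  refine (answerE.runs hrep1 (L := 6) ?_ answerE_regs).mono le_rfl ?_
  · simp [answerE, ok_bestE hs, h2]
  rintro m2 ⟨hm2, -⟩
  have e3 : (Ex.inp (.lit 2)).eval C H (fun _ => 0) = C.imm 2 := by
    simp only [Ex.eval]
    congr 1
    simp
  have := bestE_le_iff hs (ρ := fun _ => 0) hk hsound fun S hS =>
    hset S (encodable_of_optimal hs.tree hS)
  rw [hm2, answerE, Ex.eval_le, Ex.eval_mul, e3, Ex.eval_lit]
  exact flag_congr (by exact_mod_cast this)

theorem frontCode_runs {n : ℕ} {T : SimpleGraph (Fin n)} (hT : T.IsTree) (k : ℕ) (τ : ℝ) :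
    RunsIn frontCode (spaceBound n) (timeBound (roundBound n)) (input T k τ) fun m =>
      m 6 = flag (T.MinIGL k τ) := by
  obtain ⟨r⟩ := hT.1.nonempty
  have hn : 1 ≤ n := r.pos
  have hbase : regCount ≤ baseCell n := by unfold baseCell regCount; omega
  unfold frontCode timeBound
  refine RunsIn.cat (prologue_runs hn (Nat.le_add_right _ _) rfl) ?_
  rintro m ⟨h3, h4, h5, hsave, hkeep⟩
  have hkeep0 : ∀ c < 3, m c = input T k τ c := fun c hc =>
    hkeep c (Or.inl hc) fun a _ => by nlinarith [Nat.zero_le (a * n)]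
  obtain ⟨C, hCn, hCb, hCbd, hCi⟩ : ∃ C : Ctx, C.n = n ∧ C.base = baseCell n ∧
      C.bd = roundBound n ∧ C.imm = m :=
    ⟨⟨n, baseCell n, roundBound n, m, hbase⟩, rfl, rfl, rfl, rfl⟩
  have hspace : spaceBound n = C.space := by rw [spaceBound, Ctx.space, hCb, hCn]
  have h2 : C.imm 2 = τ := by rw [hCi]; exact hkeep0 2 (by norm_num)
  rw [hspace, ← hCbd, ← h2]
  refine algorithm_runs (r := ⟨0, hn⟩) ⟨hT, rfl, hCn, ?_, ?_, ?_, cutoff_le n⟩ ?_ (fun i j => ?_) ?_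
  · rw [hCi]; exact hkeep0 0 (by norm_num)
  · rw [hCbd]; exact Nat.le_self_pow (by omega) _
  · rw [hCbd]; exact Nat.pow_le_pow_right (by omega) (by omega)
  · rw [hCi]; exact hkeep0 1 (by norm_num)
  · rw [hCi, Ctx.Readable, hCb]
    have := input_moved hn hsave hkeep i j
    exact ⟨Or.inr this.1, this.2⟩
  · refine ⟨fun _ _ => by rw [hCi], by rw [hCn, h3], by rw [hCb, h4], fun _ => by norm_num,
      fun _ => by simpa using h5, ?_, by norm_num⟩
    intro a _ i _ j _ k' _
    have hb := C.base_le_addr a i j k'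
    rw [hCb] at hb
    rw [hkeep _ (Or.inr (hbase.trans hb)) fun a ha => ?_]
    · refine input_eq_zero T k τ ?_
      unfold baseCell at hb
      omega
    · have := Nat.mul_le_mul_right n (show 68 + a ≤ 128 by omega)
      unfold baseCell at hb
      omega

theorem program_answers {n : ℕ} {T : SimpleGraph (Fin n)} (hT : T.IsTree) (k : ℕ) (τ : ℝ) :
    ∃ (ans : Bool) (t : ℕ), program.Answers (input T k τ) ans t (spaceBound n) ∧
      (ans = true ↔ T.MinIGL k τ) ∧ t ≤ timeBound (roundBound n) + 3 := by
  have hcode : CodeAt program 0 (cat frontCode haltCode) := by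
    intro i ins h
    rw [Nat.zero_add, program, h]
    cases ins <;> simp [Instr.shift]
  have hs : 64 ≤ spaceBound n := by unfold spaceBound baseCell; omega
  obtain ⟨t, ht, m, h1, h2⟩ := frontCode_runs hT k τ program 0 hcode.left
  have hh := hcode.right
  rw [Nat.zero_add] at h1 hh
  set p := frontCode.length
  have h3 : program.Reaches (spaceBound n) ⟨p, m⟩ 1 ⟨p + 1, Function.update m 7 1⟩ :=
    Program.Reaches.single (.const 7 1) (hh 0 _ rfl) (by simp [Instr.cells]; omega)
      (by simp [Instr.exec, Config.write])
  have h4 := reaches_jump (s := spaceBound n) (m := Function.update m 7 1) (hh 1 _ rfl) (by omega)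
    (by omega)
  have h5 := (h1.trans h3).trans h4
  rw [Function.update_self, Function.update_of_ne (by norm_num), h2] at h5
  by_cases hT' : T.MinIGL k τ
  · rw [flag_true hT', if_pos le_rfl] at h5
    exact ⟨true, _, ⟨_, _, rfl, h5, hh 3 _ rfl⟩, by simp [hT'], by omega⟩
  · rw [flag_false hT', if_neg (by norm_num)] at h5
    exact ⟨false, _, ⟨_, _, rfl, h5, hh 2 _ rfl⟩, by simp [hT'], by omega⟩

/-! ## Asymptotics -/

theorem exists_timeBound_le : ∃ K d : ℕ, 1 ≤ K ∧
    ∀ n, timeBound (roundBound n) + 3 ≤ K * roundBound n ^ d := by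
  obtain ⟨K, d, h⟩ := ((PolyBounded.const 194).add
    (mainSt.cost_polyBounded.add answerE.cost_polyBounded)).add (.const 3)
  refine ⟨K + 1, d, by omega, fun n => ?_⟩
  have h1 : 1 ≤ roundBound n := Nat.one_le_pow _ _ (by omega)
  exact (h _ h1).trans (Nat.mul_le_mul_right _ (by omega))

theorem cutoff_le_rpow (n : ℕ) : (cutoff n : ℝ) ≤ 8 * (n : ℝ) ^ (3 / 4 : ℝ) + 1 := by
  rcases Nat.eq_zero_or_pos (cutoff n) with h | h
  · rw [h]
    have : (0 : ℝ) ≤ (n : ℝ) ^ (3 / 4 : ℝ) := by positivity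
    simp only [Nat.cast_zero]
    linarith
  obtain ⟨i, hi⟩ : ∃ i, cutoff n = i + 1 := ⟨cutoff n - 1, by omega⟩
  have hin : i < n := by have := cutoff_le n; omega
  have h1 := (lt_cutoff_iff hin).1 (by omega)
  -- The constant works because `3200 ≤ 8^4`.
  have h2 : (i : ℝ) ^ 4 ≤ (8 * (n : ℝ) ^ (3 / 4 : ℝ)) ^ 4 := by
    rw [mul_pow, ← Real.rpow_natCast ((n : ℝ) ^ (3 / 4 : ℝ)) 4, ← Real.rpow_mul (by positivity)]
    norm_num
    have h3 : (i : ℝ) ^ 4 ≤ 3200 * n ^ 3 := by exact_mod_cast h1.le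
    have h4 : (0 : ℝ) ≤ (n : ℝ) ^ 3 := by positivity
    linarith
  have h3 := le_of_pow_le_pow_left₀ (by norm_num) (by positivity) h2
  rw [hi]
  push_cast
  linarith

/-- Of the factor `log x`, the power `5/6` is kept and the remaining power `1/6` is traded for `2
x^(1/12)`, where `3/4 + 1/12 = 5/6`. -/
theorem rpow_mul_log_le {x : ℝ} (hx : 1 ≤ x) :
    x ^ (3 / 4 : ℝ) * Real.log x ≤ 2 * (x * Real.log x) ^ (5 / 6 : ℝ) := by
  have h0 : 0 ≤ x := by linarith
  have hl := Real.log_nonneg hx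
  have h1 : Real.log x ≤ 2 * x ^ (1 / 2 : ℝ) := by
    have := Real.log_le_rpow_div h0 (show (0 : ℝ) < 1 / 2 by norm_num)
    linarith
  have h2 : Real.log x ^ (1 / 6 : ℝ) ≤ 2 * x ^ (1 / 12 : ℝ) := by
    refine (Real.rpow_le_rpow hl h1 (by norm_num)).trans ?_
    rw [Real.mul_rpow (by norm_num) (by positivity), ← Real.rpow_mul h0]
    norm_num
    refine mul_le_mul_of_nonneg_right ?_ (by positivity)
    calc (2 : ℝ) ^ (1 / 6 : ℝ) ≤ 2 ^ (1 : ℝ) :=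
          Real.rpow_le_rpow_of_exponent_le (by norm_num) (by norm_num)
      _ = 2 := by norm_num
  have h3 : Real.log x = Real.log x ^ (5 / 6 : ℝ) * Real.log x ^ (1 / 6 : ℝ) := by
    rw [← Real.rpow_add_of_nonneg hl (by norm_num) (by norm_num)]
    norm_num
  have h4 : x ^ (5 / 6 : ℝ) = x ^ (3 / 4 : ℝ) * x ^ (1 / 12 : ℝ) := by
    rw [← Real.rpow_add_of_nonneg h0 (by norm_num) (by norm_num)]
    norm_num
  rw [Real.mul_rpow h0 hl, h4]
  calc x ^ (3 / 4 : ℝ) * Real.log x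
      = x ^ (3 / 4 : ℝ) * Real.log x ^ (5 / 6 : ℝ) * Real.log x ^ (1 / 6 : ℝ) := by
        rw [mul_assoc, ← h3]
    _ ≤ x ^ (3 / 4 : ℝ) * Real.log x ^ (5 / 6 : ℝ) * (2 * x ^ (1 / 12 : ℝ)) :=
        mul_le_mul_of_nonneg_left h2 (by positivity)
    _ = _ := by ring

theorem isBigO_logb_roundBound {K d : ℕ} (hK : 1 ≤ K) :
    (fun n : ℕ => Real.logb 2 ((K * roundBound n ^ d : ℕ) : ℝ)) =O[Filter.atTop]
      fun n : ℕ => ((n : ℝ) * Real.log n) ^ (5 / 6 : ℝ) := by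
  have hK' : (0 : ℝ) ≤ Real.log K := Real.log_nonneg (by exact_mod_cast hK)
  refine Asymptotics.IsBigO.of_bound ((2 * Real.log K + 40 * d) / Real.log 2) ?_
  filter_upwards [Filter.eventually_ge_atTop 3] with n hn
  have hn' : (3 : ℝ) ≤ n := by exact_mod_cast hn
  have hl2 : (0 : ℝ) < Real.log 2 := Real.log_pos (by norm_num)
  have hl : 1 ≤ Real.log n := by
    rw [Real.le_log_iff_exp_le (by linarith)]
    have := Real.exp_one_lt_d9
    linarith
  have hp : (1 : ℝ) ≤ (n : ℝ) ^ (3 / 4 : ℝ) := Real.one_le_rpow (by linarith) (by norm_num)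
  have hsucc : Real.log (n + 1) ≤ 2 * Real.log n := by
    rw [← Real.log_rpow (by linarith)]
    refine Real.log_le_log (by linarith) ?_
    norm_num
    nlinarith
  have hB : 1 ≤ roundBound n := Nat.one_le_pow _ _ (by omega)
  have hval : Real.log ((K * roundBound n ^ d : ℕ) : ℝ) =
      Real.log K + d * ((cutoff n + 1) * Real.log (n + 1)) := by
    have h1 : ((roundBound n : ℕ) : ℝ) = ((n : ℝ) + 1) ^ (cutoff n + 1) := by
      unfold roundBound; push_cast; rfl
    have hK0 : (K : ℝ) ≠ 0 := by
      have : K ≠ 0 := by omega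
      exact_mod_cast this
    push_cast
    rw [h1, Real.log_mul hK0 (by positivity), Real.log_pow, Real.log_pow]
    push_cast
    ring
  have hcut : ((cutoff n : ℝ) + 1) * Real.log (n + 1) ≤
      20 * ((n : ℝ) ^ (3 / 4 : ℝ) * Real.log n) := by
    have h1 := cutoff_le_rpow n
    -- The two extra units are absorbed since `n^(3/4) ≥ 1`, and `log (n + 1) ≤ 2 log n`.
    calc ((cutoff n : ℝ) + 1) * Real.log (n + 1)
        ≤ (10 * (n : ℝ) ^ (3 / 4 : ℝ)) * (2 * Real.log n) := by
          refine mul_le_mul (by linarith) hsucc (Real.log_nonneg (by linarith)) (by positivity)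
      _ = _ := by ring
  have hmain := rpow_mul_log_le (x := n) (by linarith)
  have hone : (1 : ℝ) ≤ (n : ℝ) ^ (3 / 4 : ℝ) * Real.log n := one_le_mul_of_one_le_of_one_le hp hl
  set y := ((n : ℝ) * Real.log n) ^ (5 / 6 : ℝ) with hy
  have hy0 : 0 ≤ y := by positivity
  have hnn : 0 ≤ Real.log ((K * roundBound n ^ d : ℕ) : ℝ) := by
    refine Real.log_nonneg ?_
    exact_mod_cast Nat.one_le_iff_ne_zero.2 (by positivity)
  rw [Real.logb, Real.norm_of_nonneg (div_nonneg hnn hl2.le), Real.norm_of_nonneg hy0,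
    div_mul_eq_mul_div]
  refine div_le_div_of_nonneg_right ?_ hl2.le
  rw [hval]
  have h1 : (d : ℝ) * ((cutoff n + 1) * Real.log (n + 1)) ≤ d * (40 * y) :=
    mul_le_mul_of_nonneg_left (by linarith) (by positivity)
  nlinarith

theorem isBigO_spaceBound :
    (fun n : ℕ => (spaceBound n : ℝ)) =O[Filter.atTop] fun n : ℕ => (n : ℝ) ^ 3 := by
  refine Asymptotics.IsBigO.of_bound 385 ?_
  filter_upwards [Filter.eventually_ge_atTop 1] with n hn
  rw [Real.norm_of_nonneg (by positivity), Real.norm_of_nonneg (by positivity)]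
  -- The constant is `1 + 128 + 64 + 24 * 8`, from `n + 1 ≤ 2 n`.
  have h1 : spaceBound n ≤ 385 * n ^ 3 := by
    unfold spaceBound baseCell arrCount
    have h2 : n + 1 ≤ 2 * n := by omega
    have h3 := Nat.pow_le_pow_left h2 3
    have h4 : n * n ≤ n ^ 3 := by
      calc n * n = n ^ 2 := by ring
        _ ≤ n ^ 3 := Nat.pow_le_pow_right hn (by norm_num)
    have h5 : n ≤ n ^ 3 := Nat.le_self_pow (by norm_num) n
    have h6 : (2 * n) ^ 3 = 8 * n ^ 3 := by ring
    omega
  exact_mod_cast h1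

end RealRAM

theorem theorem2 :
    ∃ (P : RealRAM.Program) (g : ℕ → ℝ) (s : ℕ → ℕ),
      (g =O[Filter.atTop] fun n : ℕ => ((n : ℝ) * Real.log n) ^ (5 / 6 : ℝ)) ∧
      ((fun n : ℕ => (s n : ℝ)) =O[Filter.atTop] fun n : ℕ => (n : ℝ) ^ 3) ∧
      ∀ (n : ℕ) (T : SimpleGraph (Fin n)), T.IsTree → ∀ (k : ℕ) (τ : ℝ),
        ∃ (ans : Bool) (t : ℕ),
          P.Answers (RealRAM.input T k τ) ans t (s n) ∧
          (ans = true ↔ T.MinIGL k τ) ∧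
          (t : ℝ) ≤ (2 : ℝ) ^ g n := by
  obtain ⟨K, d, hK, hKd⟩ := RealRAM.exists_timeBound_le
  -- The exponent `g` is the binary logarithm of the explicit time bound, so the estimate holds for
  -- every `n`, and only the growth of `g` is asymptotic.
  refine ⟨RealRAM.program, _, RealRAM.spaceBound, RealRAM.isBigO_logb_roundBound (d := d) hK,
    RealRAM.isBigO_spaceBound, fun n T hT k τ => ?_⟩
  obtain ⟨ans, t, h1, h2, h3⟩ := RealRAM.program_answers hT k τ
  refine ⟨ans, t, h1, h2, ?_⟩
  have hpos : 0 < K * RealRAM.roundBound n ^ d :=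
    Nat.mul_pos (by omega) (Nat.pow_pos (Nat.pow_pos (by omega)))
  rw [Real.rpow_logb (by norm_num) (by norm_num) (by exact_mod_cast hpos)]
  exact_mod_cast h3.trans (hKd n)
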